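/- Let $q\in\mathbb C$ with $|q|=1$ and $q\notin\{\pm1,\pm i\}$. **Quantum groups.** $\mathcal A=\mathrm{Fun}_q(GL(3,\mathbb C))$ is the complex unital algebra generated by $z^i{}_j$ ($1\le i,j\le 3$) and $\mathcal D^{-1}$ with relations $z^i{}_jz^i{}_k=q\,z^i{}_kz^i{}_j$ ($j<k$), $z^i{}_jz^k{}_j=q\,z^k{}_jz^i{}_j$ ($i<k$), $z^i{}_jz^k{}_l=z^k{}_lz^i{}_j$ ($i<k$, $j>l$), $z^i{}_jz^k{}_l=z^k{}_lz^i{}_j+(q-q^{-1})z^k{}_jz^i{}_l$ ($i<k$, $j<l$), and $\mathcal D\mathcal D^{-1}=\mathcal D^{-1}\mathcal D=1$, where $\mathcal D=z^1{}_1z^2{}_2z^3{}_3+q^2z^1{}_2z^2{}_3z^3{}_1+q^2z^1{}_3z^2{}_1z^3{}_2-q\,z^1{}_1z^2{}_3z^3{}_2-q^3z^1{}_3z^2{}_2z^3{}_1-q\,z^1{}_2z^2{}_1z^3{}_3$ is the quantum determinant. It is a Hopf algebra with $\Delta(z^i{}_j)=\sum_k z^i{}_k\otimes z^k{}_j$,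 $\varepsilon(z^i{}_j)=\delta^i{}_j$ and antipode $S$. $\mathrm{Fun}_q(SL(3,\mathbb C))$ is its quotient by $\mathcal D=1$. $GL_q(3,\mathbb R)$ and $SL_q(3,\mathbb R)$ denote these Hopf algebras with the antilinear antimultiplicative involution $*$ determined by $(z^i{}_j)^*=z^i{}_j$ (and $(\mathcal D^{-1})^*=\mathcal D^{-1}$). **Calculi.** A first order differential calculus over an algebra is a bimodule $\Gamma$ with a linear map $\mathrm d$ that satisfies $\mathrm d(ab)=(\mathrm da)b+a\,\mathrm db$ and whose image generates $\Gamma$ as a left module. It is bicovariant if there are linear maps $\Delta_L,\Delta_R$ on $\Gamma$ with $\Delta_L(a\,\mathrm db)=\Delta(a)(\mathrm{id}\otimes\mathrm d)\Delta(b)$ and $\Delta_R(a\,\mathrm db)=\Delta(a)(\mathrm d\otimes\mathrm{id})\Delta(b)$. In all that follows a "bicovariant calculus" is moreover required to have the nine differentials $\mathrm dz^i{}_j$ as a basis of $\Gamma$ as a left module. A $*$-calculus is one on which $*$ extends to an antilinear involution of $\Gamma$ with $(a\rho)^*=\rho^*a^*$, $(\rho a)^*=a^*\rho^*$, $(\mathrm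 da)^*=\mathrm d(a^*)$. Calculi are equivalent if a bimodule isomorphism intertwines their differentials. A bicovariant calculus over $SL_q(3)$ is induced from $GL_q(3)$ if it is a quotient (compatibly with the algebra projection, the bimodule structures and $\mathrm d$) of a bicovariant calculus over $GL_q(3)$. **The two families.** Put $\theta^i{}_j=\sum_kS(z^i{}_k)\,\mathrm dz^k{}_j$, $\tau=q^4\theta^1{}_1+q^2\theta^2{}_2+\theta^3{}_3$, $N=q^4(q^2+1)(t-1)-q^2+t$, $\hat N=q^4(q^2t-1)+(q^2+1)(t-1)$, $\sigma=(q^2-t)(t-1)/N$, $\beta=t(q^2-1)(t-1)/N$, $\hat\sigma=-(q^2t-1)(t-1)/\hat N$, $\hat\beta=-t(q^2-1)(t-1)/\hat N$. The parameter $t\in\mathbb C\setminus\{0\}$ is admissible for $\nu=1$ if $(q^6+q^4+1)t\ne q^6+q^4+q^2$, and for $\nu=2$ if $(q^6+q^2+1)t\ne q^4+q^2+1$. A bicovariant calculus over $GL_q(3)$ or $SL_q(3)$ is a $\Gamma_1(t)$ ($t$ admissible for $\nu=1$) if - $(\mathrm dz^i{}_j)z^i{}_j=(\tfrac t{q^2}+t-1)z^i{}_j\mathrm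 dz^i{}_j+\sigma z^i{}_jz^i{}_j\tau$; - $(\mathrm dz^i{}_j)z^i{}_l=\tfrac tq z^i{}_l\mathrm dz^i{}_j+(t-1)z^i{}_j\mathrm dz^i{}_l+\sigma z^i{}_jz^i{}_l\tau$ for $j<l$; - $(\mathrm dz^i{}_j)z^k{}_j=\tfrac tq z^k{}_j\mathrm dz^i{}_j+(t-1)z^i{}_j\mathrm dz^k{}_j+\sigma z^i{}_jz^k{}_j\tau$ for $i<k$; - $(\mathrm dz^i{}_j)z^k{}_l=tz^k{}_l\mathrm dz^i{}_j+(t-1)z^i{}_j\mathrm dz^k{}_l+\sigma z^i{}_jz^k{}_l\tau-\beta(z^i{}_jz^k{}_l-qz^i{}_lz^k{}_j)\tau$ for $i<k$, $j<l$; - $(\mathrm dz^i{}_j)z^k{}_l=tz^k{}_l\mathrm dz^i{}_j+(t-1)z^i{}_j\mathrm dz^k{}_l+\sigma z^i{}_jz^k{}_l\tau-t(q-\tfrac1q)z^k{}_j\mathrm dz^i{}_l+q\beta(z^i{}_lz^k{}_j-qz^i{}_jz^k{}_l)\tau$ for $i<k$, $j>l$; and a $\Gamma_2(t)$ ($t$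 admissible for $\nu=2$) if - $(\mathrm dz^i{}_j)z^i{}_j=(tq^2+t-1)z^i{}_j\mathrm dz^i{}_j+\hat\sigma z^i{}_jz^i{}_j\tau$; - $(\mathrm dz^i{}_j)z^i{}_l=tq\,z^i{}_l\mathrm dz^i{}_j+(tq^2-1)z^i{}_j\mathrm dz^i{}_l+\hat\sigma z^i{}_jz^i{}_l\tau$ for $j<l$; - $(\mathrm dz^i{}_j)z^k{}_j=tq\,z^k{}_j\mathrm dz^i{}_j+(tq^2-1)z^i{}_j\mathrm dz^k{}_j+\hat\sigma z^i{}_jz^k{}_j\tau$ for $i<k$; - $(\mathrm dz^i{}_j)z^k{}_l=tz^k{}_l\mathrm dz^i{}_j+(t-1)z^i{}_j\mathrm dz^k{}_l+\hat\sigma z^i{}_jz^k{}_l\tau+t(q-\tfrac1q)(z^i{}_l\mathrm dz^k{}_j+z^k{}_j\mathrm dz^i{}_l)+t(q-\tfrac1q)^2z^i{}_j\mathrm dz^k{}_l-\tfrac1{q^2}\hat\beta(z^i{}_jz^k{}_l-qz^i{}_lz^k{}_j)\tau$ for $i<k$, $j<l$; - $(\mathrm dz^i{}_j)z^k{}_l=tz^k{}_l\mathrm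 dz^i{}_j+(t-1)z^i{}_j\mathrm dz^k{}_l+\hat\sigma z^i{}_jz^k{}_l\tau+t(q-\tfrac1q)z^i{}_l\mathrm dz^k{}_j+\tfrac1q\hat\beta(z^i{}_lz^k{}_j-qz^i{}_jz^k{}_l)\tau$ for $i<k$, $j>l$. **Statement.** 1. A bicovariant calculus over $GL_q(3,\mathbb R)$ is a $*$-calculus if and only if it is a $\Gamma_\nu(t)$ with $\nu\in\{1,2\}$, $t$ admissible for $\nu$ and $|t|=1$. For each such $\nu,t$ a $\Gamma_\nu(t)$ exists and is unique up to equivalence. 2. All bicovariant calculi over $SL_q(3)$ induced from $GL_q(3)$ are $*$-calculi over $SL_q(3,\mathbb R)$. Up to equivalence these are exactly the pairwise inequivalent calculi $\Gamma_1(t)$ with $t^3=q^2$ and $\Gamma_2(t)$ with $t^3=q^{-2}$, $t$ admissible; for generic $q$, namely whenever $q^4\neq-1$, there are exactly six of them. -/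

import Mathlib

open scoped TensorProduct
open MulOpposite (op unop)

universe u v

/-! ## First order differential calculi -/

/-- A first order differential calculus over a complex algebra `A`: an `A`-bimodule `Form` (the
right action of `a` is the action of `op a`) with a linear map `d` that satisfies the Leibniz rule
and whose image generates `Form` as a left module. -/
structure Calculus (A : Type) [Ring A] [Algebra ℂ A] where
  Form : Type u
  [addCommGroup : AddCommGroup Form]
  [moduleComplex : Module ℂ Form]
  [moduleLeft : Module A Form]
  [moduleRight : Module Aᵐᵒᵖ Form]
  [towerLeft : IsScalarTower ℂ A Form]
  [towerRight : IsScalarTower ℂ Aᵐᵒᵖ Form]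
  [bimodule : SMulCommClass A Aᵐᵒᵖ Form]
  d : A →ₗ[ℂ] Form
  leibniz : ∀ a b : A, d (a * b) = op b • d a + a • d b
  span_range_d : Submodule.span A (Set.range d) = ⊤

namespace Calculus

attribute [instance] addCommGroup moduleComplex moduleLeft moduleRight towerLeft towerRight bimodule

section Basic

variable {A : Type} [Ring A] [Algebra ℂ A]

/-- Equivalence of calculi: a bimodule isomorphism that intertwines the differentials. -/
def Equivalent (C : Calculus.{u} A) (C' : Calculus.{v} A) : Prop :=
  ∃ ζ : C.Form ≃ₗ[ℂ] C'.Form,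
    (∀ (a : A) (ρ : C.Form), ζ (a • ρ) = a • ζ ρ) ∧
    (∀ (a : A) (ρ : C.Form), ζ (op a • ρ) = op a • ζ ρ) ∧
    (∀ a : A, ζ (C.d a) = C'.d a)

/-- The left action of `A` on one-forms, as a bilinear map. -/
noncomputable def leftAction (C : Calculus.{u} A) : A →ₗ[ℂ] C.Form →ₗ[ℂ] C.Form :=
  (Algebra.lsmul ℂ ℂ C.Form : A →ₐ[ℂ] Module.End ℂ C.Form).toLinearMap

/-- A `*`-calculus with respect to a `*`-operation `s` on `A`: `s` extends to an antilinear
involution of the one-forms that reverses products and commutes with `d`. -/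
def IsStarCalculus (s : A → A) (C : Calculus.{u} A) : Prop :=
  ∃ σ : C.Form →ₛₗ[starRingEnd ℂ] C.Form,
    (∀ ρ, σ (σ ρ) = ρ) ∧
    (∀ (a : A) (ρ : C.Form), σ (a • ρ) = op (s a) • σ ρ) ∧
    (∀ (a : A) (ρ : C.Form), σ (op a • ρ) = s a • σ ρ) ∧
    (∀ a : A, σ (C.d a) = C.d (s a))

/-- The differentials of the matrix entries `z i j` form a basis of the left module of
one-forms. -/
def HasBasis (z : Fin 3 → Fin 3 → A) (C : Calculus.{u} A) : Prop :=
  LinearIndependent A (fun p : Fin 3 × Fin 3 => C.d (z p.1 p.2)) ∧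
    Submodule.span A (Set.range fun p : Fin 3 × Fin 3 => C.d (z p.1 p.2)) = ⊤

end Basic

/-- Bicovariance: there are linear coactions `ΔL`, `ΔR` with
`ΔL (a db) = Δ(a) (id ⊗ d) Δ(b)` and `ΔR (a db) = Δ(a) (d ⊗ id) Δ(b)`. -/
def IsBicovariant {A : Type} [Ring A] [Bialgebra ℂ A] (C : Calculus.{u} A) : Prop :=
  (∃ ΔL : C.Form →ₗ[ℂ] A ⊗[ℂ] C.Form, ∀ a b : A,
    ΔL (a • C.d b) =
      TensorProduct.map₂ (LinearMap.mul ℂ A) C.leftAction (Coalgebra.comul (R := ℂ) a)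
        (TensorProduct.map LinearMap.id C.d (Coalgebra.comul (R := ℂ) b))) ∧
  (∃ ΔR : C.Form →ₗ[ℂ] C.Form ⊗[ℂ] A, ∀ a b : A,
    ΔR (a • C.d b) =
      TensorProduct.map₂ C.leftAction (LinearMap.mul ℂ A) (Coalgebra.comul (R := ℂ) a)
        (TensorProduct.map C.d LinearMap.id (Coalgebra.comul (R := ℂ) b)))

end Calculus

/-! ## Quantum matrices -/

section QuantumMatrix

variable {B : Type} [Ring B] [Algebra ℂ B]

/-- The commutation relations of the entries of a quantum `3 × 3` matrix. -/
structure IsQuantumMatrix (q : ℂˣ) (z : Fin 3 → Fin 3 → B) : Prop where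
  row : ∀ i j k, j < k → z i j * z i k = (q : ℂ) • (z i k * z i j)
  col : ∀ i k j, i < k → z i j * z k j = (q : ℂ) • (z k j * z i j)
  anti : ∀ i k j l, i < k → l < j → z i j * z k l = z k l * z i j
  diag : ∀ i k j l, i < k → j < l →
    z i j * z k l = z k l * z i j + ((q : ℂ) - (q : ℂ)⁻¹) • (z k j * z i l)

/-- The quantum determinant. -/
noncomputable def qdet (q : ℂˣ) (z : Fin 3 → Fin 3 → B) : B :=
  z 0 0 * z 1 1 * z 2 2 + (q : ℂ) ^ 2 • (z 0 1 * z 1 2 * z 2 0)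
    + (q : ℂ) ^ 2 • (z 0 2 * z 1 0 * z 2 1) - (q : ℂ) • (z 0 0 * z 1 2 * z 2 1)
    - (q : ℂ) ^ 3 • (z 0 2 * z 1 1 * z 2 0) - (q : ℂ) • (z 0 1 * z 1 0 * z 2 2)

/-- The matrix `S(Z)` of antipodes of the entries of the quantum matrix `z`, where `w` is the
inverse of the quantum determinant. -/
noncomputable def antipodeMatrix (q : ℂˣ) (z : Fin 3 → Fin 3 → B) (w : B) : Matrix (Fin 3) (Fin 3) B :=
  !![w * (z 1 1 * z 2 2 - (q : ℂ) • (z 1 2 * z 2 1)),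
      w * (-((q : ℂ)⁻¹ • (z 0 1 * z 2 2)) + z 0 2 * z 2 1),
      w * (((q : ℂ)⁻¹) ^ 2 • (z 0 1 * z 1 2) - (q : ℂ)⁻¹ • (z 0 2 * z 1 1));
    w * (-((q : ℂ) • (z 1 0 * z 2 2)) + (q : ℂ) ^ 2 • (z 1 2 * z 2 0)),
      w * (z 0 0 * z 2 2 - (q : ℂ) • (z 0 2 * z 2 0)),
      w * (-((q : ℂ)⁻¹ • (z 0 0 * z 1 2)) + z 0 2 * z 1 0);
    w * ((q : ℂ) ^ 2 • (z 1 0 * z 2 1) - (q : ℂ) ^ 3 • (z 1 1 * z 2 0)),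
      w * (-((q : ℂ) • (z 0 0 * z 2 1)) + (q : ℂ) ^ 2 • (z 0 1 * z 2 0)),
      w * (z 0 0 * z 1 1 - (q : ℂ) • (z 0 1 * z 1 0))]

end QuantumMatrix

namespace IsQuantumMatrix

variable {B : Type} [Ring B] [Algebra ℂ B] {q : ℂˣ} {z x y : Fin 3 → Fin 3 → B}

theorem map {B' : Type} [Ring B'] [Algebra ℂ B'] (h : IsQuantumMatrix q z) (f : B →ₐ[ℂ] B') :
    IsQuantumMatrix q (fun i j => f (z i j)) where
  row i j k hjk := by simp only [← map_mul, ← map_smul, h.row i j k hjk]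
  col i k j hik := by simp only [← map_mul, ← map_smul, h.col i k j hik]
  anti i k j l hik hlj := by simp only [← map_mul, h.anti i k j l hik hlj]
  diag i k j l hik hjl := by
    simp only [← map_mul, ← map_smul, ← map_add, h.diag i k j l hik hjl]

/-- Coefficients of the relations in the form `R̂ Z₁ Z₂ = Z₁ Z₂ R̂`. -/
noncomputable def rDiag (q : ℂˣ) (a b : Fin 3) : ℂ :=
  if a = b then (q : ℂ) else if a < b then (q : ℂ) - (q : ℂ)⁻¹ else 0

noncomputable def rOff (a b : Fin 3) : ℂ := if a = b then 0 else 1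

theorem rOff_comm (a b : Fin 3) : rOff a b = rOff b a := by
  simp only [rOff, eq_comm]

theorem rtt (h : IsQuantumMatrix q z) (a b e f : Fin 3) :
    rDiag q a b • (z a e * z b f) + rOff a b • (z b e * z a f) =
      rDiag q e f • (z a e * z b f) + rOff e f • (z a f * z b e) := by
  have hq : (q : ℂ) ≠ 0 := q.ne_zero
  rcases lt_trichotomy a b with hab | rfl | hab <;> rcases lt_trichotomy e f with hef | rfl | hef
  · simp [rDiag, rOff, hab, hef, hab.ne, hef.ne, h.anti a b f e hab hef]
  · simp only [rDiag, rOff, hab, hab.ne, if_true, if_false, h.col a b e hab, lt_irrefl]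
    match_scalars
    field_simp
    ring
  · simp only [rDiag, rOff, hab, hab.ne, hef.ne', if_true, if_false, not_lt.2 hef.le,
      h.anti a b e f hab hef, h.diag a b f e hab hef]
    module
  · simp only [rDiag, rOff, hef, hef.ne, if_true, if_false, h.row a e f hef, lt_irrefl]
    match_scalars
    field_simp
    ring
  · simp only [rDiag, rOff, if_true]
  · simp only [rDiag, rOff, hef.ne', if_true, if_false, h.row a f e hef, lt_irrefl,
      not_lt.2 hef.le]
    module
  · simp only [rDiag, rOff, hef, hab.ne', hef.ne, if_true, if_false, not_lt.2 hab.le,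
      h.diag b a e f hab hef]
    module
  · simp only [rDiag, rOff, hab.ne', if_true, if_false, h.col b a e hab, lt_irrefl,
      not_lt.2 hab.le]
    module
  · simp [rDiag, rOff, hab.ne', hef.ne', not_lt.2 hab.le, not_lt.2 hef.le,
      h.anti b a e f hab hef]

theorem of_rtt (h : ∀ a b e f : Fin 3,
    rDiag q a b • (z a e * z b f) + rOff a b • (z b e * z a f) =
      rDiag q e f • (z a e * z b f) + rOff e f • (z a f * z b e)) : IsQuantumMatrix q z where
  row i j k hjk := by
    have := h i i k j
    simpa [rDiag, rOff, hjk.ne', not_lt.2 hjk.le] using this.symm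
  col i k j hik := by
    have := h k i j j
    simpa [rDiag, rOff, hik.ne', not_lt.2 hik.le] using this
  anti i k j l hik hlj := by
    have := h k i l j
    have h2 := h k i j l
    have h3 := h i k l j
    have h4 := h i k j l
    simp only [rDiag, rOff, hik.ne', hik.ne, hlj.ne, hlj.ne', not_lt.2 hik.le, not_lt.2 hlj.le,
      hik, hlj, if_true, if_false, zero_smul, one_smul, zero_add] at this h2 h3 h4
    exact (add_left_cancel h3).symm
  diag i k j l hik hjl := by
    have h2 := h k i j l
    have h3 := h k i l j
    have h4 := h i k j l
    simp only [rDiag, rOff, hik.ne', hik.ne, hjl.ne, hjl.ne', not_lt.2 hik.le, not_lt.2 hjl.le,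
      hik, hjl, if_true, if_false, zero_smul, one_smul, zero_add] at h2 h3 h4
    rw [h2]
    abel

/-- The product of two quantum matrices whose entries commute with each other. -/
theorem mul (hx : IsQuantumMatrix q x) (hy : IsQuantumMatrix q y)
    (hc : ∀ i j k l, y i j * x k l = x k l * y i j) :
    IsQuantumMatrix q (fun i j => ∑ k, x i k * y k j) := by
  have key : ∀ a b e f : Fin 3, (∑ k, x a k * y k e) * (∑ k, x b k * y k f) =
      ∑ c, ∑ d, x a c * x b d * (y c e * y d f) := by
    intro a b e f
    rw [Finset.sum_mul_sum]
    refine Finset.sum_congr rfl fun c _ => Finset.sum_congr rfl fun d _ => ?_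
    rw [mul_assoc, ← mul_assoc (y c e), hc, mul_assoc, mul_assoc]
  refine of_rtt fun a b e f => ?_
  simp only [key]
  calc _ = ∑ c, ∑ d, (rDiag q a b • (x a c * x b d) + rOff a b • (x b c * x a d))
            * (y c e * y d f) := by
        simp only [Finset.smul_sum, ← Finset.sum_add_distrib, add_mul, smul_mul_assoc]
    _ = ∑ c, ∑ d, (rDiag q c d • (x a c * x b d) + rOff c d • (x a d * x b c))
            * (y c e * y d f) := by simp only [hx.rtt a b]
    _ = (∑ c, ∑ d, rDiag q c d • (x a c * x b d * (y c e * y d f)))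
          + ∑ c, ∑ d, rOff c d • (x a d * x b c * (y c e * y d f)) := by
        simp only [← Finset.sum_add_distrib, add_mul, smul_mul_assoc]
    _ = (∑ c, ∑ d, rDiag q c d • (x a c * x b d * (y c e * y d f)))
          + ∑ c, ∑ d, rOff c d • (x a c * x b d * (y d e * y c f)) := by
        congr 1
        rw [Finset.sum_comm]
        simp only [rOff_comm]
    _ = ∑ c, ∑ d, x a c * x b d *
          (rDiag q c d • (y c e * y d f) + rOff c d • (y d e * y c f)) := by
        simp only [← Finset.sum_add_distrib, mul_add, mul_smul_comm]
    _ = ∑ c, ∑ d, x a c * x b d *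
          (rDiag q e f • (y c e * y d f) + rOff e f • (y c f * y d e)) := by
        simp only [hy.rtt _ _ e f]
    _ = _ := by
        simp only [Finset.smul_sum, ← Finset.sum_add_distrib, mul_add, mul_smul_comm]

/-- The quantum determinant formed from three arbitrary rows. -/
noncomputable def qdetRows (q : ℂˣ) (y : Fin 3 → Fin 3 → B) (k l m : Fin 3) : B :=
  y k 0 * y l 1 * y m 2 + (q : ℂ) ^ 2 • (y k 1 * y l 2 * y m 0)
    + (q : ℂ) ^ 2 • (y k 2 * y l 0 * y m 1) - (q : ℂ) • (y k 0 * y l 2 * y m 1)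
    - (q : ℂ) ^ 3 • (y k 2 * y l 1 * y m 0) - (q : ℂ) • (y k 1 * y l 0 * y m 2)

/-- Quantum minors of size two. -/
noncomputable def minor (q : ℂˣ) (y : Fin 3 → Fin 3 → B) (a b j l : Fin 3) : B :=
  y a j * y b l - (q : ℂ) • (y a l * y b j)

theorem minor_self (h : IsQuantumMatrix q y) (a j l : Fin 3) (hjl : j < l) :
    minor q y a a j l = 0 := by
  rw [minor, h.row a j l hjl, sub_self]

theorem minor_swap (h : IsQuantumMatrix q y) (a b j l : Fin 3) (hab : a < b) (hjl : j < l) :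
    minor q y b a j l = -((q : ℂ) • minor q y a b j l) := by
  have hq : (q : ℂ) ≠ 0 := q.ne_zero
  rw [minor, minor, h.diag a b j l hab hjl, h.anti a b l j hab hjl]
  match_scalars <;> field_simp <;> ring

theorem qdetRows_left (k l m : Fin 3) : qdetRows q y k l m =
    y k 0 * minor q y l m 1 2 - (q : ℂ) • (y k 1 * minor q y l m 0 2)
      + (q : ℂ) ^ 2 • (y k 2 * minor q y l m 0 1) := by
  simp only [qdetRows, minor, mul_sub, mul_smul_comm, ← mul_assoc]
  module

theorem qdetRows_right (k l m : Fin 3) : qdetRows q y k l m =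
    minor q y k l 0 1 * y m 2 - (q : ℂ) • (minor q y k l 0 2 * y m 1)
      + (q : ℂ) ^ 2 • (minor q y k l 1 2 * y m 0) := by
  simp only [qdetRows, minor, sub_mul, smul_mul_assoc]
  module

theorem qdetRows_self_left (h : IsQuantumMatrix q y) (k m : Fin 3) :
    qdetRows q y k k m = 0 := by
  simp [qdetRows_right, h.minor_self]

theorem qdetRows_self_right (h : IsQuantumMatrix q y) (k m : Fin 3) :
    qdetRows q y k m m = 0 := by
  simp [qdetRows_left, h.minor_self]

theorem qdetRows_swap_left (h : IsQuantumMatrix q y) (k l m : Fin 3) (hkl : k < l) :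
    qdetRows q y l k m = -((q : ℂ) • qdetRows q y k l m) := by
  rw [qdetRows_right, qdetRows_right, h.minor_swap k l _ _ hkl (by decide),
    h.minor_swap k l _ _ hkl (by decide), h.minor_swap k l _ _ hkl (by decide)]
  simp only [neg_mul, smul_mul_assoc]
  module

theorem qdetRows_swap_right (h : IsQuantumMatrix q y) (k l m : Fin 3) (hlm : l < m) :
    qdetRows q y k m l = -((q : ℂ) • qdetRows q y k l m) := by
  rw [qdetRows_left, qdetRows_left, h.minor_swap l m _ _ hlm (by decide),
    h.minor_swap l m _ _ hlm (by decide), h.minor_swap l m _ _ hlm (by decide)]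
  simp only [mul_neg, mul_smul_comm]
  module

theorem qdetRows_012 : qdetRows q y 0 1 2 = qdet q y := rfl

theorem qdetRows_021 (h : IsQuantumMatrix q y) :
    qdetRows q y 0 2 1 = -((q : ℂ) • qdet q y) := by
  rw [h.qdetRows_swap_right 0 1 2 (by decide), qdetRows_012]

theorem qdetRows_102 (h : IsQuantumMatrix q y) :
    qdetRows q y 1 0 2 = -((q : ℂ) • qdet q y) := by
  rw [h.qdetRows_swap_left 0 1 2 (by decide), qdetRows_012]

theorem qdetRows_120 (h : IsQuantumMatrix q y) :
    qdetRows q y 1 2 0 = (q : ℂ) ^ 2 • qdet q y := by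
  rw [h.qdetRows_swap_right 1 0 2 (by decide), h.qdetRows_102]
  module

theorem qdetRows_201 (h : IsQuantumMatrix q y) :
    qdetRows q y 2 0 1 = (q : ℂ) ^ 2 • qdet q y := by
  rw [h.qdetRows_swap_left 0 2 1 (by decide), h.qdetRows_021]
  module

theorem qdetRows_210 (h : IsQuantumMatrix q y) :
    qdetRows q y 2 1 0 = -((q : ℂ) ^ 3 • qdet q y) := by
  rw [h.qdetRows_swap_right 2 0 1 (by decide), h.qdetRows_201]
  module

theorem qdet_mul (hy : IsQuantumMatrix q y) (hc : ∀ i j k l, y i j * x k l = x k l * y i j) :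
    qdet q (fun i j => ∑ k, x i k * y k j) = qdet q x * qdet q y := by
  have key : ∀ a b c : Fin 3, (∑ k, x 0 k * y k a) * (∑ k, x 1 k * y k b)
      * (∑ k, x 2 k * y k c) =
      ∑ k, ∑ l, ∑ m, x 0 k * x 1 l * x 2 m * (y k a * y l b * y m c) := by
    intro a b c
    rw [Finset.sum_mul_sum, Finset.sum_mul]
    refine Finset.sum_congr rfl fun k _ => ?_
    rw [Finset.sum_mul]
    refine Finset.sum_congr rfl fun l _ => ?_
    rw [Finset.mul_sum]
    refine Finset.sum_congr rfl fun m _ => ?_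
    have h1 := hc k a 1 l
    have h2 := hc k a 2 m
    have h3 := hc l b 2 m
    calc x 0 k * y k a * (x 1 l * y l b) * (x 2 m * y m c)
        = x 0 k * (y k a * x 1 l) * (y l b * x 2 m) * y m c := by simp only [mul_assoc]
      _ = x 0 k * x 1 l * (y k a * x 2 m) * y l b * y m c := by
          rw [h1, h3]; simp only [mul_assoc]
      _ = _ := by rw [h2]; simp only [mul_assoc]
  have hsum : qdet q (fun i j => ∑ k, x i k * y k j) =
      ∑ k, ∑ l, ∑ m, x 0 k * x 1 l * x 2 m * qdetRows q y k l m := by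
    simp only [qdet, key, qdetRows, mul_add, mul_sub, mul_smul_comm, Finset.sum_add_distrib,
      Finset.sum_sub_distrib, Finset.smul_sum]
  rw [hsum]
  simp only [Fin.sum_univ_three, hy.qdetRows_self_left, hy.qdetRows_self_right, qdetRows_012,
    hy.qdetRows_021, hy.qdetRows_102, hy.qdetRows_120, hy.qdetRows_201, hy.qdetRows_210]
  have h010 : qdetRows q y 0 1 0 = 0 := by
    rw [hy.qdetRows_swap_right 0 0 1 (by decide), hy.qdetRows_self_left, smul_zero, neg_zero]
  have h020 : qdetRows q y 0 2 0 = 0 := by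
    rw [hy.qdetRows_swap_right 0 0 2 (by decide), hy.qdetRows_self_left, smul_zero, neg_zero]
  have h121 : qdetRows q y 1 2 1 = 0 := by
    rw [hy.qdetRows_swap_right 1 1 2 (by decide), hy.qdetRows_self_left, smul_zero, neg_zero]
  have h101 : qdetRows q y 1 0 1 = 0 := by
    rw [hy.qdetRows_swap_left 0 1 1 (by decide), hy.qdetRows_self_right, smul_zero, neg_zero]
  have h202 : qdetRows q y 2 0 2 = 0 := by
    rw [hy.qdetRows_swap_left 0 2 2 (by decide), hy.qdetRows_self_right, smul_zero, neg_zero]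
  have h212 : qdetRows q y 2 1 2 = 0 := by
    rw [hy.qdetRows_swap_left 1 2 2 (by decide), hy.qdetRows_self_right, smul_zero, neg_zero]
  rw [← qdetRows_012 (y := x), h010, h020, h121, h101, h202, h212]
  simp only [qdetRows, mul_zero, add_mul, sub_mul, mul_neg,
    mul_smul_comm, smul_mul_assoc]
  module

/-- The quantum determinant with all products reversed. -/
theorem qdet_reverse (h : IsQuantumMatrix q z) :
    z 2 2 * (z 1 1 * z 0 0) + ((q : ℂ)⁻¹) ^ 2 • (z 2 0 * (z 1 2 * z 0 1))
      + ((q : ℂ)⁻¹) ^ 2 • (z 2 1 * (z 1 0 * z 0 2)) - (q : ℂ)⁻¹ • (z 2 1 * (z 1 2 * z 0 0))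
      - ((q : ℂ)⁻¹) ^ 3 • (z 2 0 * (z 1 1 * z 0 2)) - (q : ℂ)⁻¹ • (z 2 2 * (z 1 0 * z 0 1))
      = qdet q z := by
  have hq : (q : ℂ) ≠ 0 := q.ne_zero
  have h1 : qdet q z = -(((q : ℂ)⁻¹) ^ 3 • qdetRows q z 2 1 0) := by
    rw [h.qdetRows_210, smul_neg, neg_neg, smul_smul, ← mul_pow, inv_mul_cancel₀ hq, one_pow,
      one_smul]
  rw [h1, qdetRows]
  simp only [mul_assoc]
  match_scalars <;> field_simp

end IsQuantumMatrix

/-! ## The opposite algebra with conjugated scalars -/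

/-- The opposite ring of `A`, with the complex scalars acting through complex conjugation. An
algebra homomorphism `A → ConjOp A` is the same thing as an antilinear antihomomorphism
`A → A`. -/
def ConjOp (A : Type) : Type := Aᵐᵒᵖ

namespace ConjOp

variable {A : Type} [Ring A]

instance : Ring (ConjOp A) := inferInstanceAs (Ring Aᵐᵒᵖ)

def mk (a : A) : ConjOp A := MulOpposite.op a

def get (x : ConjOp A) : A := MulOpposite.unop x

theorem mk_mul (a b : A) : mk (a * b) = mk b * mk a := rfl

theorem mk_add (a b : A) : mk (a + b) = mk a + mk b := rfl

theorem mk_sub (a b : A) : mk (a - b) = mk a - mk b := rfl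

theorem mk_one : mk (1 : A) = 1 := rfl

variable [Algebra ℂ A]

noncomputable instance : Algebra ℂ (ConjOp A) :=
  RingHom.toAlgebra' ((algebraMap ℂ Aᵐᵒᵖ).comp (starRingEnd ℂ))
    fun c x => Algebra.commutes (R := ℂ) (A := Aᵐᵒᵖ) (starRingEnd ℂ c) x

theorem smul_mk (c : ℂ) (a : A) : c • mk a = mk (starRingEnd ℂ c • a) := by
  rw [Algebra.smul_def, Algebra.smul_def, Algebra.commutes]
  rfl

theorem get_smul (c : ℂ) (x : ConjOp A) : get (c • x) = starRingEnd ℂ c • get x :=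
  congrArg get (smul_mk c (get x))

end ConjOp

namespace IsQuantumMatrix

variable {A : Type} [Ring A] [Algebra ℂ A] {q : ℂˣ} {z : Fin 3 → Fin 3 → A}

theorem conj_eq_inv (hq : ‖(q : ℂ)‖ = 1) : starRingEnd ℂ (q : ℂ) = (q : ℂ)⁻¹ := by
  rw [Complex.inv_def, Complex.normSq_eq_norm_sq, hq]
  simp

theorem conjOp (h : IsQuantumMatrix q z) (hq : ‖(q : ℂ)‖ = 1) :
    IsQuantumMatrix q (fun i j => ConjOp.mk (z i j)) where
  row i j k hjk := by
    rw [← ConjOp.mk_mul, ← ConjOp.mk_mul, ConjOp.smul_mk, conj_eq_inv hq, h.row i j k hjk,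
      smul_smul, inv_mul_cancel₀ q.ne_zero, one_smul]
  col i k j hik := by
    rw [← ConjOp.mk_mul, ← ConjOp.mk_mul, ConjOp.smul_mk, conj_eq_inv hq, h.col i k j hik,
      smul_smul, inv_mul_cancel₀ q.ne_zero, one_smul]
  anti i k j l hik hlj := by
    rw [← ConjOp.mk_mul, ← ConjOp.mk_mul, h.anti i k j l hik hlj]
  diag i k j l hik hjl := by
    rw [← ConjOp.mk_mul, ← ConjOp.mk_mul, ← ConjOp.mk_mul, ConjOp.smul_mk, ← ConjOp.mk_add,
      map_sub, map_inv₀, conj_eq_inv hq, inv_inv, h.diag i k j l hik hjl, h.anti i k l j hik hjl]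
    congr 1
    module

theorem qdet_conjOp (h : IsQuantumMatrix q z) (hq : ‖(q : ℂ)‖ = 1) :
    qdet q (fun i j => ConjOp.mk (z i j)) = ConjOp.mk (qdet q z) := by
  rw [← h.qdet_reverse]
  simp only [qdet, ← ConjOp.mk_mul, ConjOp.smul_mk, map_pow, conj_eq_inv hq, ← ConjOp.mk_add,
    ← ConjOp.mk_sub]

end IsQuantumMatrix

/-! ## The quantum group `GL_q(3, ℂ)` -/

/-- Generators of `Fun_q(GL(3, ℂ))`: the matrix entries and the inverse of the determinant. -/
inductive GLGen : Type
  | z (i j : Fin 3)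
  | dinv

/-- The generators as elements of the free algebra. -/
noncomputable def freeZ (i j : Fin 3) : FreeAlgebra ℂ GLGen := FreeAlgebra.ι ℂ (GLGen.z i j)

noncomputable def freeDinv : FreeAlgebra ℂ GLGen := FreeAlgebra.ι ℂ GLGen.dinv

/-- The defining relations of `Fun_q(GL(3, ℂ))`. -/
inductive GLRel (q : ℂˣ) : FreeAlgebra ℂ GLGen → FreeAlgebra ℂ GLGen → Prop
  | row (i j k : Fin 3) (h : j < k) :
      GLRel q (freeZ i j * freeZ i k) ((q : ℂ) • (freeZ i k * freeZ i j))
  | col (i k j : Fin 3) (h : i < k) :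
      GLRel q (freeZ i j * freeZ k j) ((q : ℂ) • (freeZ k j * freeZ i j))
  | anti (i k j l : Fin 3) (h : i < k) (h' : l < j) :
      GLRel q (freeZ i j * freeZ k l) (freeZ k l * freeZ i j)
  | diag (i k j l : Fin 3) (h : i < k) (h' : j < l) :
      GLRel q (freeZ i j * freeZ k l)
        (freeZ k l * freeZ i j + ((q : ℂ) - (q : ℂ)⁻¹) • (freeZ k j * freeZ i l))
  | qdet_mul_dinv : GLRel q (qdet q freeZ * freeDinv) 1
  | dinv_mul_qdet : GLRel q (freeDinv * qdet q freeZ) 1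

/-- The algebra `Fun_q(GL(3, ℂ))`. -/
def GLq (q : ℂˣ) : Type := RingQuot (GLRel q)

theorem map_qdet {B B' : Type} [Ring B] [Algebra ℂ B] [Ring B'] [Algebra ℂ B'] (q : ℂˣ)
    (z : Fin 3 → Fin 3 → B) (f : B →ₐ[ℂ] B') :
    f (qdet q z) = qdet q (fun i j => f (z i j)) := by
  simp only [qdet, map_add, map_sub, map_smul, map_mul]

namespace GLq

variable (q : ℂˣ)

noncomputable instance : Ring (GLq q) := inferInstanceAs (Ring (RingQuot (GLRel q)))

noncomputable instance : Algebra ℂ (GLq q) := inferInstanceAs (Algebra ℂ (RingQuot (GLRel q)))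

noncomputable def proj : FreeAlgebra ℂ GLGen →ₐ[ℂ] GLq q := RingQuot.mkAlgHom ℂ (GLRel q)

/-- The matrix entries. -/
noncomputable def z (i j : Fin 3) : GLq q := proj q (freeZ i j)

/-- The inverse of the quantum determinant. -/
noncomputable def dinv : GLq q := proj q freeDinv

theorem proj_rel {a b : FreeAlgebra ℂ GLGen} (h : GLRel q a b) : proj q a = proj q b :=
  RingQuot.mkAlgHom_rel ℂ h

theorem isQuantumMatrix : IsQuantumMatrix q (z q) where
  row i j k h := by simpa only [z, map_mul, map_smul] using proj_rel q (.row i j k h)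
  col i k j h := by simpa only [z, map_mul, map_smul] using proj_rel q (.col i k j h)
  anti i k j l h h' := by simpa only [z, map_mul] using proj_rel q (.anti i k j l h h')
  diag i k j l h h' := by
    simpa only [z, map_mul, map_add, map_smul] using proj_rel q (.diag i k j l h h')

theorem qdet_mul_dinv : qdet q (z q) * dinv q = 1 := by
  have h := proj_rel q .qdet_mul_dinv
  rwa [map_mul, map_qdet, map_one] at h

theorem dinv_mul_qdet : dinv q * qdet q (z q) = 1 := by
  have h := proj_rel q .dinv_mul_qdet
  rwa [map_mul, map_qdet, map_one] at h

variable {q} {B : Type} [Ring B] [Algebra ℂ B]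

/-- The universal property. -/
noncomputable def lift (x : Fin 3 → Fin 3 → B) (w : B) (hx : IsQuantumMatrix q x)
    (h₁ : qdet q x * w = 1) (h₂ : w * qdet q x = 1) : GLq q →ₐ[ℂ] B :=
  RingQuot.liftAlgHom ℂ ⟨FreeAlgebra.lift ℂ fun g => GLGen.casesOn g x w, by
    have hz : ∀ i j, FreeAlgebra.lift ℂ (fun g => GLGen.casesOn g x w : GLGen → B) (freeZ i j)
        = x i j := fun i j => FreeAlgebra.lift_ι_apply _ _
    have hw : FreeAlgebra.lift ℂ (fun g => GLGen.casesOn g x w : GLGen → B) freeDinv = w :=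
      FreeAlgebra.lift_ι_apply _ _
    intro a b h
    induction h with
    | row i j k h => simp only [map_mul, map_smul, hz, hx.row i j k h]
    | col i k j h => simp only [map_mul, map_smul, hz, hx.col i k j h]
    | anti i k j l h h' => simp only [map_mul, hz, hx.anti i k j l h h']
    | diag i k j l h h' => simp only [map_mul, map_add, map_smul, hz, hx.diag i k j l h h']
    | qdet_mul_dinv => simp only [map_mul, map_qdet, map_one, hz, hw, h₁]
    | dinv_mul_qdet => simp only [map_mul, map_qdet, map_one, hz, hw, h₂]⟩

section

variable {x : Fin 3 → Fin 3 → B} {w : B} {hx : IsQuantumMatrix q x}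
  {h₁ : qdet q x * w = 1} {h₂ : w * qdet q x = 1}

theorem lift_z (i j : Fin 3) : lift x w hx h₁ h₂ (z q i j) = x i j :=
  (RingQuot.liftAlgHom_mkAlgHom_apply ℂ _ _ _).trans (FreeAlgebra.lift_ι_apply _ _)

theorem lift_dinv : lift x w hx h₁ h₂ (dinv q) = w :=
  (RingQuot.liftAlgHom_mkAlgHom_apply ℂ _ _ _).trans (FreeAlgebra.lift_ι_apply _ _)

end

theorem algHom_ext {f g : GLq q →ₐ[ℂ] B} (hz : ∀ i j, f (z q i j) = g (z q i j))
    (hw : f (dinv q) = g (dinv q)) : f = g := by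
  refine RingQuot.ringQuot_ext' ℂ _ _ (FreeAlgebra.hom_ext (funext fun a => ?_))
  cases a with
  | z i j => exact hz i j
  | dinv => exact hw

theorem isQuantumMatrix_tensor :
    IsQuantumMatrix q (fun i j => ∑ k, z q i k ⊗ₜ[ℂ] z q k j) ∧
      qdet q (fun i j => ∑ k, z q i k ⊗ₜ[ℂ] z q k j) = qdet q (z q) ⊗ₜ[ℂ] qdet q (z q) := by
  have hx := (isQuantumMatrix q).map
    (Algebra.TensorProduct.includeLeft : GLq q →ₐ[ℂ] GLq q ⊗[ℂ] GLq q)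
  have hy := (isQuantumMatrix q).map
    (Algebra.TensorProduct.includeRight : GLq q →ₐ[ℂ] GLq q ⊗[ℂ] GLq q)
  have hc : ∀ i j k l,
      (Algebra.TensorProduct.includeRight : GLq q →ₐ[ℂ] GLq q ⊗[ℂ] GLq q) (z q i j)
        * (Algebra.TensorProduct.includeLeft : GLq q →ₐ[ℂ] GLq q ⊗[ℂ] GLq q) (z q k l)
      = (Algebra.TensorProduct.includeLeft : GLq q →ₐ[ℂ] GLq q ⊗[ℂ] GLq q) (z q k l)
        * (Algebra.TensorProduct.includeRight : GLq q →ₐ[ℂ] GLq q ⊗[ℂ] GLq q) (z q i j) := by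
    intro i j k l
    simp
  have e : (fun i j => ∑ k, z q i k ⊗ₜ[ℂ] z q k j) = fun i j => ∑ k,
      (Algebra.TensorProduct.includeLeft : GLq q →ₐ[ℂ] GLq q ⊗[ℂ] GLq q) (z q i k)
        * (Algebra.TensorProduct.includeRight : GLq q →ₐ[ℂ] GLq q ⊗[ℂ] GLq q) (z q k j) := by
    funext i j
    simp
  rw [e]
  refine ⟨hx.mul hy hc, ?_⟩
  rw [hy.qdet_mul hc, ← map_qdet, ← map_qdet]
  simp

/-- The coproduct `Δ(z i j) = ∑ k, z i k ⊗ z k j`. -/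
noncomputable def comulHom (q : ℂˣ) : GLq q →ₐ[ℂ] GLq q ⊗[ℂ] GLq q :=
  lift (fun i j => ∑ k, z q i k ⊗ₜ[ℂ] z q k j) (dinv q ⊗ₜ[ℂ] dinv q) isQuantumMatrix_tensor.1
    (by rw [isQuantumMatrix_tensor.2, Algebra.TensorProduct.tmul_mul_tmul, qdet_mul_dinv,
      Algebra.TensorProduct.one_def])
    (by rw [isQuantumMatrix_tensor.2, Algebra.TensorProduct.tmul_mul_tmul, dinv_mul_qdet,
      Algebra.TensorProduct.one_def])

theorem isQuantumMatrix_one : IsQuantumMatrix q (fun i j : Fin 3 => if i = j then (1 : ℂ) else 0) ∧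
    qdet q (fun i j : Fin 3 => if i = j then (1 : ℂ) else 0) = 1 := by
  refine ⟨⟨?_, ?_, ?_, ?_⟩, ?_⟩
  · intro i j k h
    rcases eq_or_ne i j with rfl | h1
    · simp [h.ne]
    · simp [h1]
  · intro i k j h
    rcases eq_or_ne i j with rfl | h1
    · simp [h.ne']
    · simp [h1]
  · intro i k j l _ _
    exact mul_comm _ _
  · intro i k j l h h'
    have : ¬ (k = j ∧ i = l) := by
      rintro ⟨rfl, rfl⟩
      exact lt_asymm h h'
    rcases not_and_or.1 this with h1 | h1 <;> simp [h1, mul_comm]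
  · simp [qdet]

/-- The counit `ε(z i j) = δ i j`. -/
noncomputable def counitHom (q : ℂˣ) : GLq q →ₐ[ℂ] ℂ :=
  lift (fun i j => if i = j then 1 else 0) 1 isQuantumMatrix_one.1
    (by rw [isQuantumMatrix_one.2, one_mul]) (by rw [isQuantumMatrix_one.2, one_mul])

theorem comulHom_z (i j : Fin 3) : comulHom q (z q i j) = ∑ k, z q i k ⊗ₜ[ℂ] z q k j := lift_z _ _

theorem comulHom_dinv : comulHom q (dinv q) = dinv q ⊗ₜ[ℂ] dinv q := lift_dinv

theorem comulHom_qdet : comulHom q (qdet q (z q)) = qdet q (z q) ⊗ₜ[ℂ] qdet q (z q) := by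
  rw [map_qdet]
  simp only [comulHom_z, isQuantumMatrix_tensor.2]

theorem counitHom_z (i j : Fin 3) : counitHom q (z q i j) = if i = j then 1 else 0 := lift_z _ _

theorem counitHom_dinv : counitHom q (dinv q) = 1 := lift_dinv

theorem counitHom_qdet : counitHom q (qdet q (z q)) = 1 := by
  rw [map_qdet]
  simp only [counitHom_z, isQuantumMatrix_one.2]

noncomputable instance : Bialgebra ℂ (GLq q) :=
  Bialgebra.ofAlgHom (comulHom q) (counitHom q)
    (by
      refine algHom_ext (fun i j => ?_) ?_
      · simp only [AlgHom.comp_apply, comulHom_z, map_sum, Algebra.TensorProduct.map_tmul,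
          AlgHom.id_apply, TensorProduct.sum_tmul, TensorProduct.tmul_sum]
        exact Finset.sum_comm
      · simp [comulHom_dinv])
    (by
      refine algHom_ext (fun i j => ?_) ?_
      · simp [comulHom_z, counitHom_z, TensorProduct.ite_tmul]
      · simp [comulHom_dinv, counitHom_dinv])
    (by
      refine algHom_ext (fun i j => ?_) ?_
      · simp [comulHom_z, counitHom_z, TensorProduct.tmul_ite]
      · simp [comulHom_dinv, counitHom_dinv])

/-- The antipode on the matrix entries. -/
noncomputable def antipodeZ (q : ℂˣ) : Matrix (Fin 3) (Fin 3) (GLq q) :=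
  antipodeMatrix q (z q) (dinv q)

/-- The `*`-operation as a homomorphism into the opposite algebra. -/
noncomputable def starHom (hq : ‖(q : ℂ)‖ = 1) : GLq q →ₐ[ℂ] ConjOp (GLq q) :=
  lift (fun i j => ConjOp.mk (z q i j)) (ConjOp.mk (dinv q)) ((isQuantumMatrix q).conjOp hq)
    (by rw [(isQuantumMatrix q).qdet_conjOp hq, ← ConjOp.mk_mul, dinv_mul_qdet, ConjOp.mk_one])
    (by rw [(isQuantumMatrix q).qdet_conjOp hq, ← ConjOp.mk_mul, qdet_mul_dinv, ConjOp.mk_one])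

/-- The `*`-operation of `GL_q(3, ℝ)` for `|q| = 1`: the antilinear antihomomorphism that fixes
the matrix entries and the inverse of the determinant. -/
noncomputable def star (hq : ‖(q : ℂ)‖ = 1) (a : GLq q) : GLq q := (starHom hq a).get

variable (hq : ‖(q : ℂ)‖ = 1)

theorem star_z (i j : Fin 3) : star hq (z q i j) = z q i j := congrArg ConjOp.get (lift_z i j)

theorem star_dinv : star hq (dinv q) = dinv q := congrArg ConjOp.get lift_dinv

theorem star_add (a b : GLq q) : star hq (a + b) = star hq a + star hq b :=
  congrArg ConjOp.get (map_add (starHom hq) a b)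

theorem star_mul (a b : GLq q) : star hq (a * b) = star hq b * star hq a :=
  congrArg ConjOp.get (map_mul (starHom hq) a b)

theorem star_smul (c : ℂ) (a : GLq q) : star hq (c • a) = starRingEnd ℂ c • star hq a :=
  (congrArg ConjOp.get (map_smul (starHom hq) c a)).trans (ConjOp.get_smul _ _)

theorem star_one : star hq (1 : GLq q) = 1 := congrArg ConjOp.get (map_one (starHom hq))

theorem star_star (a : GLq q) : star hq (star hq a) = a := by
  let f : GLq q →ₐ[ℂ] GLq q :=
    { toFun := fun a => star hq (star hq a)
      map_one' := by simp only [star_one]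
      map_mul' := fun a b => by simp only [star_mul]
      map_zero' := by
        have h := star_smul hq 0 (0 : GLq q)
        simp only [zero_smul, map_zero] at h
        simp only [h]
      map_add' := fun a b => by simp only [star_add]
      commutes' := fun c => by
        simp only [Algebra.algebraMap_eq_smul_one, star_smul, star_one, Complex.conj_conj] }
  have hf : f = AlgHom.id ℂ _ :=
    algHom_ext (fun i j => (congrArg (star hq) (star_z hq i j)).trans (star_z hq i j))
      ((congrArg (star hq) (star_dinv hq)).trans (star_dinv hq))
  exact DFunLike.congr_fun hf a

theorem starHom_qdet : starHom hq (qdet q (z q)) = ConjOp.mk (qdet q (z q)) := by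
  rw [map_qdet, ← (isQuantumMatrix q).qdet_conjOp hq]
  exact congrArg (qdet q) (funext fun i => funext fun j => lift_z i j)

end GLq

/-! ## The quantum group `SL_q(3, ℂ)` -/

/-- The unimodularity relation. -/
inductive SLRel (q : ℂˣ) : GLq q → GLq q → Prop
  | qdet_eq_one : SLRel q (qdet q (GLq.z q)) 1

/-- The algebra `Fun_q(SL(3, ℂ))`, the quotient of `Fun_q(GL(3, ℂ))` by `D = 1`. -/
def SLq (q : ℂˣ) : Type := RingQuot (SLRel q)

namespace SLq

variable (q : ℂˣ)

noncomputable instance : Ring (SLq q) := inferInstanceAs (Ring (RingQuot (SLRel q)))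

noncomputable instance : Algebra ℂ (SLq q) := inferInstanceAs (Algebra ℂ (RingQuot (SLRel q)))

/-- The projection from `Fun_q(GL(3, ℂ))`. -/
noncomputable def proj : GLq q →ₐ[ℂ] SLq q := RingQuot.mkAlgHom ℂ (SLRel q)

/-- The matrix entries. -/
noncomputable def z (i j : Fin 3) : SLq q := proj q (GLq.z q i j)

/-- The antipode on the matrix entries. -/
noncomputable def antipodeZ : Matrix (Fin 3) (Fin 3) (SLq q) := antipodeMatrix q (z q) 1

theorem proj_qdet : proj q (qdet q (GLq.z q)) = 1 :=
  (RingQuot.mkAlgHom_rel ℂ SLRel.qdet_eq_one).trans (map_one (proj q))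

theorem proj_dinv : proj q (GLq.dinv q) = 1 := by
  have h := congrArg (proj q) (GLq.dinv_mul_qdet q)
  rwa [map_mul, proj_qdet, mul_one, map_one] at h

theorem isQuantumMatrix : IsQuantumMatrix q (z q) := (GLq.isQuantumMatrix q).map (proj q)

theorem qdet_z : qdet q (z q) = 1 := (map_qdet q (GLq.z q) (proj q)).symm.trans (proj_qdet q)

variable {q} {B : Type} [Ring B] [Algebra ℂ B]

/-- The universal property. -/
noncomputable def lift (f : GLq q →ₐ[ℂ] B) (hf : f (qdet q (GLq.z q)) = 1) : SLq q →ₐ[ℂ] B :=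
  RingQuot.liftAlgHom ℂ ⟨f, by
    rintro _ _ ⟨⟩
    rw [hf, map_one]⟩

theorem lift_proj (f : GLq q →ₐ[ℂ] B) (hf : f (qdet q (GLq.z q)) = 1) (a : GLq q) :
    lift f hf (proj q a) = f a :=
  RingQuot.liftAlgHom_mkAlgHom_apply ℂ _ _ _

theorem algHom_ext {f g : SLq q →ₐ[ℂ] B} (hz : ∀ i j, f (z q i j) = g (z q i j)) : f = g := by
  refine RingQuot.ringQuot_ext' ℂ _ _ (GLq.algHom_ext hz ?_)
  change f (proj q (GLq.dinv q)) = g (proj q (GLq.dinv q))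
  rw [proj_dinv, map_one, map_one]

/-- The coproduct. -/
noncomputable def comulHom (q : ℂˣ) : SLq q →ₐ[ℂ] SLq q ⊗[ℂ] SLq q :=
  lift ((Algebra.TensorProduct.map (proj q) (proj q)).comp (GLq.comulHom q)) (by
    rw [AlgHom.comp_apply, GLq.comulHom_qdet, Algebra.TensorProduct.map_tmul, proj_qdet,
      Algebra.TensorProduct.one_def])

/-- The counit. -/
noncomputable def counitHom (q : ℂˣ) : SLq q →ₐ[ℂ] ℂ := lift (GLq.counitHom q) GLq.counitHom_qdet

theorem comulHom_z (i j : Fin 3) : comulHom q (z q i j) = ∑ k, z q i k ⊗ₜ[ℂ] z q k j := by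
  refine (lift_proj _ _ _).trans ?_
  rw [AlgHom.comp_apply, GLq.comulHom_z, map_sum]
  rfl

theorem counitHom_z (i j : Fin 3) : counitHom q (z q i j) = if i = j then 1 else 0 :=
  (lift_proj _ _ _).trans (GLq.counitHom_z i j)

noncomputable instance : Bialgebra ℂ (SLq q) :=
  Bialgebra.ofAlgHom (comulHom q) (counitHom q)
    (by
      refine algHom_ext fun i j => ?_
      simp only [AlgHom.comp_apply, comulHom_z, map_sum, Algebra.TensorProduct.map_tmul,
        AlgHom.id_apply, TensorProduct.sum_tmul, TensorProduct.tmul_sum]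
      exact Finset.sum_comm)
    (by
      refine algHom_ext fun i j => ?_
      simp [comulHom_z, counitHom_z, TensorProduct.ite_tmul])
    (by
      refine algHom_ext fun i j => ?_
      simp [comulHom_z, counitHom_z, TensorProduct.tmul_ite])

/-- The `*`-operation as a homomorphism into the opposite algebra. -/
noncomputable def starHom (hq : ‖(q : ℂ)‖ = 1) : SLq q →ₐ[ℂ] ConjOp (SLq q) :=
  lift (GLq.lift (fun i j => ConjOp.mk (z q i j)) 1 ((isQuantumMatrix q).conjOp hq)
    (by rw [(isQuantumMatrix q).qdet_conjOp hq, qdet_z, ConjOp.mk_one, mul_one])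
    (by rw [(isQuantumMatrix q).qdet_conjOp hq, qdet_z, ConjOp.mk_one, mul_one]))
    (by
      rw [map_qdet]
      simp only [GLq.lift_z]
      rw [(isQuantumMatrix q).qdet_conjOp hq, qdet_z, ConjOp.mk_one])

/-- The `*`-operation of `SL_q(3, ℝ)` for `|q| = 1`: the antilinear antihomomorphism that fixes
the matrix entries. -/
noncomputable def star (hq : ‖(q : ℂ)‖ = 1) (a : SLq q) : SLq q := (starHom hq a).get

variable (hq : ‖(q : ℂ)‖ = 1)

theorem star_z (i j : Fin 3) : star hq (z q i j) = z q i j :=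
  congrArg ConjOp.get ((lift_proj _ _ _).trans (GLq.lift_z i j))

theorem star_add (a b : SLq q) : star hq (a + b) = star hq a + star hq b :=
  congrArg ConjOp.get (map_add (starHom hq) a b)

theorem star_mul (a b : SLq q) : star hq (a * b) = star hq b * star hq a :=
  congrArg ConjOp.get (map_mul (starHom hq) a b)

theorem star_smul (c : ℂ) (a : SLq q) : star hq (c • a) = starRingEnd ℂ c • star hq a :=
  (congrArg ConjOp.get (map_smul (starHom hq) c a)).trans (ConjOp.get_smul _ _)

end SLq

/-! ## The two families of calculi -/

namespace Calculus

section Families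

variable {A : Type} [Ring A] [Algebra ℂ A]

/-- The Maurer-Cartan forms `θ i j = ∑ k, S(z i k) dz k j`. -/
noncomputable def theta (z : Fin 3 → Fin 3 → A) (S : Matrix (Fin 3) (Fin 3) A)
    (C : Calculus.{u} A) (i j : Fin 3) : C.Form :=
  ∑ k, S i k • C.d (z k j)

/-- The quantum trace of the Maurer-Cartan forms. -/
noncomputable def trTheta (q : ℂˣ) (z : Fin 3 → Fin 3 → A) (S : Matrix (Fin 3) (Fin 3) A)
    (C : Calculus.{u} A) : C.Form :=
  (q : ℂ) ^ 4 • C.theta z S 0 0 + (q : ℂ) ^ 2 • C.theta z S 1 1 + C.theta z S 2 2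

/-- The coefficients of the first family. -/
noncomputable def sigma₁ (q t : ℂ) : ℂ :=
  (q ^ 2 - t) * (t - 1) / (q ^ 4 * (q ^ 2 + 1) * (t - 1) - q ^ 2 + t)

noncomputable def beta₁ (q t : ℂ) : ℂ :=
  t * (q ^ 2 - 1) * (t - 1) / (q ^ 4 * (q ^ 2 + 1) * (t - 1) - q ^ 2 + t)

/-- The coefficients of the second family. -/
noncomputable def sigma₂ (q t : ℂ) : ℂ :=
  -((q ^ 2 * t - 1) * (t - 1) / (q ^ 4 * (q ^ 2 * t - 1) + (q ^ 2 + 1) * (t - 1)))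

noncomputable def beta₂ (q t : ℂ) : ℂ :=
  -(t * (q ^ 2 - 1) * (t - 1) / (q ^ 4 * (q ^ 2 * t - 1) + (q ^ 2 + 1) * (t - 1)))

/-- The commutation relations of the calculus `Γ₁(t)`. -/
structure IsGamma₁ (q : ℂˣ) (z : Fin 3 → Fin 3 → A) (S : Matrix (Fin 3) (Fin 3) A) (t : ℂ)
    (C : Calculus.{u} A) : Prop where
  same : ∀ i j, op (z i j) • C.d (z i j) =
    (t / (q : ℂ) ^ 2 + t - 1) • z i j • C.d (z i j)
      + sigma₁ q t • (z i j * z i j) • C.trTheta q z S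
  row : ∀ i j l, j < l → op (z i l) • C.d (z i j) =
    (t / (q : ℂ)) • z i l • C.d (z i j) + (t - 1) • z i j • C.d (z i l)
      + sigma₁ q t • (z i j * z i l) • C.trTheta q z S
  col : ∀ i k j, i < k → op (z k j) • C.d (z i j) =
    (t / (q : ℂ)) • z k j • C.d (z i j) + (t - 1) • z i j • C.d (z k j)
      + sigma₁ q t • (z i j * z k j) • C.trTheta q z S
  diag : ∀ i k j l, i < k → j < l → op (z k l) • C.d (z i j) =
    t • z k l • C.d (z i j) + (t - 1) • z i j • C.d (z k l)
      + sigma₁ q t • (z i j * z k l) • C.trTheta q z S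
      - beta₁ q t • (z i j * z k l - (q : ℂ) • (z i l * z k j)) • C.trTheta q z S
  anti : ∀ i k j l, i < k → l < j → op (z k l) • C.d (z i j) =
    t • z k l • C.d (z i j) + (t - 1) • z i j • C.d (z k l)
      + sigma₁ q t • (z i j * z k l) • C.trTheta q z S
      - (t * ((q : ℂ) - (q : ℂ)⁻¹)) • z k j • C.d (z i l)
      + ((q : ℂ) * beta₁ q t) • (z i l * z k j - (q : ℂ) • (z i j * z k l)) • C.trTheta q z S

/-- The commutation relations of the calculus `Γ₂(t)`. -/
structure IsGamma₂ (q : ℂˣ) (z : Fin 3 → Fin 3 → A) (S : Matrix (Fin 3) (Fin 3) A) (t : ℂ)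
    (C : Calculus.{u} A) : Prop where
  same : ∀ i j, op (z i j) • C.d (z i j) =
    (t * (q : ℂ) ^ 2 + t - 1) • z i j • C.d (z i j)
      + sigma₂ q t • (z i j * z i j) • C.trTheta q z S
  row : ∀ i j l, j < l → op (z i l) • C.d (z i j) =
    (t * (q : ℂ)) • z i l • C.d (z i j) + (t * (q : ℂ) ^ 2 - 1) • z i j • C.d (z i l)
      + sigma₂ q t • (z i j * z i l) • C.trTheta q z S
  col : ∀ i k j, i < k → op (z k j) • C.d (z i j) =
    (t * (q : ℂ)) • z k j • C.d (z i j) + (t * (q : ℂ) ^ 2 - 1) • z i j • C.d (z k j)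
      + sigma₂ q t • (z i j * z k j) • C.trTheta q z S
  diag : ∀ i k j l, i < k → j < l → op (z k l) • C.d (z i j) =
    t • z k l • C.d (z i j) + (t - 1) • z i j • C.d (z k l)
      + sigma₂ q t • (z i j * z k l) • C.trTheta q z S
      + (t * ((q : ℂ) - (q : ℂ)⁻¹)) • (z i l • C.d (z k j) + z k j • C.d (z i l))
      + (t * ((q : ℂ) - (q : ℂ)⁻¹) ^ 2) • z i j • C.d (z k l)
      - (beta₂ q t / (q : ℂ) ^ 2) • (z i j * z k l - (q : ℂ) • (z i l * z k j))
          • C.trTheta q z S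
  anti : ∀ i k j l, i < k → l < j → op (z k l) • C.d (z i j) =
    t • z k l • C.d (z i j) + (t - 1) • z i j • C.d (z k l)
      + sigma₂ q t • (z i j * z k l) • C.trTheta q z S
      + (t * ((q : ℂ) - (q : ℂ)⁻¹)) • z i l • C.d (z k j)
      + (beta₂ q t / (q : ℂ)) • (z i l * z k j - (q : ℂ) • (z i j * z k l)) • C.trTheta q z S

end Families

end Calculus

/-- The labels of the two families of calculi. -/
inductive Family : Type
  | first
  | second

/-- The admissible parameters of the two families. -/
def Admissible (q : ℂˣ) : Family → ℂ → Prop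
  | .first, t => t ≠ 0 ∧
      ((q : ℂ) ^ 6 + (q : ℂ) ^ 4 + 1) * t - ((q : ℂ) ^ 6 + (q : ℂ) ^ 4 + (q : ℂ) ^ 2) ≠ 0
  | .second, t => t ≠ 0 ∧
      ((q : ℂ) ^ 6 + (q : ℂ) ^ 2 + 1) * t - ((q : ℂ) ^ 4 + (q : ℂ) ^ 2 + 1) ≠ 0

/-- The parameters of the calculi on `SL_q(3, ℂ)`: the admissible solutions of `t ^ 3 = q ^ 2` in
the first and of `t ^ 3 = q ^ (-2)` in the second family. -/
def slParameters (q : ℂˣ) : Family → Set ℂ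
  | .first => {t | Admissible q .first t ∧ t ^ 3 = (q : ℂ) ^ 2}
  | .second => {t | Admissible q .second t ∧ t ^ 3 = ((q : ℂ) ^ 2)⁻¹}

namespace Calculus

/-- The commutation relations of the calculus `Γ_ν(t)`. -/
def IsGamma {A : Type} [Ring A] [Algebra ℂ A] (q : ℂˣ) (z : Fin 3 → Fin 3 → A)
    (S : Matrix (Fin 3) (Fin 3) A) : Family → ℂ → Calculus.{u} A → Prop
  | .first, t, C => C.IsGamma₁ q z S t
  | .second, t, C => C.IsGamma₂ q z S t

variable {q : ℂˣ}

/-- A calculus `C'` over `SL_q(3, ℂ)` is a quotient of a calculus `C` over `GL_q(3, ℂ)`: there is a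
map of one-forms compatible with the projection of the algebras, the bimodule structures and the
differentials (it is onto, since the differentials generate). -/
def Induces (C : Calculus.{u} (GLq q)) (C' : Calculus.{v} (SLq q)) : Prop :=
  ∃ φ : C.Form →ₗ[ℂ] C'.Form,
    (∀ (a : GLq q) (ρ : C.Form), φ (a • ρ) = SLq.proj q a • φ ρ) ∧
    (∀ (a : GLq q) (ρ : C.Form), φ (op a • ρ) = op (SLq.proj q a) • φ ρ) ∧
    (∀ a : GLq q, φ (C.d a) = C'.d (SLq.proj q a))

/-- The bicovariant calculi over `SL_q(3, ℂ)` with nine independent differentials `dz i j` that are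
induced by such calculi over `GL_q(3, ℂ)`. -/
def IsInduced (C' : Calculus.{u} (SLq q)) : Prop :=
  C'.IsBicovariant ∧ C'.HasBasis (SLq.z q) ∧
    ∃ C : Calculus.{u} (GLq q), C.IsBicovariant ∧ C.HasBasis (GLq.z q) ∧ C.Induces C'

end Calculus

/-! Let Z be the quantum matrix, and let R be the braid operator of the R-matrix (second family) or
its inverse (first family). Then R² = μR + 1 and R Z₁Z₂ = Z₁Z₂ R. Each `actL` is a multiplication by
R on the row indices, and each `actR` one on the column indices.

Existence. On the free left module over nine left-invariant forms η, let Z act from the right by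
η₁Z₂ = t Z₂ R η₂ R. This action is t times a tensor product of two copies of the representation
given by R, hence compatible with the relations, and the determinant D acts on η by the scalar
t³·base² (`isQuantumMatrix_action`). The differential is the commutator with ω = ∑ weight·η_ii. The
weighted trace of R g₂ R gives dZ = (t−1)Zω + t·μ·trace·Zη, so τ = κω. The dz i j therefore form a
basis once κ ≠ 0 and t·μ ≠ 0, and admissibility says exactly t ≠ 0 and κ ≠ 0. Right covariance rests
on the intertwining of the right action with the coadjoint corepresentation
(`matrixRight_mul_coadjoint`) and on the invariance of ω. Substituting dZ into the right action
yields `IsBraided`, whose entries are the relations of Γ_ν(t).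

Uniqueness. The listed relations determine d on all products of two entries, hence the right action
on the basis, hence the calculus (`IsGamma.equivalent`).

Involution. For |q| = 1, complex conjugation turns R into its inverse with exchanged legs. The forms
ζ = Zη satisfy ζ₁Z₂ = t R Z₁ζ₂ R, so the antilinear antimultiplicative map with ζ ↦ cζ respects the
right action as soon as |t| = 1. For c = −t·trace² it sends ω to −ω and hence commutes with d.
Conversely, right multiplication by D on forms is t³·base² times left multiplication by D, and D is
self-adjoint; so a *-calculus has |t³·base²| = 1, that is |t| = 1.

Classification. In a bicovariant calculus both coactions act on dZ₁·Z₂ as on Z₁Z₂. The fibre of such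
a tensor at the unit is encoded in an operator that commutes with the third tensor power of Z. Such
an operator is determined by six entries, because e₀⊗e₁⊗e₂ generates the third tensor power under
the Chevalley generators and weights are preserved (`eq_zero_of_permutations`). The six tensors
Z₁dZ₂, its images under R on either or both sides, Z₁Z₂τ and R Z₁Z₂τ account for these six entries
(`exists_expansion`). The Leibniz rule on R Z₁Z₂ = Z₁Z₂ R and one row relation then leave a
quadratic equation whose two roots are the two families (`exists_isExpanded`); further row relations
fix the coefficients of τ (`trace_coeff`).

Special linear case. An induced calculus satisfies the projected relations, and D = 1 forces
t³·base² = 1, which is t³ = q² or t³ = q⁻². Such t have modulus one, so every induced calculus is a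
*-calculus. The classes of (dz 0 0)·z 1 1 at the unit separate the parameters. -/

/-! ## The braid operator on tensors with four indices -/

namespace Family

/-- The value of the braid operator of a family on the vectors `e i ⊗ e i`. -/
noncomputable def base (q : ℂˣ) : Family → ℂ
  | .first => (q : ℂ)⁻¹
  | .second => (q : ℂ)

/-- The diagonal coefficients of the braid operator (second family) and of its inverse (first
family). -/
noncomputable def coeff (q : ℂˣ) : Family → Fin 3 → Fin 3 → ℂ
  | .first => fun a b => IsQuantumMatrix.rDiag q a b - ((q : ℂ) - (q : ℂ)⁻¹)
  | .second => IsQuantumMatrix.rDiag q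

/-- The parameter `μ` of the Hecke relation `R ^ 2 = μ R + 1`. -/
noncomputable def hecke (q : ℂˣ) : Family → ℂ
  | .first => (q : ℂ)⁻¹ - (q : ℂ)
  | .second => (q : ℂ) - (q : ℂ)⁻¹

/-- The quantum trace of the braid operator over one leg. -/
noncomputable def trace (q : ℂˣ) : Family → ℂ
  | .first => (q : ℂ)⁻¹
  | .second => (q : ℂ) ^ 5

theorem hecke_eq (q : ℂˣ) (ν : Family) : ν.hecke q = ν.base q - (ν.base q)⁻¹ := by
  cases ν <;> simp [hecke, base]

theorem base_ne_zero (q : ℂˣ) (ν : Family) : ν.base q ≠ 0 := by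
  cases ν <;> simp [base]

theorem trace_ne_zero (q : ℂˣ) (ν : Family) : ν.trace q ≠ 0 := by
  cases ν <;> simp [trace]

theorem hecke_ne_zero {q : ℂˣ} (h : (q : ℂ) ^ 2 ≠ 1) (ν : Family) : ν.hecke q ≠ 0 := by
  have hq : (q : ℂ) ≠ 0 := q.ne_zero
  have key : (q : ℂ) - (q : ℂ)⁻¹ ≠ 0 := by
    intro h0
    apply h
    field_simp at h0
    linear_combination h0
  cases ν
  · intro h0
    have h1 : (q : ℂ)⁻¹ - (q : ℂ) = 0 := h0
    exact key (by linear_combination -h1)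
  · exact key

end Family

namespace Braid

open IsQuantumMatrix (rDiag rOff rOff_comm)

/-- The weights of the quantum trace. -/
noncomputable def weight (q : ℂˣ) : Fin 3 → ℂ := ![(q : ℂ) ^ 4, (q : ℂ) ^ 2, 1]

variable {M : Type*} [AddCommGroup M] [Module ℂ M]

/-- The braid operator acting on the row indices of a tensor. -/
noncomputable def actL (r : Fin 3 → Fin 3 → ℂ) (T : Fin 3 → Fin 3 → Fin 3 → Fin 3 → M) :
    Fin 3 → Fin 3 → Fin 3 → Fin 3 → M :=
  fun i k j l => r i k • T i k j l + rOff i k • T k i j l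

/-- The braid operator acting on the column indices of a tensor. -/
noncomputable def actR (r : Fin 3 → Fin 3 → ℂ) (T : Fin 3 → Fin 3 → Fin 3 → Fin 3 → M) :
    Fin 3 → Fin 3 → Fin 3 → Fin 3 → M :=
  fun i k j l => r j l • T i k j l + rOff j l • T i k l j

/-- The tensor with a matrix on the second leg and the identity on the first leg. -/
def leg (g : Fin 3 → Fin 3 → M) : Fin 3 → Fin 3 → Fin 3 → Fin 3 → M :=
  fun i k j l => if i = j then g k l else 0

theorem actL_actR (r : Fin 3 → Fin 3 → ℂ) (T : Fin 3 → Fin 3 → Fin 3 → Fin 3 → M) :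
    actL r (actR r T) = actR r (actL r T) := by
  funext i k j l
  simp only [actL, actR]
  module

/-- On the plane spanned by e_a⊗e_b and e_b⊗e_a the operator has off-diagonal entries 1. These
identities make its trace μ and its determinant −1, so that Cayley–Hamilton is the Hecke relation
there. -/
theorem coeff_add_coeff (q : ℂˣ) (ν : Family) {a b : Fin 3} (h : a ≠ b) :
    ν.coeff q a b + ν.coeff q b a = ν.hecke q ∧ ν.coeff q a b * ν.coeff q b a = 0 := by
  rcases lt_or_gt_of_ne h with h' | h' <;> cases ν <;>
    simp [Family.coeff, Family.hecke, rDiag, h, h.symm, h', not_lt.2 h'.le]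

theorem coeff_self (q : ℂˣ) (ν : Family) (a : Fin 3) : ν.coeff q a a = ν.base q := by
  cases ν <;> simp [Family.coeff, Family.base, rDiag]

/-- The Hecke relation R² = μR + 1. It is checked on each e_i⊗e_i, where R is `base` and μ = base −
base⁻¹, and on each plane of two distinct indices. -/
theorem actL_actL (q : ℂˣ) (ν : Family) (T : Fin 3 → Fin 3 → Fin 3 → Fin 3 → M) :
    actL (ν.coeff q) (actL (ν.coeff q) T) = ν.hecke q • actL (ν.coeff q) T + T := by
  funext i k j l
  have h0 := Family.base_ne_zero q ν
  simp only [actL, Pi.add_apply, Pi.smul_apply]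
  rcases eq_or_ne i k with rfl | h
  · simp only [rOff, if_true, coeff_self, Family.hecke_eq]
    match_scalars
    field_simp
    ring
  · obtain ⟨h1, h2⟩ := coeff_add_coeff q ν h
    have h3 : ν.coeff q k i = ν.hecke q - ν.coeff q i k := by linear_combination h1
    rw [h3] at h2
    simp only [rOff, h, h.symm, if_false, h3]
    match_scalars
    · linear_combination -h2
    · ring

/-- Associativity (P·R)·G = P·(R·G) of the contraction over two indices. It takes this form because
the off-diagonal part of R is symmetric. -/
theorem sum_actR_smul {A : Type*} [Ring A] [Algebra ℂ A] [Module A M] [IsScalarTower ℂ A M]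
    (r : Fin 3 → Fin 3 → ℂ) (P : Fin 3 → Fin 3 → Fin 3 → Fin 3 → A)
    (G : Fin 3 → Fin 3 → Fin 3 → Fin 3 → M) (i k j l : Fin 3) :
    ∑ a, ∑ b, actR r P i k a b • G a b j l = ∑ a, ∑ b, P i k a b • actL r G a b j l := by
  have hc (c : ℂ) (a : A) (m : M) : a • c • m = c • a • m := by
    rw [← algebraMap_smul A c m, smul_smul, ← Algebra.commutes, mul_smul, algebraMap_smul]
  simp only [actL, actR, add_smul, smul_add, smul_assoc, hc, Finset.sum_add_distrib]
  congr 1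
  rw [Finset.sum_comm]
  simp only [rOff_comm]

variable {A : Type} [Ring A] [Algebra ℂ A] {q : ℂˣ} {z : Fin 3 → Fin 3 → A}

/-- The products of the entries of a quantum matrix. -/
def prod (z : Fin 3 → Fin 3 → A) : Fin 3 → Fin 3 → Fin 3 → Fin 3 → A :=
  fun i k j l => z i j * z k l

/-- For the second family this is the defining relation R Z₁Z₂ = Z₁Z₂ R. The operator of the first
family differs from that R by a scalar, so it commutes as well. -/
theorem actL_prod (h : IsQuantumMatrix q z) (ν : Family) :
    actL (ν.coeff q) (prod z) = actR (ν.coeff q) (prod z) := by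
  funext i k j l
  have := h.rtt i k j l
  cases ν
  · simp only [actL, actR, prod, Family.coeff, sub_smul] at this ⊢
    rw [sub_add_eq_add_sub, sub_add_eq_add_sub, this]
  · exact this

/-- Conceptually, replace the right factor of R g₂ R by R⁻¹ + μ. The weighted trace of R g₂ R⁻¹ over
the first leg is the weighted trace of g times the identity, and the remaining term is μ times the
trace of R times g. The identity gives both the right action on ω and the formula for dZ. -/
theorem trace_actL_actR (q : ℂˣ) (ν : Family) (g : Fin 3 → Fin 3 → M) (n l : Fin 3) :
    ∑ i, weight q i • actL (ν.coeff q) (actR (ν.coeff q) (leg g)) i n i l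
      = (ν.hecke q * ν.trace q) • g n l + if n = l then ∑ i, weight q i • g i i else 0 := by
  have hq : (q : ℂ) ≠ 0 := q.ne_zero
  cases ν <;> fin_cases n <;> fin_cases l <;>
    simp [Fin.sum_univ_three, actL, actR, leg, Family.coeff, Family.trace, Family.hecke, rDiag,
      rOff, weight] <;>
    match_scalars <;> field_simp <;> ring

end Braid

/-! ## Cofactor expansions -/

namespace IsQuantumMatrix

variable {A : Type} [Ring A] [Algebra ℂ A] {q : ℂˣ} {z : Fin 3 → Fin 3 → A} {w : A}

theorem transpose (h : IsQuantumMatrix q z) : IsQuantumMatrix q (fun i j => z j i) where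
  row i j k hjk := h.col j k i hjk
  col i k j hik := h.row j i k hik
  anti i k j l hik hlj := (h.anti l j k i hlj hik).symm
  diag i k j l hik hjl := by
    rw [h.diag j l i k hjl hik, h.anti j l k i hjl hik]

/-- The monomials of the transposed determinant are reordered using only pairs of entries that
commute, so no correction terms arise. -/
theorem qdet_transpose (h : IsQuantumMatrix q z) : qdet q (fun i j => z j i) = qdet q z := by
  have h1 : z 1 0 * z 2 1 * z 0 2 = z 0 2 * z 1 0 * z 2 1 := by
    rw [mul_assoc, ← h.anti 0 2 2 1 (by decide) (by decide), ← mul_assoc,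
      ← h.anti 0 1 2 0 (by decide) (by decide)]
  have h2 : z 2 0 * z 0 1 * z 1 2 = z 0 1 * z 1 2 * z 2 0 := by
    rw [← h.anti 0 2 1 0 (by decide) (by decide), mul_assoc,
      ← h.anti 1 2 2 0 (by decide) (by decide), mul_assoc]
  have h3 : z 0 0 * z 2 1 * z 1 2 = z 0 0 * z 1 2 * z 2 1 := by
    rw [mul_assoc, ← h.anti 1 2 2 1 (by decide) (by decide), ← mul_assoc]
  have h4 : z 2 0 * z 1 1 * z 0 2 = z 0 2 * z 1 1 * z 2 0 := by
    rw [← h.anti 1 2 1 0 (by decide) (by decide), mul_assoc,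
      ← h.anti 0 2 2 0 (by decide) (by decide), ← mul_assoc,
      ← h.anti 0 1 2 1 (by decide) (by decide)]
  have h5 : z 1 0 * z 0 1 * z 2 2 = z 0 1 * z 1 0 * z 2 2 := by
    rw [h.anti 0 1 1 0 (by decide) (by decide)]
  simp only [qdet, h1, h2, h3, h4, h5]
  abel

theorem minor_transpose (h : IsQuantumMatrix q z) {a b j l : Fin 3} (hab : a < b) (hjl : j < l) :
    minor q (fun i j => z j i) a b j l = minor q z j l a b := by
  rw [minor, minor, h.anti j l b a hjl hab]

theorem qdetRows_self_outer (h : IsQuantumMatrix q z) {k l : Fin 3} (hkl : k ≠ l) :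
    qdetRows q z k l k = 0 := by
  have hq : (q : ℂ) ≠ 0 := q.ne_zero
  rcases lt_or_gt_of_ne hkl with hlt | hlt
  · rw [h.qdetRows_swap_right k k l hlt, h.qdetRows_self_left, smul_zero, neg_zero]
  · rw [h.qdetRows_swap_left l k k hlt, h.qdetRows_self_right, smul_zero, neg_zero]

/-- The matrix of cofactors. -/
theorem mul_cofactor (h : IsQuantumMatrix q z) (i j : Fin 3) :
    ∑ k, z i k * antipodeMatrix q z 1 k j = if i = j then qdet q z else 0 := by
  have hq : (q : ℂ) ≠ 0 := q.ne_zero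
  -- Each column of cofactors produces, up to a factor, the expansion along the first row of a
  -- determinant whose first row is row i. It vanishes when a row is repeated.
  have h0 : ∑ k, z i k * antipodeMatrix q z 1 k 0 = qdetRows q z i 1 2 := by
    simp only [antipodeMatrix, qdetRows_left, minor, Fin.sum_univ_three, one_mul]
    simp
    simp only [mul_sub, mul_add, mul_neg, mul_smul_comm]
    module
  have h1 : ∑ k, z i k * antipodeMatrix q z 1 k 1 = -((q : ℂ)⁻¹ • qdetRows q z i 0 2) := by
    simp only [antipodeMatrix, qdetRows_left, minor, Fin.sum_univ_three, one_mul]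
    simp
    simp only [mul_sub, mul_add, mul_neg, mul_smul_comm]
    match_scalars <;> field_simp
  have h2 : ∑ k, z i k * antipodeMatrix q z 1 k 2 = ((q : ℂ)⁻¹) ^ 2 • qdetRows q z i 0 1 := by
    simp only [antipodeMatrix, qdetRows_left, minor, Fin.sum_univ_three, one_mul]
    simp
    simp only [mul_sub, mul_add, mul_neg, mul_smul_comm]
    match_scalars <;> field_simp
  have e01 : qdetRows q z 0 1 0 = 0 := h.qdetRows_self_outer (by decide)
  have e02 : qdetRows q z 2 0 2 = 0 := h.qdetRows_self_outer (by decide)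
  have e12 : qdetRows q z 2 1 2 = 0 := h.qdetRows_self_outer (by decide)
  have e10 : qdetRows q z 1 0 1 = 0 := h.qdetRows_self_outer (by decide)
  match j with
  | 0 => rw [h0]; fin_cases i <;> simp [qdetRows_012, h.qdetRows_self_left, e12]
  | 1 => rw [h1]; fin_cases i <;> simp [h.qdetRows_102, h.qdetRows_self_left, e02]
  | 2 => rw [h2]; fin_cases i <;> simp [h.qdetRows_201, h.qdetRows_self_left, e10]

/-- The column expansion is the row expansion of the transposed quantum matrix, which has the same
minors and the same determinant. -/
theorem cofactor_mul (h : IsQuantumMatrix q z) (i j : Fin 3) :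
    ∑ k, antipodeMatrix q z 1 i k * z k j = if i = j then qdet q z else 0 := by
  have hq : (q : ℂ) ≠ 0 := q.ne_zero
  have ht := h.transpose
  have h0 : ∑ k, antipodeMatrix q z 1 0 k * z k j
      = ((q : ℂ)⁻¹) ^ 2 • qdetRows q (fun i j => z j i) 1 2 j := by
    rw [qdetRows_right, h.minor_transpose (by decide) (by decide),
      h.minor_transpose (by decide) (by decide), h.minor_transpose (by decide) (by decide)]
    simp only [antipodeMatrix, minor, Fin.sum_univ_three, one_mul]
    simp
    simp only [sub_mul, add_mul, neg_mul, smul_mul_assoc]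
    match_scalars <;> field_simp
  have h1 : ∑ k, antipodeMatrix q z 1 1 k * z k j
      = -((q : ℂ)⁻¹ • qdetRows q (fun i j => z j i) 0 2 j) := by
    rw [qdetRows_right, h.minor_transpose (by decide) (by decide),
      h.minor_transpose (by decide) (by decide), h.minor_transpose (by decide) (by decide)]
    simp only [antipodeMatrix, minor, Fin.sum_univ_three, one_mul]
    simp
    simp only [sub_mul, add_mul, neg_mul, smul_mul_assoc]
    match_scalars <;> field_simp
  have h2 : ∑ k, antipodeMatrix q z 1 2 k * z k j
      = qdetRows q (fun i j => z j i) 0 1 j := by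
    rw [qdetRows_right, h.minor_transpose (by decide) (by decide),
      h.minor_transpose (by decide) (by decide), h.minor_transpose (by decide) (by decide)]
    simp only [antipodeMatrix, minor, Fin.sum_univ_three, one_mul]
    simp
    simp only [sub_mul, add_mul, neg_mul, smul_mul_assoc]
    module
  have e01 := ht.qdetRows_self_outer (k := 0) (l := 1) (by decide)
  have e02 := ht.qdetRows_self_outer (k := 0) (l := 2) (by decide)
  have e12 := ht.qdetRows_self_outer (k := 1) (l := 2) (by decide)
  have hd := h.qdet_transpose
  match i with
  | 0 => rw [h0]; fin_cases j <;> simp [ht.qdetRows_120, ht.qdetRows_self_right, e12, hd]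
  | 1 => rw [h1]; fin_cases j <;> simp [ht.qdetRows_021, ht.qdetRows_self_right, e02, hd]
  | 2 => rw [h2]; fin_cases j <;> simp [qdetRows_012, ht.qdetRows_self_right, e01, hd]

/-- Both sides are the triple product of Z, the cofactor matrix and Z, bracketed in the two possible
ways. -/
theorem qdet_comm (h : IsQuantumMatrix q z) (i j : Fin 3) :
    qdet q z * z i j = z i j * qdet q z := by
  have h1 : ∑ k, ∑ l, z i k * antipodeMatrix q z 1 k l * z l j = z i j * qdet q z := by
    simp only [mul_assoc, ← Finset.mul_sum, h.cofactor_mul]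
    simp
  have h2 : ∑ k, ∑ l, z i k * antipodeMatrix q z 1 k l * z l j = qdet q z * z i j := by
    rw [Finset.sum_comm]
    simp only [← Finset.sum_mul, h.mul_cofactor]
    simp
  rw [← h1, h2]

theorem antipodeMatrix_apply (i j : Fin 3) :
    antipodeMatrix q z w i j = w * antipodeMatrix q z 1 i j := by
  fin_cases i <;> fin_cases j <;> simp [antipodeMatrix]

theorem antipode_mul (h : IsQuantumMatrix q z) (hw : w * qdet q z = 1) (i j : Fin 3) :
    ∑ k, antipodeMatrix q z w i k * z k j = if i = j then 1 else 0 := by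
  simp only [antipodeMatrix_apply (w := w) i, mul_assoc, ← Finset.mul_sum, h.cofactor_mul]
  rw [mul_ite, hw, mul_zero]

theorem mul_antipode (h : IsQuantumMatrix q z) (hw : w * qdet q z = 1) (hw' : qdet q z * w = 1)
    (i j : Fin 3) : ∑ k, z i k * antipodeMatrix q z w k j = if i = j then 1 else 0 := by
  have hc (k : Fin 3) : z i k * w = w * z i k := by
    calc z i k * w = w * qdet q z * (z i k * w) := by rw [hw, one_mul]
      _ = w * (qdet q z * z i k) * w := by simp only [mul_assoc]
      _ = w * z i k := by rw [h.qdet_comm, mul_assoc, mul_assoc, hw', mul_one]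
  simp only [antipodeMatrix_apply (w := w) _ j, ← mul_assoc, hc]
  simp only [mul_assoc, ← Finset.mul_sum, h.mul_cofactor]
  rw [mul_ite, hw, mul_zero]

theorem smul (h : IsQuantumMatrix q z) (t : ℂ) : IsQuantumMatrix q (fun i j => t • z i j) where
  row i j k hjk := by
    simp only [smul_mul_smul_comm, h.row i j k hjk, smul_comm (t * t)]
  col i k j hik := by
    simp only [smul_mul_smul_comm, h.col i k j hik, smul_comm (t * t)]
  anti i k j l hik hlj := by
    simp only [smul_mul_smul_comm, h.anti i k j l hik hlj]
  diag i k j l hik hjl := by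
    simp only [smul_mul_smul_comm, h.diag i k j l hik hjl, smul_add, smul_comm (t * t)]

theorem qdet_smul (t : ℂ) : qdet q (fun i j => t • z i j) = t ^ 3 • qdet q z := by
  simp only [qdet, smul_mul_smul_comm]
  module

end IsQuantumMatrix

/-! ## Quantum groups generated by a quantum matrix -/

/-- A bialgebra generated by the entries of a quantum matrix and the inverse of its quantum
determinant, with the matrix coproduct. -/
structure IsQuantumGroup (q : ℂˣ) {A : Type} [Ring A] [Bialgebra ℂ A] (z : Fin 3 → Fin 3 → A)
    (w : A) : Prop where
  isQuantumMatrix : IsQuantumMatrix q z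
  comul_z : ∀ i j, Coalgebra.comul (R := ℂ) (z i j) = ∑ k, z i k ⊗ₜ[ℂ] z k j
  counit_z : ∀ i j, Coalgebra.counit (R := ℂ) (z i j) = if i = j then (1 : ℂ) else 0
  qdet_mul : qdet q z * w = 1
  mul_qdet : w * qdet q z = 1
  adjoin : ∀ S : Subalgebra ℂ A, (∀ i j, z i j ∈ S) → w ∈ S → S = ⊤

theorem mem_of_qdet_mem {q : ℂˣ} {A : Type} [Ring A] [Algebra ℂ A] {z : Fin 3 → Fin 3 → A}
    {S : Subalgebra ℂ A} (h : ∀ i j, z i j ∈ S) : qdet q z ∈ S := by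
  have hm (i j k l m n) : z i j * z k l * z m n ∈ S := S.mul_mem (S.mul_mem (h _ _) (h _ _)) (h _ _)
  exact S.sub_mem (S.sub_mem (S.sub_mem (S.add_mem (S.add_mem (hm ..) (S.smul_mem (hm ..) _))
    (S.smul_mem (hm ..) _)) (S.smul_mem (hm ..) _)) (S.smul_mem (hm ..) _)) (S.smul_mem (hm ..) _)

namespace IsQuantumGroup

variable {q : ℂˣ} {A : Type} [Ring A] [Bialgebra ℂ A] {z : Fin 3 → Fin 3 → A} {w : A}

/-- The closure properties cut out a subalgebra. It contains the determinant as soon as it contains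
the entries, so the hypothesis on `w` may assume the property of the determinant; in applications it
passes from there to the inverse. -/
theorem induction (h : IsQuantumGroup q z w) {P : A → Prop} (halg : ∀ c : ℂ, P (algebraMap ℂ A c))
    (hadd : ∀ a b, P a → P b → P (a + b)) (hmul : ∀ a b, P a → P b → P (a * b))
    (hz : ∀ i j, P (z i j)) (hw : P (qdet q z) → P w) (a : A) : P a := by
  let S : Subalgebra ℂ A :=
    { carrier := {a | P a}
      mul_mem' := fun {a b} => hmul a b
      add_mem' := fun {a b} => hadd a b
      algebraMap_mem' := halg }
  have hS : S = ⊤ := h.adjoin S hz (hw (mem_of_qdet_mem (S := S) hz))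
  exact (hS ▸ Algebra.mem_top : a ∈ S)

theorem antipode_mul (h : IsQuantumGroup q z w) (i j : Fin 3) :
    ∑ k, antipodeMatrix q z w i k * z k j = if i = j then 1 else 0 :=
  h.isQuantumMatrix.antipode_mul h.mul_qdet i j

theorem mul_antipode (h : IsQuantumGroup q z w) (i j : Fin 3) :
    ∑ k, z i k * antipodeMatrix q z w k j = if i = j then 1 else 0 :=
  h.isQuantumMatrix.mul_antipode h.mul_qdet h.qdet_mul i j

theorem qdet_comm (h : IsQuantumGroup q z w) (a : A) : qdet q z * a = a * qdet q z := by
  refine h.induction (P := fun a => qdet q z * a = a * qdet q z)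
    (fun c => (Algebra.commutes c _).symm) (fun a b ha hb => by rw [mul_add, add_mul, ha, hb])
    (fun a b ha hb => by rw [← mul_assoc, ha, mul_assoc, hb, mul_assoc])
    h.isQuantumMatrix.qdet_comm (fun _ => by rw [h.qdet_mul, h.mul_qdet]) a

theorem algHom_ext (h : IsQuantumGroup q z w) {B : Type*} [Ring B] [Algebra ℂ B] {f g : A →ₐ[ℂ] B}
    (hz : ∀ i j, f (z i j) = g (z i j)) : f = g := by
  refine AlgHom.ext (h.induction (fun c => by simp) (fun a b ha hb => by simp [ha, hb])
    (fun a b ha hb => by simp [ha, hb]) hz fun hD => ?_)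
  calc f w = g (w * qdet q z) * f w := by rw [h.mul_qdet, map_one, one_mul]
    _ = g w * f (qdet q z * w) := by rw [map_mul, ← hD, mul_assoc, ← map_mul]
    _ = g w := by rw [h.qdet_mul, map_one, mul_one]

/-- The weighted trace is invariant under the adjoint coaction. -/
theorem sum_weight_antipode_mul (h : IsQuantumGroup q z w) (a b : Fin 3) :
    ∑ i, Braid.weight q i • (antipodeMatrix q z w i a * z b i)
      = if a = b then algebraMap ℂ A (Braid.weight q a) else 0 := by
  have hq : (q : ℂ) ≠ 0 := q.ne_zero
  set S := antipodeMatrix q z w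
  set U : Fin 3 → Fin 3 → A := fun a b => ∑ i, Braid.weight q i • (S i a * z b i)
  have key (b f : Fin 3) :
      (if b = f then ∑ a, IsQuantumMatrix.rDiag q a b • U a a else 0)
        + IsQuantumMatrix.rOff f b • U f b = if b = f then algebraMap ℂ A ((q : ℂ) ^ 5) else 0 := by
    -- The relation R Z₁Z₂ = Z₁Z₂ R is multiplied by S(Z) on both sides. One side then simplifies by
    -- Z·S(Z) = 1, the other by S(Z)·Z = 1.
    have h1 (c : Fin 3) : (if b = f then ∑ a, IsQuantumMatrix.rDiag q a b • (S c a * z a c) else 0)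
        + IsQuantumMatrix.rOff f b • (S c f * z b c)
        = ∑ n, IsQuantumMatrix.rDiag q c n • (z b n * S n f) := by
      have e1 : ∑ a, ∑ n, S c a * (IsQuantumMatrix.rDiag q a b • (z a c * z b n)
          + IsQuantumMatrix.rOff a b • (z b c * z a n)) * S n f
          = (if b = f then ∑ a, IsQuantumMatrix.rDiag q a b • (S c a * z a c) else 0)
            + IsQuantumMatrix.rOff f b • (S c f * z b c) := by
        simp only [mul_add, add_mul, Finset.sum_add_distrib, mul_smul_comm, smul_mul_assoc,
          mul_assoc, ← Finset.smul_sum, ← Finset.mul_sum, h.mul_antipode, S]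
        simp [Finset.sum_ite_eq', apply_ite, Finset.sum_ite_irrel]
      have e2 : ∑ a, ∑ n, S c a * (IsQuantumMatrix.rDiag q c n • (z a c * z b n)
          + IsQuantumMatrix.rOff c n • (z a n * z b c)) * S n f
          = ∑ n, IsQuantumMatrix.rDiag q c n • (z b n * S n f) := by
        rw [Finset.sum_comm]
        simp only [mul_add, add_mul, Finset.sum_add_distrib, mul_smul_comm, smul_mul_assoc,
          ← mul_assoc, ← Finset.smul_sum, ← Finset.sum_mul, h.antipode_mul, S]
        simp [IsQuantumMatrix.rOff]
      rw [← e1, ← e2]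
      simp only [h.isQuantumMatrix.rtt]
    have h2 : ∑ c, Braid.weight q c • ∑ n, IsQuantumMatrix.rDiag q c n • (z b n * S n f)
        = if b = f then algebraMap ℂ A ((q : ℂ) ^ 5) else 0 := by
      -- This is what singles out the weights: the weighted column sums of the diagonal coefficients
      -- of R do not depend on the column.
      have h3 (n : Fin 3) : ∑ c, Braid.weight q c * IsQuantumMatrix.rDiag q c n = (q : ℂ) ^ 5 := by
        fin_cases n <;> simp [Fin.sum_univ_three, Braid.weight, IsQuantumMatrix.rDiag] <;>
          field_simp <;> ring
      simp only [Finset.smul_sum, smul_smul]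
      rw [Finset.sum_comm]
      simp only [← Finset.sum_smul, h3, ← Finset.smul_sum, h.mul_antipode, S]
      simp [Algebra.algebraMap_eq_smul_one]
    rw [← h2]
    simp only [← h1, smul_add, Finset.sum_add_distrib]
    congr 1
    · split_ifs
      · simp only [U, Finset.smul_sum]
        rw [Finset.sum_comm]
        simp only [smul_comm (Braid.weight q _)]
      · simp
    · simp only [U, Finset.smul_sum, smul_comm (Braid.weight q _)]
  change U a b = _
  -- The equations for the diagonal entries of `U` form a triangular system with pivot q and are
  -- solved one after the other.
  have k0 := key 0 0
  have k1 := key 1 1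
  have k2 := key 2 2
  simp [Fin.sum_univ_three, IsQuantumMatrix.rDiag, IsQuantumMatrix.rOff] at k0 k1 k2
  have u0 : U 0 0 = (q : ℂ) ^ 4 • 1 := by
    rw [← smul_right_injective A hq |>.eq_iff, k0, ← map_pow, Algebra.algebraMap_eq_smul_one]
    module
  have u1 : U 1 1 = (q : ℂ) ^ 2 • 1 := by
    rw [← smul_right_injective A hq |>.eq_iff, ← add_right_inj, k1, ← map_pow,
      Algebra.algebraMap_eq_smul_one, u0]
    match_scalars
    field_simp
    ring
  have u2 : U 2 2 = 1 := by
    rw [← smul_right_injective A hq |>.eq_iff, ← add_right_inj, k2, ← map_pow,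
      Algebra.algebraMap_eq_smul_one, u0, u1]
    match_scalars
    field_simp
    ring
  rcases eq_or_ne a b with rfl | hab
  · rw [if_pos rfl]
    match a with
    | 0 => simp [u0, Braid.weight, Algebra.algebraMap_eq_smul_one]
    | 1 => simp [u1, Braid.weight, Algebra.algebraMap_eq_smul_one]
    | 2 => simp [u2, Braid.weight]
  · simpa [hab, hab.symm, IsQuantumMatrix.rOff] using key b a

end IsQuantumGroup

theorem GLq.isQuantumGroup (q : ℂˣ) : IsQuantumGroup q (GLq.z q) (GLq.dinv q) where
  isQuantumMatrix := GLq.isQuantumMatrix q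
  comul_z := GLq.comulHom_z
  counit_z := GLq.counitHom_z
  qdet_mul := GLq.qdet_mul_dinv q
  mul_qdet := GLq.dinv_mul_qdet q
  adjoin S hz hw := by
    have hx : IsQuantumMatrix q (fun i j => (⟨GLq.z q i j, hz i j⟩ : S)) := by
      constructor
      · intro i j k hjk
        exact Subtype.ext ((GLq.isQuantumMatrix q).row i j k hjk)
      · intro i j k hjk
        exact Subtype.ext ((GLq.isQuantumMatrix q).col i j k hjk)
      · intro i k j l h h'
        exact Subtype.ext ((GLq.isQuantumMatrix q).anti i k j l h h')
      · intro i k j l h h'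
        exact Subtype.ext ((GLq.isQuantumMatrix q).diag i k j l h h')
    let f : GLq q →ₐ[ℂ] S := GLq.lift (fun i j => ⟨GLq.z q i j, hz i j⟩) ⟨GLq.dinv q, hw⟩ hx
      (Subtype.ext (GLq.qdet_mul_dinv q)) (Subtype.ext (GLq.dinv_mul_qdet q))
    have hf : S.val.comp f = AlgHom.id ℂ (GLq q) :=
      GLq.algHom_ext (fun i j => congrArg Subtype.val (GLq.lift_z i j))
        (congrArg Subtype.val GLq.lift_dinv)
    refine eq_top_iff.2 fun a _ => ?_
    rw [← show (f a : GLq q) = a from DFunLike.congr_fun hf a]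
    exact (f a).2

theorem SLq.proj_surjective (q : ℂˣ) : Function.Surjective (SLq.proj q) :=
  RingQuot.mkAlgHom_surjective ℂ _

theorem SLq.isQuantumGroup (q : ℂˣ) : IsQuantumGroup q (SLq.z q) 1 where
  isQuantumMatrix := SLq.isQuantumMatrix q
  comul_z := SLq.comulHom_z
  counit_z := SLq.counitHom_z
  qdet_mul := by rw [SLq.qdet_z, one_mul]
  mul_qdet := by rw [SLq.qdet_z, one_mul]
  adjoin S hz hw := by
    have h := (GLq.isQuantumGroup q).adjoin (S.comap (SLq.proj q)) hz
      (show SLq.proj q (GLq.dinv q) ∈ S by rwa [SLq.proj_dinv])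
    refine eq_top_iff.2 fun a _ => ?_
    obtain ⟨b, rfl⟩ := SLq.proj_surjective q a
    exact (h ▸ Algebra.mem_top : b ∈ S.comap (SLq.proj q))

/-! ## The representations of the quantum group given by the braid operator -/

namespace Family

open IsQuantumMatrix (rDiag rOff)
open Braid

/-- The representation of the quantum group on `W` given by the braid operator. -/
noncomputable def rep (q : ℂˣ) (ν : Family) (a u : Fin 3) : Matrix (Fin 3) (Fin 3) ℂ :=
  fun i c => (if i = u ∧ a = c then ν.coeff q i a else 0) + if i = c ∧ a = u then rOff i a else 0

set_option maxHeartbeats 1000000 in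
-- In essence the Yang–Baxter equation for the braid operator, verified entry by entry.
theorem isQuantumMatrix_rep (q : ℂˣ) (ν : Family) : IsQuantumMatrix q (ν.rep q) := by
  have hq : (q : ℂ) ≠ 0 := q.ne_zero
  have h1 : (q : ℂ)⁻¹ - q = q * (((q : ℂ)⁻¹ - q) * (q : ℂ)⁻¹) := by field_simp
  have h2 : (0 : ℂ) = ((q : ℂ)⁻¹ - q) * ((q : ℂ)⁻¹ - q) + (q - (q : ℂ)⁻¹) * ((q : ℂ)⁻¹ - q) := by
    ring
  have h3 : ((q : ℂ) - (q : ℂ)⁻¹) * q = q * ((q : ℂ) - (q : ℂ)⁻¹) := mul_comm _ _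
  cases ν
  all_goals
    constructor
    · intro i j k hjk
      ext a b
      fin_cases i <;> fin_cases j <;> fin_cases k <;> first | exact absurd hjk (by decide) | skip
      all_goals
        fin_cases a <;> fin_cases b <;>
        simp [rep, coeff, rDiag, rOff, Matrix.mul_apply] <;>
        first | exact h1 | exact h3
    · intro i j k hjk
      ext a b
      fin_cases i <;> fin_cases j <;> first | exact absurd hjk (by decide) | skip
      all_goals
        fin_cases k <;> fin_cases a <;> fin_cases b <;>
        simp [rep, coeff, rDiag, rOff, Matrix.mul_apply, hq]
    · intro i k j l hik hlj
      ext a b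
      fin_cases i <;> fin_cases k <;> first | exact absurd hik (by decide) | skip
      all_goals
        fin_cases j <;> fin_cases l <;> first | exact absurd hlj (by decide) | skip
      all_goals
        fin_cases a <;> fin_cases b <;>
        simp [rep, coeff, rDiag, rOff, Matrix.mul_apply]
    · intro i k j l hik hlj
      ext a b
      fin_cases i <;> fin_cases k <;> first | exact absurd hik (by decide) | skip
      all_goals
        fin_cases j <;> fin_cases l <;> first | exact absurd hlj (by decide) | skip
      all_goals
        fin_cases a <;> fin_cases b <;>
        simp [rep, coeff, rDiag, rOff, Matrix.mul_apply] <;>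
        exact h2

theorem qdet_rep (q : ℂˣ) (ν : Family) : qdet q (ν.rep q) = ν.base q • 1 := by
  ext a b
  cases ν <;> fin_cases a <;> fin_cases b <;>
    simp [qdet, base, rep, coeff, rDiag, rOff, Matrix.mul_apply, Fin.sum_univ_three]

/-- The right action of the entry `z n l` on the nine-dimensional space of left-invariant
one-forms. -/
noncomputable def action (q : ℂˣ) (ν : Family) (t : ℂ) (n l : Fin 3) :
    Matrix (Fin 3 × Fin 3) (Fin 3 × Fin 3) ℂ :=
  fun I J => t * actL (ν.coeff q) (actR (ν.coeff q)
    (leg fun x y => if (x, y) = J then (1 : ℂ) else 0)) I.1 n I.2 l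

/-- In R g₂ R the row index of g meets only the left factor and the column index only the right one.
The nine-dimensional action is therefore a tensor product of two three-dimensional ones, from which
it inherits the quantum matrix relations. -/
theorem action_eq (q : ℂˣ) (ν : Family) (t : ℂ) :
    ν.action q t = fun n l => t • Matrix.kroneckerAlgEquiv (Fin 3) (Fin 3) ℂ
      (∑ u, ν.rep q n u ⊗ₜ[ℂ] ν.rep q l u) := by
  funext n l
  ext ⟨i, j⟩ ⟨a, b⟩
  rw [map_sum, Matrix.smul_apply, Matrix.sum_apply, action, smul_eq_mul]
  congr 1
  have h (u : Fin 3) : Matrix.kroneckerAlgEquiv (Fin 3) (Fin 3) ℂ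
      (ν.rep q n u ⊗ₜ[ℂ] ν.rep q l u) (i, j) (a, b) = ν.rep q n u i a * ν.rep q l u j b := rfl
  simp only [h, rep, actL, actR, leg, smul_eq_mul, Prod.mk.injEq, add_mul, mul_add,
    Finset.sum_add_distrib]
  have e1 : ∑ u, (if i = u ∧ n = a then ν.coeff q i n else 0)
      * (if j = u ∧ l = b then ν.coeff q j l else 0)
      = if i = j ∧ n = a ∧ l = b then ν.coeff q i n * ν.coeff q j l else 0 := by
    rw [Finset.sum_eq_single i (fun u _ hu => by simp [hu.symm]) (by simp)]
    grind
  have e2 : ∑ u, (if i = a ∧ n = u then rOff i n else 0)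
      * (if j = u ∧ l = b then ν.coeff q j l else 0)
      = if n = j ∧ i = a ∧ l = b then rOff i n * ν.coeff q j l else 0 := by
    rw [Finset.sum_eq_single n (fun u _ hu => by simp [hu.symm]) (by simp)]
    grind
  have e3 : ∑ u, (if i = u ∧ n = a then ν.coeff q i n else 0)
      * (if j = b ∧ l = u then rOff j l else 0)
      = if i = l ∧ n = a ∧ j = b then ν.coeff q i n * rOff j l else 0 := by
    rw [Finset.sum_eq_single i (fun u _ hu => by simp [hu.symm]) (by simp)]
    grind
  have e4 : ∑ u, (if i = a ∧ n = u then rOff i n else 0) * (if j = b ∧ l = u then rOff j l else 0)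
      = if n = l ∧ i = a ∧ j = b then rOff i n * rOff j l else 0 := by
    rw [Finset.sum_eq_single n (fun u _ hu => by simp [hu.symm]) (by simp)]
    grind
  rw [e1, e2, e3, e4]
  simp only [← ite_and, mul_ite, mul_one, mul_zero]
  ring

/-- The action is t times the product of two quantum matrices with mutually commuting entries, the
second one transposed. Determinants multiply under such products, each factor contributes `base`,
and the scaling contributes t³. -/
theorem isQuantumMatrix_action (q : ℂˣ) (ν : Family) (t : ℂ) :
    IsQuantumMatrix q (ν.action q t) ∧
      qdet q (ν.action q t) = (t ^ 3 * ν.base q ^ 2) • 1 := by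
  have hx := (isQuantumMatrix_rep q ν).map
    (Algebra.TensorProduct.includeLeft : Matrix (Fin 3) (Fin 3) ℂ →ₐ[ℂ]
      Matrix (Fin 3) (Fin 3) ℂ ⊗[ℂ] Matrix (Fin 3) (Fin 3) ℂ)
  have hy := (isQuantumMatrix_rep q ν).transpose.map
    (Algebra.TensorProduct.includeRight : Matrix (Fin 3) (Fin 3) ℂ →ₐ[ℂ]
      Matrix (Fin 3) (Fin 3) ℂ ⊗[ℂ] Matrix (Fin 3) (Fin 3) ℂ)
  have e : ν.action q t = fun n l => t • (Matrix.kroneckerAlgEquiv (Fin 3) (Fin 3) ℂ).toAlgHom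
      (∑ u, (Algebra.TensorProduct.includeLeft : Matrix (Fin 3) (Fin 3) ℂ →ₐ[ℂ]
        Matrix (Fin 3) (Fin 3) ℂ ⊗[ℂ] Matrix (Fin 3) (Fin 3) ℂ) (ν.rep q n u) *
        (Algebra.TensorProduct.includeRight : Matrix (Fin 3) (Fin 3) ℂ →ₐ[ℂ]
          Matrix (Fin 3) (Fin 3) ℂ ⊗[ℂ] Matrix (Fin 3) (Fin 3) ℂ) (ν.rep q l u)) := by
    rw [action_eq]
    simp
  have hc (i j k l : Fin 3) : (Algebra.TensorProduct.includeRight : Matrix (Fin 3) (Fin 3) ℂ →ₐ[ℂ]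
      Matrix (Fin 3) (Fin 3) ℂ ⊗[ℂ] Matrix (Fin 3) (Fin 3) ℂ) (ν.rep q j i)
        * (Algebra.TensorProduct.includeLeft : Matrix (Fin 3) (Fin 3) ℂ →ₐ[ℂ]
      Matrix (Fin 3) (Fin 3) ℂ ⊗[ℂ] Matrix (Fin 3) (Fin 3) ℂ) (ν.rep q k l)
        = (Algebra.TensorProduct.includeLeft : Matrix (Fin 3) (Fin 3) ℂ →ₐ[ℂ]
      Matrix (Fin 3) (Fin 3) ℂ ⊗[ℂ] Matrix (Fin 3) (Fin 3) ℂ) (ν.rep q k l)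
        * (Algebra.TensorProduct.includeRight : Matrix (Fin 3) (Fin 3) ℂ →ₐ[ℂ]
      Matrix (Fin 3) (Fin 3) ℂ ⊗[ℂ] Matrix (Fin 3) (Fin 3) ℂ) (ν.rep q j i) := by
    simp
  rw [e]
  refine ⟨((hx.mul hy hc).map _).smul t, ?_⟩
  rw [IsQuantumMatrix.qdet_smul, ← map_qdet, hy.qdet_mul hc, ← map_qdet, ← map_qdet,
    (isQuantumMatrix_rep q ν).qdet_transpose, qdet_rep, map_smul, map_smul, map_one, map_one,
    smul_mul_smul_comm, one_mul, map_smul, map_one, smul_smul, pow_two]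

end Family

/-! ## The bicovariant bimodule of a nine-dimensional representation -/

namespace Convolution

open Coalgebra (comul coassoc_apply)

variable {A : Type} [Ring A] [Bialgebra ℂ A] {I : Type} [Fintype I] [DecidableEq I]

/-- The convolution of the identity with a matrix representation. -/
noncomputable def matrixRight (f : A →ₐ[ℂ] Matrix I I ℂ) : A →ₐ[ℂ] Matrix I I A :=
  ((matrixEquivTensor I ℂ A).symm : A ⊗[ℂ] Matrix I I ℂ →ₐ[ℂ] Matrix I I A).comp
    ((Algebra.TensorProduct.map (AlgHom.id ℂ A) f).comp (Bialgebra.comulAlgHom ℂ A))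

/-- The convolution of a matrix representation with the identity. -/
noncomputable def matrixLeft (f : A →ₐ[ℂ] Matrix I I ℂ) : A →ₐ[ℂ] Matrix I I A :=
  ((matrixEquivTensor I ℂ A).symm : A ⊗[ℂ] Matrix I I ℂ →ₐ[ℂ] Matrix I I A).comp
    ((Algebra.TensorProduct.comm ℂ (Matrix I I ℂ) A : _ →ₐ[ℂ] _).comp
      ((Algebra.TensorProduct.map f (AlgHom.id ℂ A)).comp (Bialgebra.comulAlgHom ℂ A)))

/-- The matrix elements of a representation. -/
noncomputable def matrixElement (f : A →ₐ[ℂ] Matrix I I ℂ) (i j : I) : A →ₗ[ℂ] ℂ :=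
  Matrix.entryLinearMap ℂ ℂ i j ∘ₗ f.toLinearMap

variable (f : A →ₐ[ℂ] Matrix I I ℂ) (i j : I)

/-- The entries of `matrixRight`. -/
noncomputable def entryRight : A →ₗ[ℂ] A :=
  (TensorProduct.rid ℂ A : A ⊗[ℂ] ℂ →ₗ[ℂ] A) ∘ₗ (matrixElement f i j).lTensor A ∘ₗ comul

/-- The entries of `matrixLeft`. -/
noncomputable def entryLeft : A →ₗ[ℂ] A :=
  (TensorProduct.lid ℂ A : ℂ ⊗[ℂ] A →ₗ[ℂ] A) ∘ₗ (matrixElement f i j).rTensor A ∘ₗ comul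

theorem matrixRight_apply (a : A) : matrixRight f a i j = entryRight f i j a := by
  simp only [matrixRight, entryRight, AlgHom.comp_apply, LinearMap.comp_apply]
  change (matrixEquivTensor I ℂ A).symm (Algebra.TensorProduct.map (AlgHom.id ℂ A) f
    (comul (R := ℂ) a)) i j = _
  induction comul (R := ℂ) a with
  | zero => simp
  | add x y hx hy => simp only [map_add, Matrix.add_apply, hx, hy]
  | tmul x y =>
    simp [matrixElement, Matrix.map_apply, ← Algebra.commutes, Algebra.smul_def]

theorem matrixLeft_apply (a : A) : matrixLeft f a i j = entryLeft f i j a := by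
  simp only [matrixLeft, entryLeft, AlgHom.comp_apply, LinearMap.comp_apply]
  change (matrixEquivTensor I ℂ A).symm (Algebra.TensorProduct.comm ℂ (Matrix I I ℂ) A
    (Algebra.TensorProduct.map f (AlgHom.id ℂ A) (comul (R := ℂ) a))) i j = _
  induction comul (R := ℂ) a with
  | zero => simp
  | add x y hx hy => simp only [map_add, Matrix.add_apply, hx, hy]
  | tmul x y =>
    simp [matrixElement, Matrix.map_apply, ← Algebra.commutes, Algebra.smul_def]

/-- Coassociativity: convolving with a functional on the right leaves the left leg of the coproduct
alone. This gives the left covariance of the calculus. -/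
theorem comul_entryRight (a : A) :
    comul (R := ℂ) (entryRight f i j a) = (entryRight f i j).lTensor A (comul (R := ℂ) a) := by
  have h1 (u : A ⊗[ℂ] A) : comul (R := ℂ) (TensorProduct.rid ℂ A ((matrixElement f i j).lTensor A u))
      = TensorProduct.map LinearMap.id ((TensorProduct.rid ℂ A : A ⊗[ℂ] ℂ →ₗ[ℂ] A) ∘ₗ
        (matrixElement f i j).lTensor A)
        (TensorProduct.assoc ℂ A A A (comul.rTensor A u)) := by
    induction u with
    | zero => simp
    | add x y hx hy => simp only [map_add, hx, hy]
    | tmul x y =>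
      simp only [LinearMap.lTensor_tmul, TensorProduct.rid_tmul, map_smul,
        LinearMap.rTensor_tmul]
      induction comul (R := ℂ) x with
      | zero => simp
      | add x y hx hy => simp only [smul_add, TensorProduct.add_tmul, map_add, hx, hy]
      | tmul x x' => simp
  have h2 := h1 (comul a)
  rw [coassoc_apply] at h2
  refine h2.trans ?_
  induction comul (R := ℂ) a with
  | zero => simp
  | add x y hx hy => simp only [map_add, hx, hy]
  | tmul x y => rfl

/-- Both sides apply the matrix element to the middle leg of the iterated coproduct. The identity
lets left and right convolutions be exchanged in the proof of right covariance. -/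
theorem lTensor_entryLeft (a : A) :
    (entryLeft f i j).lTensor A (comul (R := ℂ) a)
      = (entryRight f i j).rTensor A (comul (R := ℂ) a) := by
  have h1 (u : A ⊗[ℂ] A) : TensorProduct.map LinearMap.id
      ((TensorProduct.lid ℂ A : ℂ ⊗[ℂ] A →ₗ[ℂ] A) ∘ₗ (matrixElement f i j).rTensor A)
        (TensorProduct.assoc ℂ A A A (comul.rTensor A u))
      = (entryRight f i j).rTensor A u := by
    induction u with
    | zero => simp
    | add x y hx hy => simp only [map_add, hx, hy]
    | tmul x y =>
      simp only [LinearMap.rTensor_tmul, entryRight, LinearMap.comp_apply]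
      induction comul (R := ℂ) x with
      | zero => simp
      | add x y hx hy => simp only [TensorProduct.add_tmul, map_add, hx, hy]
      | tmul x x' => simp [TensorProduct.smul_tmul]
  rw [← h1, coassoc_apply]
  induction comul (R := ℂ) a with
  | zero => simp
  | add x y hx hy => simp only [map_add, hx, hy]
  | tmul x y => rfl

end Convolution

open Convolution (matrixRight matrixLeft entryRight entryLeft matrixRight_apply matrixLeft_apply)

namespace Family

/-- The one-forms of the calculi of the two families: the free left module over a basis of nine
left-invariant forms, with the right action given by a representation. -/
def Form {A : Type} [Ring A] [Bialgebra ℂ A]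
    (_ : A →ₐ[ℂ] Matrix (Fin 3 × Fin 3) (Fin 3 × Fin 3) ℂ) : Type :=
  Fin 3 × Fin 3 → A

namespace Form

variable {A : Type} [Ring A] [Bialgebra ℂ A] (f : A →ₐ[ℂ] Matrix (Fin 3 × Fin 3) (Fin 3 × Fin 3) ℂ)

noncomputable instance : AddCommGroup (Form f) :=
  inferInstanceAs (AddCommGroup (Fin 3 × Fin 3 → A))

noncomputable instance : Module ℂ (Form f) := inferInstanceAs (Module ℂ (Fin 3 × Fin 3 → A))

noncomputable instance : Module A (Form f) := inferInstanceAs (Module A (Fin 3 × Fin 3 → A))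

instance : IsScalarTower ℂ A (Form f) :=
  inferInstanceAs (IsScalarTower ℂ A (Fin 3 × Fin 3 → A))

noncomputable instance : SMul Aᵐᵒᵖ (Form f) :=
  ⟨fun b x => Matrix.vecMul (x : Fin 3 × Fin 3 → A) (matrixRight f (unop b))⟩

variable {f}

theorem op_smul_apply (b : A) (x : Form f) (J : Fin 3 × Fin 3) :
    (op b • x) J = ∑ I, x I * matrixRight f b I J := rfl

theorem smul_apply (a : A) (x : Form f) (J : Fin 3 × Fin 3) : (a • x) J = a * x J := rfl

theorem csmul_apply (a : ℂ) (x : Form f) (J : Fin 3 × Fin 3) : (a • x) J = a • x J := rfl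

theorem add_apply (x y : Form f) (J : Fin 3 × Fin 3) : (x + y) J = x J + y J := rfl

theorem sub_apply (x y : Form f) (J : Fin 3 × Fin 3) : (x - y) J = x J - y J := rfl

theorem sum_apply {ι : Type*} (s : Finset ι) (x : ι → Form f) (J : Fin 3 × Fin 3) :
    (∑ i ∈ s, x i) J = ∑ i ∈ s, x i J := Finset.sum_apply J s x

@[ext] theorem ext {x y : Form f} (h : ∀ I, x I = y I) : x = y := funext h

noncomputable instance : Module Aᵐᵒᵖ (Form f) where
  one_smul x := by
    change Matrix.vecMul x (matrixRight f 1) = x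
    rw [map_one]
    exact Matrix.vecMul_one _
  mul_smul b c x := by
    change Matrix.vecMul x (matrixRight f (unop c * unop b))
      = Matrix.vecMul (Matrix.vecMul x (matrixRight f (unop c))) (matrixRight f (unop b))
    rw [map_mul]
    exact (Matrix.vecMul_vecMul _ _ _).symm
  smul_zero b := Matrix.zero_vecMul _
  zero_smul x := by
    change Matrix.vecMul x (matrixRight f 0) = 0
    rw [map_zero]
    exact Matrix.vecMul_zero _
  smul_add b x y := Matrix.add_vecMul _ _ _
  add_smul b c x := by
    change Matrix.vecMul x (matrixRight f (unop b + unop c)) = _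
    rw [map_add]
    exact Matrix.vecMul_add _ _ _

instance : IsScalarTower ℂ Aᵐᵒᵖ (Form f) where
  smul_assoc c b x := by
    change Matrix.vecMul x (matrixRight f (c • unop b)) = _
    rw [map_smul]
    exact Matrix.vecMul_smul _ _ _

instance : SMulCommClass A Aᵐᵒᵖ (Form f) where
  smul_comm a b x := by
    ext I
    rw [smul_apply, ← MulOpposite.op_unop b, op_smul_apply, op_smul_apply, Finset.mul_sum]
    simp only [smul_apply, mul_assoc]

/-- The basis of left-invariant forms. -/
def eta (I : Fin 3 × Fin 3) : Form f := Pi.single I (1 : A)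

/-- The invariant form. -/
noncomputable def omega (q : ℂˣ) : Form f :=
  fun I => if I.1 = I.2 then algebraMap ℂ A (Braid.weight q I.1) else 0

theorem eta_apply (I J : Fin 3 × Fin 3) : (eta I : Form f) J = if J = I then 1 else 0 :=
  Pi.single_apply I (1 : A) J

theorem eq_sum_eta (x : Form f) : x = ∑ I, x I • eta I := by
  refine ext fun J => ?_
  simp only [sum_apply, smul_apply, eta_apply, mul_ite, mul_one, mul_zero]
  exact ((Finset.sum_ite_eq Finset.univ J _).trans (if_pos (Finset.mem_univ J))).symm

theorem omega_eq (q : ℂˣ) : (omega q : Form f) = ∑ i, Braid.weight q i • eta (i, i) := by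
  refine ext fun J => ?_
  obtain ⟨a, b⟩ := J
  simp only [sum_apply, csmul_apply, eta_apply, omega, Prod.mk.injEq]
  rcases eq_or_ne a b with rfl | h
  · simp [Algebra.algebraMap_eq_smul_one]
  · rw [if_neg h, Finset.sum_eq_zero]
    intro i _
    rw [if_neg, smul_zero]
    rintro ⟨rfl, rfl⟩
    exact h rfl

theorem op_smul_eta (b : A) (I : Fin 3 × Fin 3) :
    op b • (eta I : Form f) = ∑ J, matrixRight f b I J • eta J := by
  refine (Matrix.single_one_vecMul I (matrixRight f b)).trans ?_
  exact eq_sum_eta (f := f) (matrixRight f b I)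

/-- The differential, the commutator with the invariant form. -/
noncomputable def diff (q : ℂˣ) : A →ₗ[ℂ] Form f where
  toFun a := op a • omega q - a • omega q
  map_add' a b := by rw [MulOpposite.op_add, add_smul, add_smul]; abel
  map_smul' c a := by
    rw [MulOpposite.op_smul, smul_assoc, smul_assoc, ← smul_sub]
    rfl

theorem diff_apply (q : ℂˣ) (a : A) : (diff q a : Form f) = op a • omega q - a • omega q := rfl

theorem diff_mul (q : ℂˣ) (a b : A) :
    (diff q (a * b) : Form f) = op b • diff q a + a • diff q b := by
  simp only [diff_apply, smul_sub, MulOpposite.op_mul, mul_smul, smul_comm a (op b)]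
  abel

end Form

end Family

/-! ## The calculi of the two families -/

namespace Braid

theorem sum_leg_smul {M : Type*} [AddCommGroup M] [Module ℂ M] (r : Fin 3 → Fin 3 → ℂ)
    (g : Fin 3 × Fin 3 → M) (i n j l : Fin 3) :
    ∑ J, actL r (actR r (leg fun x y => if (x, y) = J then (1 : ℂ) else 0)) i n j l • g J
      = actL r (actR r (leg fun x y => g (x, y))) i n j l := by
  simp only [actL, actR, leg, smul_eq_mul, add_smul, mul_smul, Finset.sum_add_distrib,
    ← Finset.smul_sum]
  congr 1 <;> congr 2 <;> congr 1 <;> split_ifs <;> simp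

end Braid

namespace Family

/-- The factor `κ` in `τ = κ ω`. -/
noncomputable def kappa (q : ℂˣ) (ν : Family) (t : ℂ) : ℂ :=
  (t - 1) * ((q : ℂ) ^ 4 + (q : ℂ) ^ 2 + 1) + t * (ν.hecke q * ν.trace q)

theorem kappa_first (q : ℂˣ) (t : ℂ) : kappa q .first t * (q : ℂ) ^ 2 =
    (q : ℂ) ^ 4 * ((q : ℂ) ^ 2 + 1) * (t - 1) - (q : ℂ) ^ 2 + t := by
  have hq : (q : ℂ) ≠ 0 := q.ne_zero
  simp only [kappa, hecke, trace]
  field_simp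
  ring

theorem kappa_second (q : ℂˣ) (t : ℂ) : kappa q .second t =
    (q : ℂ) ^ 4 * ((q : ℂ) ^ 2 * t - 1) + ((q : ℂ) ^ 2 + 1) * (t - 1) := by
  have hq : (q : ℂ) ≠ 0 := q.ne_zero
  simp only [kappa, hecke, trace]
  field_simp
  ring

/-- The polynomial in the admissibility condition is κ, up to the factor q² in the first family. The
denominators of the structure constants are this same polynomial. -/
theorem admissible_iff (q : ℂˣ) (ν : Family) (t : ℂ) :
    Admissible q ν t ↔ t ≠ 0 ∧ kappa q ν t ≠ 0 := by
  have hq : (q : ℂ) ≠ 0 := q.ne_zero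
  cases ν <;> refine and_congr_right fun _ => not_congr ?_
  · have e : ((q : ℂ) ^ 6 + (q : ℂ) ^ 4 + 1) * t - ((q : ℂ) ^ 6 + (q : ℂ) ^ 4 + (q : ℂ) ^ 2)
        = kappa q .first t * (q : ℂ) ^ 2 := by
      rw [kappa_first]
      ring
    rw [e]
    simp
  · rw [kappa_second]
    ring_nf

open Braid

namespace Form

variable {q : ℂˣ} {A : Type} [Ring A] [Bialgebra ℂ A] {z : Fin 3 → Fin 3 → A} {w : A}
  {f : A →ₐ[ℂ] Matrix (Fin 3 × Fin 3) (Fin 3 × Fin 3) ℂ} {ν : Family} {t : ℂ}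

section

variable (h : IsQuantumGroup q z w)
include h

theorem matrixRight_z (k l : Fin 3) (I J : Fin 3 × Fin 3) :
    matrixRight f (z k l) I J = ∑ n, f (z n l) I J • z k n := by
  rw [matrixRight_apply, entryRight]
  simp only [LinearMap.comp_apply, h.comul_z, map_sum, LinearMap.lTensor_tmul]
  rfl

theorem matrixLeft_z (k l : Fin 3) (I J : Fin 3 × Fin 3) :
    matrixLeft f (z k l) I J = ∑ n, f (z k n) I J • z n l := by
  rw [matrixLeft_apply, entryLeft]
  simp only [LinearMap.comp_apply, h.comul_z, map_sum, LinearMap.rTensor_tmul]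
  rfl

end

variable (h : IsQuantumGroup q z w) (hf : ∀ n l, f (z n l) = ν.action q t n l)
include h hf

/-- In matrix notation η₁Z₂ = t Z₂ R η₂ R. -/
theorem op_smul_eta_z (i j k l : Fin 3) : op (z k l) • (eta (i, j) : Form f) =
    t • ∑ n, z k n • actL (ν.coeff q) (actR (ν.coeff q) (leg fun x y => eta (x, y))) i n j l := by
  rw [op_smul_eta]
  simp only [matrixRight_z h, hf, action, Finset.sum_smul, smul_assoc, mul_smul]
  rw [Finset.sum_comm, Finset.smul_sum]
  refine Finset.sum_congr rfl fun n _ => ?_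
  rw [← sum_leg_smul, Finset.smul_sum, Finset.smul_sum]
  refine Finset.sum_congr rfl fun J _ => ?_
  rw [smul_comm (z k n)]

/-- The weighted trace over the first leg of η₁Z₂ = t Z₂ R η₂ R, evaluated by `trace_actL_actR`. -/
theorem op_smul_omega_z (k l : Fin 3) : op (z k l) • (omega q : Form f) =
    t • z k l • omega q + (t * (ν.hecke q * ν.trace q)) • ∑ n, z k n • eta (n, l) := by
  have h1 (c : ℂ) (x : Form f) : op (z k l) • c • x = c • op (z k l) • x :=
    smul_comm _ _ _
  have h2 (c : ℂ) (a : A) (x : Form f) : c • a • x = a • c • x := smul_comm _ _ _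
  conv_lhs => rw [omega_eq, Finset.smul_sum]
  simp only [h1, op_smul_eta_z h hf, smul_comm (weight q _) t]
  rw [← Finset.smul_sum, mul_smul, ← smul_add]
  congr 1
  simp only [Finset.smul_sum, h2]
  rw [Finset.sum_comm]
  simp only [← Finset.smul_sum, trace_actL_actR, ← omega_eq, smul_add, Finset.sum_add_distrib]
  rw [add_comm]
  simp [smul_ite]

theorem diff_z (i j : Fin 3) : (diff q (z i j) : Form f) =
    (t - 1) • z i j • omega q + (t * (ν.hecke q * ν.trace q)) • ∑ n, z i n • eta (n, j) := by
  rw [diff_apply, op_smul_omega_z h hf, sub_smul, one_smul]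
  abel

theorem theta_eq (i j : Fin 3) :
    ∑ k, antipodeMatrix q z w i k • (diff q (z k j) : Form f) =
      (if i = j then (t - 1) • omega q else 0) + (t * (ν.hecke q * ν.trace q)) • eta (i, j) := by
  have h2 (c : ℂ) (a : A) (x : Form f) : a • c • x = c • a • x :=
    smul_comm _ _ _
  simp only [diff_z h hf, smul_add, Finset.sum_add_distrib, h2, smul_smul,
    Finset.smul_sum]
  congr 1
  · rw [← Finset.smul_sum, ← Finset.sum_smul, h.antipode_mul]
    split_ifs <;> simp
  · simp only [← Finset.smul_sum]
    rw [Finset.sum_comm]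
    simp only [← Finset.sum_smul, h.antipode_mul]
    simp

/-- Here S(Z)dZ = (t−1)ω·1 + cη with c = t·μ·trace. The weighted trace of the identity is q⁴ + q² +
1 and that of η is ω, so the factor is κ. -/
theorem trTheta_eq :
    (q : ℂ) ^ 4 • ∑ k, antipodeMatrix q z w 0 k • (diff q (z k 0) : Form f)
      + (q : ℂ) ^ 2 • ∑ k, antipodeMatrix q z w 1 k • (diff q (z k 1) : Form f)
      + ∑ k, antipodeMatrix q z w 2 k • (diff q (z k 2) : Form f) = ν.kappa q t • omega q := by
  simp only [theta_eq h hf, if_true, kappa]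
  rw [omega_eq]
  simp only [Fin.sum_univ_three, weight]
  simp
  module

/-- The forms S(Z)dZ lie in the span. Their weighted trace κω yields ω because κ ≠ 0, and
subtracting its multiples leaves cη with c ≠ 0. -/
theorem span_diff_z (hκ : ν.kappa q t ≠ 0) (hc : t * (ν.hecke q * ν.trace q) ≠ 0) :
    Submodule.span A (Set.range fun p : Fin 3 × Fin 3 => (diff q (z p.1 p.2) : Form f)) = ⊤ := by
  set N := Submodule.span A (Set.range fun p : Fin 3 × Fin 3 => (diff q (z p.1 p.2) : Form f))
  have hs (c : ℂ) (x : Form f) (hx : x ∈ N) : c • x ∈ N := by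
    rw [← algebraMap_smul A c x]
    exact N.smul_mem _ hx
  have hs' (c : ℂ) (hc : c ≠ 0) (x : Form f) (hx : c • x ∈ N) : x ∈ N := by
    have := hs c⁻¹ _ hx
    rwa [smul_smul, inv_mul_cancel₀ hc, one_smul] at this
  have hθ (i j : Fin 3) : ∑ k, antipodeMatrix q z w i k • (diff q (z k j) : Form f) ∈ N :=
    N.sum_mem fun k _ => N.smul_mem _ (Submodule.subset_span ⟨(k, j), rfl⟩)
  have hω : omega q ∈ N := by
    refine hs' _ hκ _ ?_
    rw [← trTheta_eq h hf]
    exact N.add_mem (N.add_mem (hs _ _ (hθ _ _)) (hs _ _ (hθ _ _))) (hθ _ _)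
  have hη (i j : Fin 3) : eta (i, j) ∈ N := by
    refine hs' _ hc _ ?_
    have := hθ i j
    rw [theta_eq h hf] at this
    refine (N.add_mem_iff_right ?_).1 this
    split_ifs
    · exact hs _ _ hω
    · exact N.zero_mem
  refine eq_top_iff.2 fun x _ => ?_
  rw [eq_sum_eta x]
  exact N.sum_mem fun I _ => N.smul_mem _ (hη I.1 I.2)

theorem linearIndependent_diff_z (hκ : ν.kappa q t ≠ 0)
    (hc : t * (ν.hecke q * ν.trace q) ≠ 0) :
    LinearIndependent A fun p : Fin 3 × Fin 3 => (diff q (z p.1 p.2) : Form f) := by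
  rw [Fintype.linearIndependent_iff]
  intro g hg
  set c := t * (ν.hecke q * ν.trace q)
  -- The coefficients are absorbed into Z, so that the vanishing combination of the dz i j becomes
  -- (t−1)·tr(H)·ω + c·∑ H η. Since Z is invertible, H = 0 gives back g = 0.
  set H : Fin 3 → Fin 3 → A := fun n j => ∑ i, g (i, j) * z i n
  have h2 (c : ℂ) (a : A) (x : Form f) : a • c • x = c • a • x :=
    smul_comm _ _ _
  have h1 : (t - 1) • (∑ j, H j j) • omega q + c • ∑ n, ∑ j, H n j • eta (n, j) = (0 : Form f) := by
    rw [← hg, Fintype.sum_prod_type]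
    simp only [diff_z h hf, smul_add, Finset.sum_add_distrib, h2, ← Finset.smul_sum]
    congr 2
    · rw [Finset.sum_comm]
      simp only [Finset.sum_smul, mul_smul]
    · simp only [H, Finset.sum_smul, mul_smul, Finset.smul_sum]
      rw [Finset.sum_comm]
      conv_rhs => rw [Finset.sum_comm]
      refine Finset.sum_congr rfl fun j _ => ?_
      rw [Finset.sum_comm]
  have h3 (a b : Fin 3) : (t - 1) • ((∑ j, H j j) * if a = b then algebraMap ℂ A (weight q a) else 0)
      + c • H a b = 0 := by
    have := congrFun h1 (a, b)
    refine Eq.trans ?_ this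
    rw [add_apply, csmul_apply, csmul_apply, smul_apply, ← Fintype.sum_prod_type'
      (f := fun n j => H n j • (eta (n, j) : Form f))]
    congr 2
    exact (congrFun (eq_sum_eta (f := f) fun p => H p.1 p.2) (a, b))
  -- Adding the three diagonal components gives κ·tr(H) = 0.
  have h4 : ∑ j, H j j = 0 := by
    have e0 := h3 0 0
    have e1 := h3 1 1
    have e2 := h3 2 2
    simp only [if_true, ← Algebra.commutes, ← Algebra.smul_def] at e0 e1 e2
    have e : ν.kappa q t • ∑ j, H j j = 0 := by
      have e3 := congrArg₂ (· + ·) (congrArg₂ (· + ·) e0 e1) e2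
      simp only [add_zero] at e3
      rw [← e3, kappa]
      simp only [Fin.sum_univ_three, weight, c]
      simp
      module
    exact (smul_eq_zero.1 e).resolve_left hκ
  have h5 (a b : Fin 3) : H a b = 0 := by
    have := h3 a b
    rw [h4, zero_mul, smul_zero, zero_add] at this
    exact (smul_eq_zero.1 this).resolve_left hc
  rintro ⟨i, j⟩
  calc g (i, j) = ∑ k, g (k, j) * ∑ n, z k n * antipodeMatrix q z w n i := by
        simp [h.mul_antipode]
    _ = ∑ n, H n j * antipodeMatrix q z w n i := by
        simp only [H, Finset.mul_sum, Finset.sum_mul, mul_assoc]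
        exact Finset.sum_comm
    _ = 0 := by simp [h5]

end Form

/-- The data of a calculus of one of the two families over a quantum group: the parameter and the
right action on the left-invariant forms. -/
structure IsAction (q : ℂˣ) {A : Type} [Ring A] [Bialgebra ℂ A] (z : Fin 3 → Fin 3 → A) (w : A)
    (ν : Family) (t : ℂ) (f : A →ₐ[ℂ] Matrix (Fin 3 × Fin 3) (Fin 3 × Fin 3) ℂ) : Prop where
  group : IsQuantumGroup q z w
  apply_z : ∀ n l, f (z n l) = ν.action q t n l
  sq_ne_one : (q : ℂ) ^ 2 ≠ 1
  admissible : Admissible q ν t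

namespace IsAction

variable {q : ℂˣ} {A : Type} [Ring A] [Bialgebra ℂ A] {z : Fin 3 → Fin 3 → A} {w : A}
  {f : A →ₐ[ℂ] Matrix (Fin 3 × Fin 3) (Fin 3 × Fin 3) ℂ} {ν : Family} {t : ℂ}

theorem kappa_ne_zero (h : IsAction q z w ν t f) : ν.kappa q t ≠ 0 :=
  ((admissible_iff q ν t).1 h.admissible).2

theorem factor_ne_zero (h : IsAction q z w ν t f) : t * (ν.hecke q * ν.trace q) ≠ 0 :=
  mul_ne_zero ((admissible_iff q ν t).1 h.admissible).1
    (mul_ne_zero (hecke_ne_zero h.sq_ne_one ν) (trace_ne_zero q ν))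

/-- The calculus `Γ_ν(t)`. -/
noncomputable def calculus (h : IsAction q z w ν t f) : Calculus.{0} A where
  Form := Form f
  d := Form.diff q
  leibniz := Form.diff_mul q
  span_range_d := by
    refine eq_top_iff.2 ?_
    rw [← Form.span_diff_z h.group h.apply_z h.kappa_ne_zero h.factor_ne_zero]
    refine Submodule.span_mono ?_
    rintro _ ⟨p, rfl⟩
    exact ⟨_, rfl⟩

theorem hasBasis (h : IsAction q z w ν t f) : h.calculus.HasBasis z :=
  ⟨Form.linearIndependent_diff_z h.group h.apply_z h.kappa_ne_zero h.factor_ne_zero,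
    Form.span_diff_z h.group h.apply_z h.kappa_ne_zero h.factor_ne_zero⟩

end IsAction

end Family

/-! ## Bicovariance of the calculi of the two families -/

namespace Braid

variable {M : Type*} [AddCommGroup M] [Module ℂ M]

theorem actL_sum {ι : Type*} (s : Finset ι) (r : Fin 3 → Fin 3 → ℂ)
    (T : ι → Fin 3 → Fin 3 → Fin 3 → Fin 3 → M) (i k j l : Fin 3) :
    ∑ x ∈ s, actL r (T x) i k j l = actL r (fun i k j l => ∑ x ∈ s, T x i k j l) i k j l := by
  simp only [actL, Finset.sum_add_distrib, Finset.smul_sum]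

theorem actR_sum {ι : Type*} (s : Finset ι) (r : Fin 3 → Fin 3 → ℂ)
    (T : ι → Fin 3 → Fin 3 → Fin 3 → Fin 3 → M) (i k j l : Fin 3) :
    ∑ x ∈ s, actR r (T x) i k j l = actR r (fun i k j l => ∑ x ∈ s, T x i k j l) i k j l := by
  simp only [actR, Finset.sum_add_distrib, Finset.smul_sum]

variable {A : Type} [Ring A] [Algebra ℂ A] [Module A M] [IsScalarTower ℂ A M]

theorem actL_smul (r : Fin 3 → Fin 3 → ℂ) (T : Fin 3 → Fin 3 → Fin 3 → Fin 3 → A)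
    (m : Fin 3 → Fin 3 → M) (i k j l x y : Fin 3) :
    actL r T i k x y • m j l = actL r (fun i k j l => T i k x y • m j l) i k j l := by
  simp only [actL, add_smul, smul_assoc]

theorem smul_actR (r : Fin 3 → Fin 3 → ℂ) (a : Fin 3 → Fin 3 → A)
    (T : Fin 3 → Fin 3 → Fin 3 → Fin 3 → M) (i k j l x y : Fin 3) :
    a i k • actR r T x y j l = actR r (fun i k j l => a i k • T x y j l) i k j l := by
  have hc (c : ℂ) (a : A) (m : M) : a • c • m = c • a • m := by
    rw [← algebraMap_smul A c m, smul_smul, ← Algebra.commutes, mul_smul, algebraMap_smul]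
  simp only [actR, smul_add, hc]

/-- The braid operators move past the matrix product with the products of the entries of a quantum
matrix. -/
theorem sum_prod_smul_actL_actR {q : ℂˣ} {z : Fin 3 → Fin 3 → A} (h : IsQuantumMatrix q z)
    (ν : Family) (g : Fin 3 → Fin 3 → M) (i k j l : Fin 3) :
    ∑ a, ∑ b, prod z i k a b • actL (ν.coeff q) (actR (ν.coeff q) (leg g)) a b j l
      = actL (ν.coeff q) (actR (ν.coeff q) fun i k j l => z i j • ∑ m, z k m • g m l) i k j l := by
  rw [← sum_actR_smul, ← actL_prod h]
  have hb (a b : Fin 3) := actL_smul (ν.coeff q) (prod z) (actR (ν.coeff q) (leg g) a b) i k j l a b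
  simp only [hb, actL_sum]
  congr 1
  funext i k j l
  have hc (a b : Fin 3) := smul_actR (ν.coeff q) (fun i k => prod z i k a b) (leg g) i k j l a b
  simp only [hc, actR_sum]
  congr 1
  funext i k j l
  rw [Finset.sum_eq_single j]
  · simp only [leg, if_true, prod, mul_smul, Finset.smul_sum]
  · intro a _ ha
    simp [leg, ha]
  · simp

theorem sum_actL_actR_smul_prod {q : ℂˣ} {z : Fin 3 → Fin 3 → A} (h : IsQuantumMatrix q z)
    (ν : Family) (g : Fin 3 → Fin 3 → ℂ) (i k j l : Fin 3) :
    ∑ a, ∑ b, actL (ν.coeff q) (actR (ν.coeff q) (leg g)) i k a b • prod z a b j l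
      = actL (ν.coeff q) (actR (ν.coeff q) fun i k j l => z i j * ∑ m, g k m • z m l) i k j l := by
  rw [actL_actR, sum_actR_smul, actL_prod h]
  have hb (a b : Fin 3) := actL_smul (ν.coeff q) (leg g) (actR (ν.coeff q) (prod z) a b) i k j l a b
  simp only [hb, actL_sum]
  congr 1
  funext i k j l
  have hc (a b : Fin 3) := smul_actR (ν.coeff q) (fun i k => leg g i k a b) (prod z) i k j l a b
  simp only [hc, actR_sum]
  congr 1
  funext i k j l
  rw [Finset.sum_eq_single i]
  · simp only [leg, if_true, prod, Finset.mul_sum, mul_smul_comm]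
  · intro a _ ha
    simp [leg, ha.symm]
  · simp

end Braid

namespace LinearMap

variable {M N P ι : Type*} [AddCommGroup M] [AddCommGroup N] [AddCommGroup P] [Module ℂ M]
  [Module ℂ N] [Module ℂ P]

theorem lTensor_finsetSum (s : Finset ι) (g : ι → N →ₗ[ℂ] P) :
    (∑ i ∈ s, g i).lTensor M = ∑ i ∈ s, (g i).lTensor M :=
  map_sum (LinearMap.lTensorHom M) g s

theorem rTensor_finsetSum (s : Finset ι) (g : ι → N →ₗ[ℂ] P) :
    (∑ i ∈ s, g i).rTensor M = ∑ i ∈ s, (g i).rTensor M :=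
  map_sum (LinearMap.rTensorHom M) g s

end LinearMap

namespace Family

namespace Form

open Braid

variable {q : ℂˣ} {A : Type} [Ring A] [Bialgebra ℂ A] {z : Fin 3 → Fin 3 → A} {w : A}
  {f : A →ₐ[ℂ] Matrix (Fin 3 × Fin 3) (Fin 3 × Fin 3) ℂ} {ν : Family} {t : ℂ}

/-- The right coadjoint corepresentation on the left-invariant forms. -/
noncomputable def coadjoint (q : ℂˣ) (z : Fin 3 → Fin 3 → A) (w : A) :
    Matrix (Fin 3 × Fin 3) (Fin 3 × Fin 3) A :=
  fun I J => antipodeMatrix q z w I.1 J.1 * z J.2 I.2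

/-- Woronowicz's compatibility condition between the right action on left-invariant forms and their
right coaction. It is multiplicative in a, so it needs to be checked only on the generators. -/
theorem matrixRight_mul_coadjoint (h : IsQuantumGroup q z w)
    (hf : ∀ n l, f (z n l) = ν.action q t n l) (a : A) :
    matrixRight f a * coadjoint q z w = coadjoint q z w * matrixLeft f a := by
  refine h.induction (P := fun a => matrixRight f a * coadjoint q z w
    = coadjoint q z w * matrixLeft f a) (fun c => ?_) (fun a b ha hb => ?_) (fun a b ha hb => ?_)
    (fun k l => ?_) (fun hD => ?_) a
  · rw [AlgHom.commutes, AlgHom.commutes, Algebra.commutes]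
  · rw [map_add, map_add, add_mul, mul_add, ha, hb]
  · rw [map_mul, map_mul, mul_assoc, hb, ← mul_assoc, ha, mul_assoc]
  · have key (p : Fin 3) (j c d : Fin 3) :
        ∑ i, z p i * (matrixRight f (z k l) * coadjoint q z w) (i, j) (c, d)
          = ∑ i, z p i * (coadjoint q z w * matrixLeft f (z k l)) (i, j) (c, d) := by
      trans t • actL (ν.coeff q) (actR (ν.coeff q) fun i k j l =>
        z i j * if k = c then z d l else 0) p k j l
      · have e := sum_prod_smul_actL_actR h.isQuantumMatrix ν
          (fun x y => antipodeMatrix q z w x c * z d y) p k j l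
        have e2 (n l : Fin 3) : ∑ m, z n m • (antipodeMatrix q z w m c * z d l)
            = if n = c then z d l else 0 := by
          simp only [smul_eq_mul, ← mul_assoc, ← Finset.sum_mul, h.mul_antipode, ite_mul, one_mul,
            zero_mul]
        simp only [smul_eq_mul] at e e2
        simp only [e2] at e
        rw [← e, Finset.smul_sum]
        refine Finset.sum_congr rfl fun i _ => ?_
        simp only [Matrix.mul_apply, matrixRight_z h, hf, action, Finset.sum_mul]
        rw [Finset.sum_comm, Finset.mul_sum, Finset.smul_sum]
        refine Finset.sum_congr rfl fun n _ => ?_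
        rw [show (fun x y => antipodeMatrix q z w x c * z d y)
          = fun x y => coadjoint q z w (x, y) (c, d) from rfl,
          ← sum_leg_smul _ fun J => coadjoint q z w J (c, d)]
        simp only [Finset.mul_sum, Finset.smul_sum]
        refine Finset.sum_congr rfl fun J _ => ?_
        simp only [prod, mul_smul, smul_mul_assoc, mul_smul_comm, mul_assoc]
      · have e := sum_actL_actR_smul_prod h.isQuantumMatrix ν
          (fun x y => if (x, y) = (c, d) then (1 : ℂ) else 0) p k j l
        have e2 (n l : Fin 3) : ∑ m, (if (n, m) = (c, d) then (1 : ℂ) else 0) • z m l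
            = if n = c then z d l else 0 := by
          rcases eq_or_ne n c with rfl | hn
          · simp
          · simp [hn]
        simp only [e2] at e
        rw [← e]
        calc t • ∑ a, ∑ b, _
            = ∑ b, z b j * matrixLeft f (z k l) (p, b) (c, d) := by
              rw [Finset.smul_sum]
              refine Finset.sum_congr rfl fun b _ => ?_
              simp only [matrixLeft_z h, hf, action, Finset.mul_sum, Finset.smul_sum, mul_smul,
                prod, mul_smul_comm]
          _ = ∑ a, (∑ i, z p i * antipodeMatrix q z w i a)
                * ∑ b, z b j * matrixLeft f (z k l) (a, b) (c, d) := by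
              simp [h.mul_antipode]
          _ = _ := by
              simp only [Matrix.mul_apply, coadjoint, Fintype.sum_prod_type, Finset.sum_mul,
                Finset.mul_sum, mul_assoc]
              exact (Finset.sum_congr rfl fun _ _ => Finset.sum_comm).trans Finset.sum_comm
    ext ⟨i, j⟩ ⟨c, d⟩
    calc _ = ∑ i', ∑ p, antipodeMatrix q z w i p * z p i'
          * (matrixRight f (z k l) * coadjoint q z w) (i', j) (c, d) := by
          simp only [← Finset.sum_mul, h.antipode_mul]
          simp
      _ = ∑ i', ∑ p, antipodeMatrix q z w i p * z p i'
          * (coadjoint q z w * matrixLeft f (z k l)) (i', j) (c, d) := by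
          rw [Finset.sum_comm]
          conv_rhs => rw [Finset.sum_comm]
          simp only [mul_assoc, ← Finset.mul_sum, key]
      _ = _ := by
          simp only [← Finset.sum_mul, h.antipode_mul]
          simp
  -- The condition passes from the determinant to its inverse: insert D·w = 1 on the right and
  -- cancel w·D = 1 on the left.
  · calc _ = matrixRight f w * coadjoint q z w * matrixLeft f (qdet q z * w) := by
          rw [h.qdet_mul, map_one, mul_one]
      _ = matrixRight f (w * qdet q z) * coadjoint q z w * matrixLeft f w := by
          rw [map_mul, map_mul, ← mul_assoc, mul_assoc _ (coadjoint q z w), ← hD]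
          simp only [mul_assoc]
      _ = _ := by rw [h.mul_qdet, map_one, one_mul]

/-- The inclusion of the multiples of a basis element. -/
noncomputable def single (f : A →ₐ[ℂ] Matrix (Fin 3 × Fin 3) (Fin 3 × Fin 3) ℂ)
    (I : Fin 3 × Fin 3) : A →ₗ[ℂ] Form f :=
  LinearMap.toSpanSingleton A (Form f) (eta I) |>.restrictScalars ℂ

theorem single_apply (I : Fin 3 × Fin 3) (a : A) : single f I a = a • eta I := rfl

/-- The coordinates of a form. -/
def coord (f : A →ₐ[ℂ] Matrix (Fin 3 × Fin 3) (Fin 3 × Fin 3) ℂ)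
    (I : Fin 3 × Fin 3) : Form f →ₗ[ℂ] A :=
  LinearMap.proj (R := ℂ) (φ := fun _ : Fin 3 × Fin 3 => A) I

theorem coord_apply (I : Fin 3 × Fin 3) (x : Form f) : coord f I x = x I := rfl

/-- The coordinates of the invariant form. -/
noncomputable def weightCoord (q : ℂˣ) (I : Fin 3 × Fin 3) : ℂ :=
  if I.1 = I.2 then weight q I.1 else 0

/-- The coordinates of the differential. -/
noncomputable def diffCoord (q : ℂˣ) (f : A →ₐ[ℂ] Matrix (Fin 3 × Fin 3) (Fin 3 × Fin 3) ℂ)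
    (J : Fin 3 × Fin 3) : A →ₗ[ℂ] A :=
  ∑ I, weightCoord q I • entryRight f I J - weightCoord q J • LinearMap.id

theorem diff_apply_coord (J : Fin 3 × Fin 3) (a : A) : (diff q a : Form f) J = diffCoord q f J a := by
  have e (I : Fin 3 × Fin 3) : (omega q : Form f) I = algebraMap ℂ A (weightCoord q I) := by
    simp only [omega, weightCoord]
    split_ifs <;> simp
  rw [diff_apply, sub_apply, smul_apply, op_smul_apply, e, ← Algebra.commutes, ← Algebra.smul_def]
  simp only [e, ← Algebra.smul_def, matrixRight_apply]
  simp [diffCoord]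

theorem diff_eq_sum : (diff q : A →ₗ[ℂ] Form f) = ∑ J, single f J ∘ₗ diffCoord q f J := by
  ext1 a
  rw [eq_sum_eta (diff q a), LinearMap.sum_apply]
  simp only [diff_apply_coord]
  rfl

theorem comul_diffCoord (J : Fin 3 × Fin 3) (a : A) : Coalgebra.comul (R := ℂ) (diffCoord q f J a)
    = (diffCoord q f J).lTensor A (Coalgebra.comul (R := ℂ) a) := by
  simp [diffCoord, Convolution.comul_entryRight, LinearMap.lTensor_sub, LinearMap.lTensor_smul,
    LinearMap.lTensor_finsetSum]

/-- The left coaction. -/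
noncomputable def coactL (f : A →ₐ[ℂ] Matrix (Fin 3 × Fin 3) (Fin 3 × Fin 3) ℂ) :
    Form f →ₗ[ℂ] A ⊗[ℂ] Form f :=
  ∑ I, (single f I).lTensor A ∘ₗ Coalgebra.comul ∘ₗ coord f I

/-- The right coaction. -/
noncomputable def coactR (q : ℂˣ) (z : Fin 3 → Fin 3 → A) (w : A)
    (f : A →ₐ[ℂ] Matrix (Fin 3 × Fin 3) (Fin 3 × Fin 3) ℂ) : Form f →ₗ[ℂ] Form f ⊗[ℂ] A :=
  ∑ J, ∑ K, TensorProduct.map (single f K) (LinearMap.mulRight ℂ (coadjoint q z w J K))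
    ∘ₗ Coalgebra.comul ∘ₗ coord f J

/-- Multiplication by the coadjoint matrix exchanges right and left convolutions, and ω is fixed by
the coadjoint coaction (`hw`). Hence the coordinates of the commutator with ω are carried to those
built from left convolutions. -/
theorem sum_mulRight_diffCoord (h : IsQuantumGroup q z w)
    (hf : ∀ n l, f (z n l) = ν.action q t n l) (K : Fin 3 × Fin 3) :
    ∑ J, LinearMap.mulRight ℂ (coadjoint q z w J K) ∘ₗ diffCoord q f J
      = ∑ J, weightCoord q J • entryLeft f J K - weightCoord q K • LinearMap.id := by
  have hw (J : Fin 3 × Fin 3) : ∑ I, weightCoord q I • coadjoint q z w I J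
      = algebraMap ℂ A (weightCoord q J) := by
    rw [Fintype.sum_prod_type]
    simp only [weightCoord, coadjoint, ite_smul, zero_smul, Finset.sum_ite_eq, Finset.mem_univ,
      if_true, h.sum_weight_antipode_mul]
    split_ifs <;> simp
  ext1 a
  have key (I : Fin 3 × Fin 3) : ∑ J, entryRight f I J a * coadjoint q z w J K
      = ∑ J, coadjoint q z w I J * entryLeft f J K a := by
    simpa only [Matrix.mul_apply, matrixRight_apply, matrixLeft_apply]
      using congrFun (congrFun (matrixRight_mul_coadjoint h hf a) I) K
  simp only [LinearMap.sum_apply, LinearMap.comp_apply, diffCoord, LinearMap.sub_apply,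
    LinearMap.smul_apply, LinearMap.mulRight_apply, LinearMap.id_apply, sub_mul,
    Finset.sum_sub_distrib, Finset.sum_mul, smul_mul_assoc]
  congr 1
  · rw [Finset.sum_comm]
    simp only [← Finset.smul_sum, key]
    simp only [Finset.smul_sum, ← smul_mul_assoc]
    rw [Finset.sum_comm]
    simp only [← Finset.sum_mul, hw, ← Algebra.smul_def]
  · simp only [← mul_smul_comm, ← Finset.mul_sum, hw]
    rw [← Algebra.commutes, ← Algebra.smul_def]

theorem rTensor_diffCoord (h : IsQuantumGroup q z w)
    (hf : ∀ n l, f (z n l) = ν.action q t n l) (K : Fin 3 × Fin 3) (a : A) :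
    (diffCoord q f K).rTensor A (Coalgebra.comul (R := ℂ) a) =
      ∑ J, (LinearMap.mulRight ℂ (coadjoint q z w J K)).lTensor A
        ((diffCoord q f J).lTensor A (Coalgebra.comul (R := ℂ) a)) := by
  have e := congrArg (fun g : A →ₗ[ℂ] A => g.lTensor A (Coalgebra.comul (R := ℂ) a))
    (sum_mulRight_diffCoord h hf K)
  simp only [LinearMap.lTensor_finsetSum, LinearMap.lTensor_sub, LinearMap.lTensor_smul,
    LinearMap.sum_apply, LinearMap.sub_apply, LinearMap.smul_apply, LinearMap.lTensor_comp,
    LinearMap.comp_apply, Convolution.lTensor_entryLeft] at e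
  rw [e]
  simp [diffCoord, LinearMap.rTensor_sub, LinearMap.rTensor_smul, LinearMap.rTensor_finsetSum]

variable (f) in
/-- The left action. -/
noncomputable def leftAction : A →ₗ[ℂ] Form f →ₗ[ℂ] Form f :=
  (Algebra.lsmul ℂ ℂ (Form f) : A →ₐ[ℂ] Module.End ℂ (Form f)).toLinearMap

theorem leftAction_apply (a : A) (x : Form f) : leftAction f a x = a • x := rfl

theorem map₂_lTensor_single (I : Fin 3 × Fin 3) (u x : A ⊗[ℂ] A) :
    TensorProduct.map₂ (LinearMap.mul ℂ A) (leftAction f) u ((single f I).lTensor A x)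
      = (single f I).lTensor A (u * x) := by
  induction u with
  | zero => simp
  | add u u' hu hu' => simp only [map_add, LinearMap.add_apply, add_mul, hu, hu']
  | tmul u u' =>
    induction x with
    | zero => simp
    | add x x' hx hx' => simp only [map_add, mul_add, hx, hx']
    | tmul x x' =>
      simp only [LinearMap.lTensor_tmul, TensorProduct.map₂_apply_tmul, TensorProduct.map_tmul,
        Algebra.TensorProduct.tmul_mul_tmul, single_apply, mul_smul, leftAction_apply,
        LinearMap.mul_apply']

theorem map₂_map_single (K : Fin 3 × Fin 3) (c : A) (u x : A ⊗[ℂ] A) :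
    TensorProduct.map₂ (leftAction f) (LinearMap.mul ℂ A) u
      (TensorProduct.map (single f K) (LinearMap.mulRight ℂ c) x)
      = TensorProduct.map (single f K) (LinearMap.mulRight ℂ c) (u * x) := by
  induction u with
  | zero => simp
  | add u u' hu hu' => simp only [map_add, LinearMap.add_apply, add_mul, hu, hu']
  | tmul u u' =>
    induction x with
    | zero => simp
    | add x x' hx hx' => simp only [map_add, mul_add, hx, hx']
    | tmul x x' =>
      simp only [TensorProduct.map_tmul, TensorProduct.map₂_apply_tmul,
        Algebra.TensorProduct.tmul_mul_tmul, single_apply, mul_smul, LinearMap.mulRight_apply,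
        LinearMap.mul_apply', mul_assoc, leftAction_apply]

theorem coactL_smul_diff (a b : A) : coactL f (a • diff q b) =
    TensorProduct.map₂ (LinearMap.mul ℂ A) (leftAction f) (Coalgebra.comul (R := ℂ) a)
      (TensorProduct.map LinearMap.id (diff q) (Coalgebra.comul (R := ℂ) b)) := by
  have e : TensorProduct.map LinearMap.id (diff q) (Coalgebra.comul (R := ℂ) b)
      = ∑ I, (single f I).lTensor A (Coalgebra.comul (R := ℂ) (diffCoord q f I b)) := by
    change (diff q : A →ₗ[ℂ] Form f).lTensor A _ = _
    simp only [diff_eq_sum, LinearMap.lTensor_finsetSum, LinearMap.sum_apply,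
      LinearMap.lTensor_comp, LinearMap.comp_apply, comul_diffCoord]
  rw [e, map_sum]
  simp only [map₂_lTensor_single, ← Bialgebra.comul_mul]
  simp only [coactL, LinearMap.sum_apply, LinearMap.comp_apply, coord_apply, smul_apply,
    diff_apply_coord]

theorem coactR_smul_diff (h : IsQuantumGroup q z w) (hf : ∀ n l, f (z n l) = ν.action q t n l)
    (a b : A) : coactR q z w f (a • diff q b) =
      TensorProduct.map₂ (leftAction f) (LinearMap.mul ℂ A) (Coalgebra.comul (R := ℂ) a)
        (TensorProduct.map (diff q) LinearMap.id (Coalgebra.comul (R := ℂ) b)) := by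
  have e : TensorProduct.map (diff q) LinearMap.id (Coalgebra.comul (R := ℂ) b)
      = ∑ J, ∑ K, TensorProduct.map (single f K) (LinearMap.mulRight ℂ (coadjoint q z w J K))
        (Coalgebra.comul (R := ℂ) (diffCoord q f J b)) := by
    change (diff q : A →ₗ[ℂ] Form f).rTensor A _ = _
    rw [diff_eq_sum]
    simp only [LinearMap.rTensor_finsetSum, LinearMap.sum_apply, LinearMap.rTensor_comp,
      LinearMap.comp_apply, comul_diffCoord, rTensor_diffCoord h hf, map_sum]
    rw [Finset.sum_comm]
    refine Finset.sum_congr rfl fun J _ => Finset.sum_congr rfl fun K _ => ?_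
    rw [← LinearMap.comp_apply (f := LinearMap.rTensor A (single f K)),
      LinearMap.rTensor_comp_lTensor]
  rw [e]
  simp only [map_sum, map₂_map_single, ← Bialgebra.comul_mul]
  simp only [coactR, LinearMap.sum_apply, LinearMap.comp_apply, coord_apply, smul_apply,
    diff_apply_coord]

end Form

open Form

theorem IsAction.isBicovariant {q : ℂˣ} {A : Type} [Ring A] [Bialgebra ℂ A]
    {z : Fin 3 → Fin 3 → A} {w : A} {f : A →ₐ[ℂ] Matrix (Fin 3 × Fin 3) (Fin 3 × Fin 3) ℂ}
    {ν : Family} {t : ℂ} (h : IsAction q z w ν t f) : h.calculus.IsBicovariant :=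
  ⟨⟨coactL f, coactL_smul_diff⟩, ⟨coactR q z w f, coactR_smul_diff h.group h.apply_z⟩⟩

end Family

/-! ## The commutation relations in terms of the braid operator -/

namespace Calculus

open Braid

variable {A : Type} [Ring A] [Algebra ℂ A]

/-- The commutation relations of the two families in terms of the braid operator. -/
def IsBraided (q : ℂˣ) (z : Fin 3 → Fin 3 → A) (S : Matrix (Fin 3) (Fin 3) A) (ν : Family) (t : ℂ)
    (C : Calculus.{u} A) : Prop :=
  ∀ i k j l, op (z k l) • C.d (z i j) =
    t • actL (ν.coeff q) (actR (ν.coeff q) fun i k j l => z i j • C.d (z k l)) i k j l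
      + (t - 1) • z i j • C.d (z k l)
      - (ν.kappa q t)⁻¹ • ((t - 1) ^ 2 • prod z i k j l
        + (t * (t - 1) * ν.hecke q) • actL (ν.coeff q) (prod z) i k j l) • C.trTheta q z S

variable {q : ℂˣ} {z : Fin 3 → Fin 3 → A} {S : Matrix (Fin 3) (Fin 3) A} {t : ℂ}
  {C : Calculus.{u} A}

/-- Each index pattern picks out certain entries of R. What remains is a comparison of scalars,
after products of entries are brought to a common order where necessary. -/
theorem IsBraided.isGamma {ν : Family} (h : C.IsBraided q z S ν t) (hz : IsQuantumMatrix q z)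
    (hκ : ν.kappa q t ≠ 0) : C.IsGamma q z S ν t := by
  have hq : (q : ℂ) ≠ 0 := q.ne_zero
  obtain ⟨act, hact⟩ : ∃ act : A →ₗ[ℂ] C.Form →ₗ[ℂ] C.Form, ∀ a ρ, a • ρ = act a ρ :=
    ⟨C.leftAction, fun _ _ => rfl⟩
  cases ν
  · have e : (q : ℂ) ^ 4 * ((q : ℂ) ^ 2 + 1) * (t - 1) - (q : ℂ) ^ 2 + t
      = Family.kappa q .first t * (q : ℂ) ^ 2 := (Family.kappa_first q t).symm
    generalize hK : Family.kappa q .first t = K at hκ e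
    constructor
    · intro i j
      rw [h i i j j]
      simp only [sigma₁, e, actL, actR, prod, Family.coeff, IsQuantumMatrix.rDiag,
        IsQuantumMatrix.rOff, Family.hecke, hK, hact, map_add, map_smul, LinearMap.add_apply,
        LinearMap.smul_apply, if_true]
      match_scalars <;> field_simp <;> ring
    · intro i j l hjl
      rw [h i i j l]
      simp only [sigma₁, e, actL, actR, prod, Family.coeff, IsQuantumMatrix.rDiag,
        IsQuantumMatrix.rOff, Family.hecke, hK, hact, map_add, map_smul, LinearMap.add_apply,
        LinearMap.smul_apply, if_true, hjl, hjl.ne, if_false]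
      match_scalars <;> field_simp <;> ring
    · intro i k j hik
      rw [h i k j j]
      simp only [sigma₁, e, actL, actR, prod, Family.coeff, IsQuantumMatrix.rDiag,
        IsQuantumMatrix.rOff, Family.hecke, hK, hact, map_add, map_smul, LinearMap.add_apply,
        LinearMap.smul_apply, hz.col i k j hik, if_true, hik, hik.ne, if_false]
      match_scalars <;> field_simp <;> ring
    · intro i k j l hik hjl
      rw [h i k j l]
      simp only [sigma₁, beta₁, e, actL, actR, prod, Family.coeff, IsQuantumMatrix.rDiag,
        IsQuantumMatrix.rOff, Family.hecke, hK, hact, map_add, map_sub, map_smul, LinearMap.add_apply,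
        LinearMap.sub_apply, LinearMap.smul_apply, hz.anti i k l j hik hjl,  if_true, hik, hik.ne, hjl, hjl.ne, if_false]
      match_scalars <;> field_simp <;> ring
    · intro i k j l hik hjl
      rw [h i k j l]
      have e2 : z k j * z i l = z i l * z k j - ((q : ℂ) - (q : ℂ)⁻¹) • (z i j * z k l) := by
        rw [hz.diag i k l j hik hjl, hz.anti i k j l hik hjl]
        abel
      simp only [sigma₁, beta₁, e, actL, actR, prod, Family.coeff, IsQuantumMatrix.rDiag,
        IsQuantumMatrix.rOff, Family.hecke, hK, hact, map_add, map_sub, map_smul, LinearMap.add_apply,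
        LinearMap.sub_apply, LinearMap.smul_apply, e2,  if_true, hik, hik.ne, not_lt.2 hjl.le, hjl.ne', if_false]
      match_scalars <;> field_simp <;> ring
  · have e : (q : ℂ) ^ 4 * ((q : ℂ) ^ 2 * t - 1) + ((q : ℂ) ^ 2 + 1) * (t - 1)
      = Family.kappa q .second t := (Family.kappa_second q t).symm
    generalize hK : Family.kappa q .second t = K at hκ e
    constructor
    · intro i j
      rw [h i i j j]
      simp only [sigma₂, e, actL, actR, prod, Family.coeff, IsQuantumMatrix.rDiag,
        IsQuantumMatrix.rOff, Family.hecke, hK, hact, map_add, map_smul, LinearMap.add_apply,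
        LinearMap.smul_apply, if_true]
      match_scalars <;> field_simp <;> ring
    · intro i j l hjl
      rw [h i i j l]
      simp only [sigma₂, e, actL, actR, prod, Family.coeff, IsQuantumMatrix.rDiag,
        IsQuantumMatrix.rOff, Family.hecke, hK, hact, map_add, map_smul, LinearMap.add_apply,
        LinearMap.smul_apply, if_true, hjl, hjl.ne, if_false]
      match_scalars <;> field_simp <;> ring
    · intro i k j hik
      rw [h i k j j]
      simp only [sigma₂, e, actL, actR, prod, Family.coeff, IsQuantumMatrix.rDiag,
        IsQuantumMatrix.rOff, Family.hecke, hK, hact, map_add, map_smul, LinearMap.add_apply,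
        LinearMap.smul_apply, hz.col i k j hik, if_true, hik, hik.ne, if_false]
      match_scalars <;> field_simp <;> ring
    · intro i k j l hik hjl
      rw [h i k j l]
      simp only [sigma₂, beta₂, e, actL, actR, prod, Family.coeff, IsQuantumMatrix.rDiag,
        IsQuantumMatrix.rOff, Family.hecke, hK, hact, map_add, map_sub, map_smul, LinearMap.add_apply,
        LinearMap.sub_apply, LinearMap.smul_apply, hz.anti i k l j hik hjl,  if_true, hik, hik.ne, hjl, hjl.ne, if_false, smul_add]
      match_scalars <;> field_simp <;> ring
    · intro i k j l hik hjl
      rw [h i k j l]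
      have e2 : z k j * z i l = z i l * z k j - ((q : ℂ) - (q : ℂ)⁻¹) • (z i j * z k l) := by
        rw [hz.diag i k l j hik hjl, hz.anti i k j l hik hjl]
        abel
      simp only [sigma₂, beta₂, e, actL, actR, prod, Family.coeff, IsQuantumMatrix.rDiag,
        IsQuantumMatrix.rOff, Family.hecke, hK, hact, map_add, map_sub, map_smul, LinearMap.add_apply,
        LinearMap.sub_apply, LinearMap.smul_apply, e2,  if_true, hik, hik.ne, not_lt.2 hjl.le, hjl.ne', if_false]
      match_scalars <;> field_simp <;> ring

end Calculus

namespace Family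

open Braid

namespace Form

variable {q : ℂˣ} {A : Type} [Ring A] [Bialgebra ℂ A] {z : Fin 3 → Fin 3 → A} {w : A}
  {f : A →ₐ[ℂ] Matrix (Fin 3 × Fin 3) (Fin 3 × Fin 3) ℂ} {ν : Family} {t : ℂ}

/-- Start from dZ₁·Z₂ = (t−1)Z₁ωZ₂ + cZ₁η₁Z₂. The first term uses ωZ₂ = dZ₂ + Z₂ω; the second
becomes tR(Z₁·cZ₂η₂)R with cZ₂η₂ = dZ₂ − (t−1)Z₂ω. -/
theorem op_smul_diff_z (h : IsQuantumGroup q z w) (hf : ∀ n l, f (z n l) = ν.action q t n l)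
    (i k j l : Fin 3) : op (z k l) • (diff q (z i j) : Form f) =
      t • actL (ν.coeff q) (actR (ν.coeff q) fun i k j l => z i j • diff q (z k l)) i k j l
        + (t - 1) • z i j • diff q (z k l)
        - ((t - 1) ^ 2 • prod z i k j l
          + (t * (t - 1) * ν.hecke q) • actL (ν.coeff q) (prod z) i k j l) • (omega q : Form f) := by
  have h1 (c : ℂ) (x : Form f) : op (z k l) • c • x = c • op (z k l) • x :=
    smul_comm _ _ _
  have h2 (c : ℂ) (a : A) (x : Form f) : a • c • x = c • a • x := smul_comm _ _ _
  have h3 (a : A) (x : Form f) : op (z k l) • a • x = a • op (z k l) • x :=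
    (smul_comm _ _ _).symm
  set c := t * (ν.hecke q * ν.trace q) with hc
  have hω : op (z k l) • (omega q : Form f) = diff q (z k l) + z k l • omega q := by
    rw [diff_apply, sub_add_cancel]
  have hW (i k j l : Fin 3) : z i j • (c • ∑ m, z k m • (eta (m, l) : Form f)) =
      z i j • diff q (z k l) - (t - 1) • prod z i k j l • omega q := by
    have e : c • ∑ m, z k m • (eta (m, l) : Form f)
        = diff q (z k l) - (t - 1) • z k l • omega q := by
      rw [diff_z h hf k l, add_sub_cancel_left]
    rw [e, smul_sub, h2, prod, mul_smul]
  have hη : ∑ n, z i n • op (z k l) • (eta (n, j) : Form f)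
      = t • actL (ν.coeff q) (actR (ν.coeff q)
        fun i k j l => z i j • ∑ m, z k m • (eta (m, l) : Form f)) i k j l := by
    rw [← sum_prod_smul_actL_actR h.isQuantumMatrix, Finset.smul_sum]
    refine Finset.sum_congr rfl fun n _ => ?_
    rw [op_smul_eta_z h hf]
    simp only [prod, mul_smul, Finset.smul_sum, h2]
  -- On Z₁Z₂ the two operators coincide, so R(Z₁Z₂)R = R²Z₁Z₂ and the Hecke relation applies. This
  -- is the source of the term linear in R next to ω.
  have hLR : actL (ν.coeff q) (actR (ν.coeff q) (prod z))
      = ν.hecke q • actL (ν.coeff q) (prod z) + prod z := by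
    rw [← actL_prod h.isQuantumMatrix, actL_actL]
  have hs : c • actL (ν.coeff q) (actR (ν.coeff q)
        fun i k j l => z i j • ∑ m, z k m • (eta (m, l) : Form f)) i k j l
      = actL (ν.coeff q) (actR (ν.coeff q) fun i k j l => z i j • diff q (z k l)) i k j l
        - (t - 1) • (actL (ν.coeff q) (actR (ν.coeff q) (prod z)) i k j l) • omega q := by
    trans actL (ν.coeff q) (actR (ν.coeff q)
      fun i k j l => z i j • (c • ∑ m, z k m • (eta (m, l) : Form f))) i k j l
    · simp only [actL, actR, h2]
      simp only [← leftAction_apply]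
      module
    · simp only [hW]
      simp only [actL, actR, add_smul, smul_assoc]
      simp only [← leftAction_apply]
      module
  conv_lhs => rw [diff_z h hf i j, smul_add, h1, h1, h3, hω, ← hc, Finset.smul_sum]
  simp only [h3]
  rw [hη, smul_comm c t, hs, hLR]
  simp only [Pi.add_apply, Pi.smul_apply, add_smul, smul_assoc, smul_add, prod, mul_smul]
  simp only [← leftAction_apply]
  module

theorem op_smul_diff_z' (h : IsQuantumGroup q z w) (hf : ∀ n l, f (z n l) = ν.action q t n l)
    (hκ : ν.kappa q t ≠ 0) (i k j l : Fin 3) : op (z k l) • (diff q (z i j) : Form f) =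
      t • actL (ν.coeff q) (actR (ν.coeff q) fun i k j l => z i j • diff q (z k l)) i k j l
        + (t - 1) • z i j • diff q (z k l)
        - (ν.kappa q t)⁻¹ • ((t - 1) ^ 2 • prod z i k j l
          + (t * (t - 1) * ν.hecke q) • actL (ν.coeff q) (prod z) i k j l) •
            ν.kappa q t • (omega q : Form f) := by
  rw [op_smul_diff_z h hf, smul_comm _ (ν.kappa q t), smul_smul, inv_mul_cancel₀ hκ, one_smul]

end Form

open Form

namespace IsAction

variable {q : ℂˣ} {A : Type} [Ring A] [Bialgebra ℂ A] {z : Fin 3 → Fin 3 → A} {w : A}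
  {f : A →ₐ[ℂ] Matrix (Fin 3 × Fin 3) (Fin 3 × Fin 3) ℂ} {ν : Family} {t : ℂ}

theorem isBraided (h : IsAction q z w ν t f) :
    h.calculus.IsBraided q z (antipodeMatrix q z w) ν t := by
  intro i k j l
  have e : h.calculus.trTheta q z (antipodeMatrix q z w) = ν.kappa q t • (omega q : Form f) :=
    trTheta_eq h.group h.apply_z
  rw [e]
  exact op_smul_diff_z' h.group h.apply_z h.kappa_ne_zero i k j l

theorem isGamma (h : IsAction q z w ν t f) :
    h.calculus.IsGamma q z (antipodeMatrix q z w) ν t :=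
  h.isBraided.isGamma h.group.isQuantumMatrix h.kappa_ne_zero

theorem map_qdet (h : IsAction q z w ν t f) : f (qdet q z) = (t ^ 3 * ν.base q ^ 2) • 1 := by
  rw [_root_.map_qdet]
  simp only [h.apply_z]
  exact (isQuantumMatrix_action q ν t).2

/-- The determinant is group-like and represented by a scalar, so it passes the left-invariant basis
up to that scalar. Being central, it also passes the coefficients. -/
theorem op_qdet_smul (h : IsAction q z w ν t f)
    (hD : Coalgebra.comul (R := ℂ) (qdet q z) = qdet q z ⊗ₜ[ℂ] qdet q z) (ρ : h.calculus.Form) :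
    op (qdet q z) • ρ = (t ^ 3 * ν.base q ^ 2) • qdet q z • ρ := by
  refine Form.ext (f := f) fun J => ?_
  refine (op_smul_apply (f := f) (qdet q z) ρ J).trans ?_
  change _ = (t ^ 3 * ν.base q ^ 2) • (qdet q z * (ρ : Form f) J)
  rw [h.group.qdet_comm]
  have e (I : Fin 3 × Fin 3) : matrixRight f (qdet q z) I J
      = if I = J then (t ^ 3 * ν.base q ^ 2) • qdet q z else 0 := by
    rw [matrixRight_apply, entryRight]
    simp only [LinearMap.comp_apply, hD, LinearMap.lTensor_tmul]
    simp [Convolution.matrixElement, h.map_qdet, Matrix.one_apply]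
  simp [e]

end IsAction

end Family

/-! ## Calculi with the same commutation relations are equivalent -/

namespace Calculus

variable {A : Type} [Ring A]

theorem d_algebraMap [Algebra ℂ A] (C : Calculus.{u} A) (c : ℂ) : C.d (algebraMap ℂ A c) = 0 := by
  have h := C.leibniz 1 1
  rw [mul_one, MulOpposite.op_one, one_smul, one_smul, left_eq_add] at h
  rw [Algebra.algebraMap_eq_smul_one, map_smul, h, smul_zero]

variable [Bialgebra ℂ A] {q : ℂˣ} {z : Fin 3 → Fin 3 → A} {w : A}

/-- The left linear isomorphism of two calculi that identifies the differentials of the matrix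
entries. -/
noncomputable def HasBasis.equiv {C : Calculus.{u} A} {C' : Calculus.{v} A} (hC : C.HasBasis z)
    (hC' : C'.HasBasis z) : C.Form ≃ₗ[A] C'.Form :=
  (Module.Basis.mk hC.1 hC.2.ge).equiv (Module.Basis.mk hC'.1 hC'.2.ge) (Equiv.refl _)

theorem HasBasis.equiv_d {C : Calculus.{u} A} {C' : Calculus.{v} A} (hC : C.HasBasis z)
    (hC' : C'.HasBasis z) (i j : Fin 3) : hC.equiv hC' (C.d (z i j)) = C'.d (z i j) := by
  have h := (Module.Basis.mk hC.1 hC.2.ge).equiv_apply (i := (i, j))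
    (b' := Module.Basis.mk hC'.1 hC'.2.ge) (e := Equiv.refl _)
  simp only [Module.Basis.mk_apply, Equiv.refl_apply] at h
  exact h

theorem equiv_csmul {C : Calculus.{u} A} {C' : Calculus.{v} A} (ζ : C.Form ≃ₗ[A] C'.Form) (c : ℂ)
    (x : C.Form) : ζ (c • x) = c • ζ x := by
  rw [← algebraMap_smul A c x, map_smul, algebraMap_smul]

/-- By the Leibniz rule the differentials of the quadratic monomials determine the right action of
the entries on the basis. Everything else follows from generation of the algebra. -/
theorem equivalent_of_d_mul (h : IsQuantumGroup q z w) {C : Calculus.{u} A} {C' : Calculus.{v} A}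
    (hC : C.HasBasis z) (hC' : C'.HasBasis z)
    (H : ∀ i k j l, hC.equiv hC' (C.d (z i j * z k l)) = C'.d (z i j * z k l)) :
    C.Equivalent C' := by
  set ζ := hC.equiv hC'
  have hA (a : A) (x : C.Form) : ζ (a • x) = a • ζ x := map_smul ζ a x
  have hz (i k j l : Fin 3) : ζ (op (z k l) • C.d (z i j)) = op (z k l) • C'.d (z i j) := by
    have := H i k j l
    rw [C.leibniz, C'.leibniz, map_add, hA, hC.equiv_d hC'] at this
    exact add_right_cancel this
  have hr (a : A) : ∀ ρ, ζ (op a • ρ) = op a • ζ ρ := by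
    refine h.induction (P := fun a => ∀ ρ, ζ (op a • ρ) = op a • ζ ρ) (fun c ρ => ?_)
      (fun a b ha hb ρ => ?_) (fun a b ha hb ρ => ?_) (fun k l ρ => ?_) (fun hD ρ => ?_) a
    · have e (D : Calculus.{v} A) (x : D.Form) : op (algebraMap ℂ A c) • x = c • x :=
        algebraMap_smul Aᵐᵒᵖ c x
      rw [e]
      exact (congrArg ζ (algebraMap_smul Aᵐᵒᵖ c ρ)).trans (equiv_csmul ζ c ρ)
    · rw [MulOpposite.op_add, add_smul, add_smul, map_add, ha, hb]
    · rw [MulOpposite.op_mul, mul_smul, mul_smul, hb, ha]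
    · have hρ : ρ ∈ Submodule.span A (Set.range fun p : Fin 3 × Fin 3 => C.d (z p.1 p.2)) :=
        hC.2 ▸ Submodule.mem_top
      induction hρ using Submodule.span_induction with
      | mem x hx =>
        obtain ⟨p, rfl⟩ := hx
        exact (hz _ _ _ _).trans (congrArg _ (hC.equiv_d hC' _ _).symm)
      | zero => rw [smul_zero, map_zero, smul_zero]
      | add x y _ _ hx hy => rw [smul_add, map_add, map_add, hx, hy, smul_add]
      | smul a x _ hx => rw [← smul_comm a, hA, hx, hA, smul_comm]
    · calc ζ (op w • ρ) = op w • op (qdet q z) • ζ (op w • ρ) := by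
            rw [smul_smul, ← MulOpposite.op_mul, h.qdet_mul, MulOpposite.op_one, one_smul]
        _ = op w • ζ ρ := by
            rw [← hD, smul_smul, ← MulOpposite.op_mul, h.mul_qdet, MulOpposite.op_one, one_smul]
  refine ⟨ζ.restrictScalars ℂ, fun a ρ => map_smul ζ a ρ, hr, fun a => ?_⟩
  refine h.induction (P := fun a => ζ (C.d a) = C'.d a) (fun c => ?_)
      (fun a b ha hb => ?_) (fun a b ha hb => ?_) (fun k l => hC.equiv_d hC' k l) (fun hD => ?_) a
  · rw [d_algebraMap, d_algebraMap, map_zero]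
  · rw [map_add, map_add, map_add, ha, hb]
  · rw [C.leibniz, C'.leibniz, map_add, hr, hA, ha, hb]
  -- The differential of the inverse comes from d(D·w) = d(1) = 0.
  · have e {X : Calculus.{v} A} : X.d w = -(w • op w • X.d (qdet q z)) := by
      have h1 := X.leibniz (qdet q z) w
      rw [h.qdet_mul, ← map_one (algebraMap ℂ A), d_algebraMap] at h1
      have h2 := congrArg (w • ·) h1
      simp only [smul_zero, smul_add] at h2
      rw [smul_smul, h.mul_qdet, one_smul] at h2
      exact (neg_eq_of_add_eq_zero_right h2.symm).symm
    have e' {X : Calculus.{u} A} : X.d w = -(w • op w • X.d (qdet q z)) := by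
      have h1 := X.leibniz (qdet q z) w
      rw [h.qdet_mul, ← map_one (algebraMap ℂ A), d_algebraMap] at h1
      have h2 := congrArg (w • ·) h1
      simp only [smul_zero, smul_add] at h2
      rw [smul_smul, h.mul_qdet, one_smul] at h2
      exact (neg_eq_of_add_eq_zero_right h2.symm).symm
    rw [e, e', map_neg, hA, hr, hD]

/-- The defining relations cover only one order of each pair of entries. They fix d on the
corresponding quadratic monomials, and the relations of the quantum matrix express the products in
the opposite order through these. -/
theorem IsGamma.equivalent (h : IsQuantumGroup q z w) {S : Matrix (Fin 3) (Fin 3) A} {ν : Family}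
    {t : ℂ} {C : Calculus.{u} A} {C' : Calculus.{v} A} (hC : C.HasBasis z) (hC' : C'.HasBasis z)
    (hg : C.IsGamma q z S ν t) (hg' : C'.IsGamma q z S ν t) : C.Equivalent C' := by
  set ζ := hC.equiv hC' with hζ
  have hd (i j : Fin 3) : ζ (C.d (z i j)) = C'.d (z i j) := hC.equiv_d hC' i j
  have hc (c : ℂ) (x : C.Form) : ζ (c • x) = c • ζ x := equiv_csmul ζ c x
  have hA (a : A) (x : C.Form) : ζ (a • x) = a • ζ x := map_smul ζ a x
  have hτ : ζ (C.trTheta q z S) = C'.trTheta q z S := by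
    simp only [trTheta, theta, map_add, hc, map_sum, hA, hd]
  have H (i k j l : Fin 3) (hik : i ≤ k) (hjl : i = k → j ≤ l) :
      ζ (C.d (z i j * z k l)) = C'.d (z i j * z k l) := by
    rw [C.leibniz, C'.leibniz, map_add, hA, hd, add_left_inj]
    rcases hik.eq_or_lt with rfl | hik
    · rcases (hjl rfl).eq_or_lt with rfl | hjl
      · cases ν <;> rw [hg.same, hg'.same] <;> simp only [map_add, hc, hA, hd, hτ]
      · cases ν <;> rw [hg.row _ _ _ hjl, hg'.row _ _ _ hjl] <;>
          simp only [map_add, hc, hA, hd, hτ]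
    · rcases lt_trichotomy j l with hjl | rfl | hjl
      · cases ν <;> rw [hg.diag _ _ _ _ hik hjl, hg'.diag _ _ _ _ hik hjl] <;>
          simp only [map_add, map_sub, hc, hA, hd, hτ, smul_add]
      · cases ν <;> rw [hg.col _ _ _ hik, hg'.col _ _ _ hik] <;>
          simp only [map_add, hc, hA, hd, hτ]
      · cases ν <;> rw [hg.anti _ _ _ _ hik hjl, hg'.anti _ _ _ _ hik hjl] <;>
          simp only [map_add, map_sub, hc, hA, hd, hτ]
  have hm := h.isQuantumMatrix
  refine equivalent_of_d_mul h hC hC' fun i k j l => ?_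
  rw [← hζ]
  rcases lt_trichotomy i k with hik | rfl | hik
  · exact H i k j l hik.le fun e => absurd e hik.ne
  · rcases le_or_gt j l with hjl | hjl
    · exact H i i j l le_rfl fun _ => hjl
    · have e : z i j * z i l = (q : ℂ)⁻¹ • (z i l * z i j) := by
        rw [hm.row i l j hjl, smul_smul, inv_mul_cancel₀ q.ne_zero, one_smul]
      rw [e, map_smul C.d, map_smul C'.d, hc, H i i l j le_rfl fun _ => hjl.le]
  · have H' := fun j l => H k i j l hik.le fun e => absurd e hik.ne
    rcases lt_trichotomy j l with hjl | rfl | hjl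
    · rw [← hm.anti k i l j hik hjl, H']
    · have e : z i j * z k j = (q : ℂ)⁻¹ • (z k j * z i j) := by
        rw [hm.col k i j hik, smul_smul, inv_mul_cancel₀ q.ne_zero, one_smul]
      rw [e, map_smul C.d, map_smul C'.d, hc, H']
    · have e : z i j * z k l = z k l * z i j - ((q : ℂ) - (q : ℂ)⁻¹) • (z k j * z i l) := by
        rw [hm.diag k i l j hik hjl, hm.anti k i j l hik hjl]
        abel
      rw [e, map_sub, map_sub, map_sub, map_smul C.d, map_smul C'.d, hc, H', H']

end Calculus

/-! ## The involution -/

/-- An antilinear antihomomorphism that fixes the matrix entries. -/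
structure IsStarMap {A : Type} [Ring A] [Algebra ℂ A] (z : Fin 3 → Fin 3 → A) (s : A → A) :
    Prop where
  map_add : ∀ a b, s (a + b) = s a + s b
  map_mul : ∀ a b, s (a * b) = s b * s a
  map_smul : ∀ (c : ℂ) a, s (c • a) = starRingEnd ℂ c • s a
  map_one : s 1 = 1
  map_z : ∀ i j, s (z i j) = z i j

namespace IsStarMap

variable {A : Type} [Ring A] {z : Fin 3 → Fin 3 → A} {s : A → A}

theorem map_zero [Algebra ℂ A] (hs : IsStarMap z s) : s 0 = 0 := by
  have := hs.map_add 0 0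
  rwa [add_zero, left_eq_add] at this

theorem map_sum [Algebra ℂ A] (hs : IsStarMap z s) {ι : Type*} (S : Finset ι) (g : ι → A) :
    s (∑ i ∈ S, g i) = ∑ i ∈ S, s (g i) :=
  _root_.map_sum (⟨⟨s, hs.map_zero⟩, hs.map_add⟩ : A →+ A) g S

theorem star_star [Bialgebra ℂ A] {q : ℂˣ} {w : A} (hs : IsStarMap z s) (h : IsQuantumGroup q z w)
    (a : A) : s (s a) = a := by
  let g : A →ₐ[ℂ] A :=
    { toFun := fun a => s (s a)
      map_one' := by rw [hs.map_one, hs.map_one]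
      map_mul' := fun a b => by rw [hs.map_mul, hs.map_mul]
      map_zero' := by rw [hs.map_zero, hs.map_zero]
      map_add' := fun a b => by rw [hs.map_add, hs.map_add]
      commutes' := fun c => by
        simp only [Algebra.algebraMap_eq_smul_one, hs.map_smul, hs.map_one, Complex.conj_conj] }
  exact DFunLike.congr_fun (h.algHom_ext (f := g) (g := AlgHom.id ℂ A) fun i j =>
    (congrArg s (hs.map_z i j)).trans (hs.map_z i j)) a

end IsStarMap

theorem GLq.isStarMap {q : ℂˣ} (hq : ‖(q : ℂ)‖ = 1) : IsStarMap (GLq.z q) (GLq.star hq) :=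
  ⟨GLq.star_add hq, GLq.star_mul hq, GLq.star_smul hq, GLq.star_one hq, GLq.star_z hq⟩

theorem SLq.isStarMap {q : ℂˣ} (hq : ‖(q : ℂ)‖ = 1) : IsStarMap (SLq.z q) (SLq.star hq) :=
  ⟨SLq.star_add hq, SLq.star_mul hq, SLq.star_smul hq,
    congrArg ConjOp.get (map_one (SLq.starHom hq)), SLq.star_z hq⟩

namespace Braid

variable {M : Type*} [AddCommGroup M] [Module ℂ M]

open IsQuantumMatrix (rDiag rOff rOff_comm)

/-- The Hecke relation says that R − μ is the inverse of R. -/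
theorem actL_coeff_sub (q : ℂˣ) (ν : Family) (T : Fin 3 → Fin 3 → Fin 3 → Fin 3 → M) :
    actL (fun a b => ν.coeff q a b - ν.hecke q) (actL (ν.coeff q) T) = T := by
  have h := actL_actL q ν T
  have e (T' : Fin 3 → Fin 3 → Fin 3 → Fin 3 → M) :
      actL (fun a b => ν.coeff q a b - ν.hecke q) T' = actL (ν.coeff q) T' - ν.hecke q • T' := by
    funext i k j l
    simp only [actL, Pi.sub_apply, Pi.smul_apply]
    module
  rw [e, h, add_sub_cancel_left]

theorem actR_coeff_sub (q : ℂˣ) (ν : Family) (T : Fin 3 → Fin 3 → Fin 3 → Fin 3 → M) :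
    actR (fun a b => ν.coeff q a b - ν.hecke q) (actR (ν.coeff q) T) = T := by
  funext i k j l
  exact congrFun (congrFun (congrFun (congrFun
    (actL_coeff_sub q ν fun j l i k => T i k j l) j) l) i) k

/-- For q on the unit circle, complex conjugation turns R into its inverse R − μ with the two legs
exchanged. This matches the reversal of products by the involution. -/
theorem conj_coeff {q : ℂˣ} (hq : starRingEnd ℂ (q : ℂ) = (q : ℂ)⁻¹) (ν : Family) (a b : Fin 3) :
    starRingEnd ℂ (ν.coeff q a b) = ν.coeff q b a - ν.hecke q := by
  rcases lt_trichotomy a b with h | rfl | h <;> cases ν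
  case inr.inl.first => simp [Family.coeff, Family.hecke, rDiag, hq]
  case inr.inl.second => simp [Family.coeff, Family.hecke, rDiag, hq]
  all_goals simp [Family.coeff, Family.hecke, rDiag, h, h.ne, h.ne', not_lt.2 h.le, hq]

theorem conj_rOff (a b : Fin 3) : starRingEnd ℂ (rOff a b) = rOff b a := by
  simp only [rOff, eq_comm]
  split_ifs <;> simp

theorem trace_actL_leg (q : ℂˣ) (ν : Family) (g : Fin 3 → Fin 3 → M) (n l : Fin 3) :
    ∑ i, weight q i • actL (ν.coeff q) (leg g) i n i l = ν.trace q • g n l := by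
  have hq : (q : ℂ) ≠ 0 := q.ne_zero
  cases ν <;> fin_cases n <;>
    simp [Fin.sum_univ_three, actL, leg, Family.coeff, Family.trace, rDiag, rOff, weight] <;>
    match_scalars <;> field_simp <;> ring

theorem sum_inv_weight (q : ℂˣ) (ν : Family) (i : Fin 3) :
    ∑ l, (weight q l)⁻¹ * (ν.coeff q i l - ν.hecke q) = (ν.trace q)⁻¹ := by
  have hq : (q : ℂ) ≠ 0 := q.ne_zero
  cases ν <;> fin_cases i <;>
    simp [Fin.sum_univ_three, Family.coeff, Family.trace, Family.hecke, rDiag, weight] <;>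
    field_simp <;> ring

end Braid

namespace Family

open Braid

namespace Form

variable {q : ℂˣ} {A : Type} [Ring A] [Bialgebra ℂ A] {z : Fin 3 → Fin 3 → A} {w : A}
  {f : A →ₐ[ℂ] Matrix (Fin 3 × Fin 3) (Fin 3 × Fin 3) ℂ} {ν : Family} {t : ℂ}

/-- The product of the quantum matrix with the matrix of left-invariant forms. -/
noncomputable def zeta (f : A →ₐ[ℂ] Matrix (Fin 3 × Fin 3) (Fin 3 × Fin 3) ℂ)
    (z : Fin 3 → Fin 3 → A) (i j : Fin 3) : Form f :=
  ∑ n, z i n • eta (n, j)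

theorem sum_antipode_smul_zeta (h : IsQuantumGroup q z w) (i j : Fin 3) :
    ∑ k, antipodeMatrix q z w i k • zeta f z k j = eta (i, j) := by
  simp only [zeta, Finset.smul_sum, smul_smul]
  rw [Finset.sum_comm]
  simp only [← Finset.sum_smul, h.antipode_mul]
  simp

/-- For ζ = Zη the right action reads ζ₁Z₂ = t R Z₁ζ₂ R. Both sides now contain one Z and one ζ,
which makes the relation suited to reversing products. -/
theorem op_smul_zeta (h : IsQuantumGroup q z w) (hf : ∀ n l, f (z n l) = ν.action q t n l)
    (i k j l : Fin 3) : op (z k l) • zeta f z i j =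
      t • actL (ν.coeff q) (actR (ν.coeff q) fun i k j l => z i j • zeta f z k l) i k j l := by
  have h2 (c : ℂ) (a : A) (x : Form f) : a • c • x = c • a • x := smul_comm _ _ _
  simp only [zeta]
  rw [← sum_prod_smul_actL_actR h.isQuantumMatrix ν (fun m l => (eta (m, l) : Form f)),
    Finset.smul_sum, Finset.smul_sum]
  refine Finset.sum_congr rfl fun n _ => ?_
  rw [← smul_comm (z i n), op_smul_eta_z h hf]
  simp only [prod, mul_smul, Finset.smul_sum, h2]

/-- Computes the conjugate of ω = ∑ weight·S(Z)ζ up to a scalar. Removing the right R from η₁Z₂ = t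
Z₂ R η₂ R and taking the weighted trace over the first leg expresses ζ through products η·Z. The
conjugated antipodes then cancel Z from the right. -/
theorem sum_zeta_smul (h : IsQuantumGroup q z w) (hf : ∀ n l, f (z n l) = ν.action q t n l)
    {s : A → A} (hs : IsStarMap z s) :
    (t * ν.trace q) • ∑ k, ∑ l, op (s (antipodeMatrix q z w l k)) • (weight q l)⁻¹ • zeta f z k l
      = (ν.trace q)⁻¹ • omega q := by
  have h1 (c : ℂ) (a : A) (x : Form f) : op a • c • x = c • op a • x := smul_comm _ _ _
  have h2 (c : ℂ) (a : A) (x : Form f) : a • c • x = c • a • x := smul_comm _ _ _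
  -- The involution applied to S(Z)·Z = 1.
  have hT (i l : Fin 3) : ∑ k, z k i * s (antipodeMatrix q z w l k) = if l = i then 1 else 0 := by
    have := congrArg s (h.antipode_mul l i)
    simp only [hs.map_sum, hs.map_mul, hs.map_z] at this
    rw [this]
    split_ifs
    · exact hs.map_one
    · exact hs.map_zero
  have key (k l : Fin 3) : (t * ν.trace q) • zeta f z k l
      = ∑ i, weight q i • ((ν.coeff q i l - ν.hecke q) • op (z k l) • (eta (i, i) : Form f)
        + IsQuantumMatrix.rOff i l • op (z k i) • (eta (i, l) : Form f)) := by
    have e (i j : Fin 3) : (ν.coeff q j l - ν.hecke q) • op (z k l) • (eta (i, j) : Form f)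
        + IsQuantumMatrix.rOff j l • op (z k j) • (eta (i, l) : Form f)
        = t • ∑ n, z k n • actL (ν.coeff q) (leg fun x y => (eta (x, y) : Form f)) i n j l := by
      simp only [op_smul_eta_z h hf, smul_comm _ t]
      rw [← smul_add]
      congr 1
      rw [Finset.smul_sum, Finset.smul_sum, ← Finset.sum_add_distrib]
      refine Finset.sum_congr rfl fun n _ => ?_
      rw [← h2, ← h2 (IsQuantumMatrix.rOff j l), ← smul_add]
      congr 1
      -- Multiplying by R − μ on the columns undoes the right factor R.
      have := congrFun (congrFun (congrFun (congrFun (actR_coeff_sub q ν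
        (actL (ν.coeff q) (leg fun x y => (eta (x, y) : Form f)))) i) n) j) l
      rw [← actL_actR] at this
      exact this
    trans t • ∑ i, ∑ n, z k n • weight q i •
      actL (ν.coeff q) (leg fun x y => (eta (x, y) : Form f)) i n i l
    · rw [Finset.sum_comm]
      simp only [← Finset.smul_sum, trace_actL_leg]
      simp only [h2, ← Finset.smul_sum]
      rw [mul_smul]
      rfl
    · rw [Finset.smul_sum]
      refine Finset.sum_congr rfl fun i _ => ?_
      rw [e, smul_comm (weight q i)]
      simp only [h2, Finset.smul_sum]
  have e1 (k l : Fin 3) : (t * ν.trace q) • op (s (antipodeMatrix q z w l k)) •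
        (weight q l)⁻¹ • zeta f z k l
      = ∑ i, (weight q i * (weight q l)⁻¹) • ((ν.coeff q i l - ν.hecke q) •
          op (z k l * s (antipodeMatrix q z w l k)) • (eta (i, i) : Form f)
        + IsQuantumMatrix.rOff i l •
          op (z k i * s (antipodeMatrix q z w l k)) • (eta (i, l) : Form f)) := by
    rw [h1, smul_comm _ (weight q l)⁻¹, ← h1, key, Finset.smul_sum, Finset.smul_sum]
    refine Finset.sum_congr rfl fun i _ => ?_
    simp only [h1, smul_add, MulOpposite.op_mul, mul_smul]
    rw [smul_comm (weight q i) (weight q l)⁻¹, smul_comm (weight q i) (weight q l)⁻¹]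
  rw [Finset.smul_sum]
  refine (Finset.sum_congr rfl fun k _ => (Finset.smul_sum).trans
    (Finset.sum_congr rfl fun l _ => e1 k l)).trans ?_
  rw [Finset.sum_comm]
  have e2 (l : Fin 3) : ∑ k, ∑ i, (weight q i * (weight q l)⁻¹) • ((ν.coeff q i l - ν.hecke q) •
          op (z k l * s (antipodeMatrix q z w l k)) • (eta (i, i) : Form f)
        + IsQuantumMatrix.rOff i l •
          op (z k i * s (antipodeMatrix q z w l k)) • (eta (i, l) : Form f))
      = ∑ i, (weight q i * (weight q l)⁻¹) • (ν.coeff q i l - ν.hecke q) • (eta (i, i) : Form f) := by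
    rw [Finset.sum_comm]
    refine Finset.sum_congr rfl fun i _ => ?_
    have e3 (g : Fin 3 → A) (x : Form f) : ∑ k, op (g k) • x = op (∑ k, g k) • x := by
      rw [← Finset.sum_smul]
      congr 1
    simp only [← Finset.smul_sum, Finset.sum_add_distrib, e3, hT]
    rcases eq_or_ne l i with rfl | hil
    · simp [IsQuantumMatrix.rOff]
    · simp [hil]
  simp only [e2]
  rw [Finset.sum_comm, omega_eq, Finset.smul_sum]
  refine Finset.sum_congr rfl fun i _ => ?_
  rw [← sum_inv_weight q ν i, smul_smul, Finset.sum_mul, Finset.sum_smul]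
  refine Finset.sum_congr rfl fun l _ => ?_
  rw [smul_smul]
  congr 1
  ring

/-- The forms ζ generate because η = S(Z)ζ. These coefficients are the ones used in the definition
of `conj`. -/
theorem smul_zeta_expansion (h : IsQuantumGroup q z w) (x : Form f) :
    x = ∑ k, ∑ j, (∑ i, x (i, j) * antipodeMatrix q z w i k) • zeta f z k j := by
  conv_lhs => rw [eq_sum_eta x, Fintype.sum_prod_type]
  simp only [← sum_antipode_smul_zeta h, Finset.smul_sum, smul_smul, Finset.sum_smul]
  rw [Finset.sum_comm]
  conv_rhs => rw [Finset.sum_comm]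
  refine Finset.sum_congr rfl fun j _ => ?_
  rw [Finset.sum_comm]

/-- The antilinear map that reverses products and maps the forms `zeta` to multiples of
themselves. -/
noncomputable def conj (f : A →ₐ[ℂ] Matrix (Fin 3 × Fin 3) (Fin 3 × Fin 3) ℂ) (q : ℂˣ)
    (z : Fin 3 → Fin 3 → A) (w : A) (c : ℂ) {s : A → A} (hs : IsStarMap z s) :
    Form f →ₛₗ[starRingEnd ℂ] Form f where
  toFun x := c • ∑ k, ∑ j, op (s (∑ i, x (i, j) * antipodeMatrix q z w i k)) • zeta f z k j
  map_add' x y := by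
    simp only [add_apply, add_mul, Finset.sum_add_distrib, hs.map_add, MulOpposite.op_add, add_smul,
      smul_add]
  map_smul' a x := by
    simp only [csmul_apply, smul_mul_assoc, ← Finset.smul_sum, hs.map_smul, MulOpposite.op_smul,
      smul_assoc, smul_comm c]

variable {s : A → A} (hs : IsStarMap z s) (c : ℂ)

theorem conj_apply (x : Form f) : conj f q z w c hs x
    = c • ∑ k, ∑ j, op (s (∑ i, x (i, j) * antipodeMatrix q z w i k)) • zeta f z k j := rfl

theorem conj_smul (a : A) (x : Form f) :
    conj f q z w c hs (a • x) = op (s a) • conj f q z w c hs x := by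
  have h1 (c : ℂ) (a : A) (x : Form f) : op a • c • x = c • op a • x := smul_comm _ _ _
  simp only [conj_apply, smul_apply, mul_assoc, ← Finset.mul_sum, hs.map_mul, MulOpposite.op_mul,
    mul_smul, h1, Finset.smul_sum]

theorem conj_zeta (h : IsQuantumGroup q z w) (i j : Fin 3) :
    conj f q z w c hs (zeta f z i j) = c • zeta f z i j := by
  have e (n l : Fin 3) : zeta f z i j (n, l) = if l = j then z i n else 0 := by
    simp only [zeta, sum_apply, smul_apply, eta_apply, Prod.mk.injEq]
    rcases eq_or_ne l j with rfl | hl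
    · simp
    · simp [hl]
  rw [conj_apply]
  congr 1
  have e2 (k l : Fin 3) : ∑ n, zeta f z i j (n, l) * antipodeMatrix q z w n k
      = if k = i ∧ l = j then 1 else 0 := by
    simp only [e, ite_mul, zero_mul]
    rcases eq_or_ne l j with rfl | hl
    · simp [h.mul_antipode, eq_comm]
    · simp [hl]
  simp only [e2]
  rw [Finset.sum_eq_single i, Finset.sum_eq_single j]
  · simp [hs.map_one]
  · intro l _ hl
    simp [hl, hs.map_zero]
  · simp
  · intro k _ hk
    simp [hk, hs.map_zero]
  · simp

variable (h : IsQuantumGroup q z w) (hf : ∀ n l, f (z n l) = ν.action q t n l)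
  (hq : starRingEnd ℂ (q : ℂ) = (q : ℂ)⁻¹) (ht : starRingEnd ℂ t = t⁻¹) (ht0 : t ≠ 0)
include h hf hq ht ht0

/-- Conjugating ζ₁Z₂ = t R Z₁ζ₂ R produces the inverses of R with exchanged legs around ζ₂Z₁. The
same relation for ζ₂Z₁ supplies a factor t and the operators that cancel these inverses, and t̄t =
1. -/
theorem conj_op_zeta (i k j l : Fin 3) : conj f q z w c hs (op (z k l) • zeta f z i j)
    = z k l • conj f q z w c hs (zeta f z i j) := by
  have h1 (c : ℂ) (x : Form f) : op (z i j) • c • x = c • op (z i j) • x := smul_comm _ _ _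
  have h2 (c : ℂ) (a : A) (x : Form f) : a • c • x = c • a • x := smul_comm _ _ _
  have e (W : Fin 3 → Fin 3 → Fin 3 → Fin 3 → Form f) :
      conj f q z w c hs (actL (ν.coeff q) (actR (ν.coeff q) W) i k j l)
      = actL (fun a b => ν.coeff q a b - ν.hecke q) (actR (fun a b => ν.coeff q a b - ν.hecke q)
        fun k i l j => conj f q z w c hs (W i k j l)) k i l j := by
    simp only [actL, actR, map_add, map_smulₛₗ, conj_coeff hq, conj_rOff]
  rw [op_smul_zeta h hf, map_smulₛₗ, e]
  simp only [conj_smul, conj_zeta hs c h, hs.map_z]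
  have e2 : (fun k i l j => op (z i j) • c • zeta f z k l) = fun k i l j => (c * t) •
      actL (ν.coeff q) (actR (ν.coeff q) fun i k j l => z i j • zeta f z k l) k i l j := by
    funext k i l j
    rw [mul_smul, ← op_smul_zeta h hf]
    exact smul_comm _ _ _
  have e3 (r : Fin 3 → Fin 3 → ℂ) (W : Fin 3 → Fin 3 → Fin 3 → Fin 3 → Form f) :
      actL r (actR r fun i k j l => (c * t) • W i k j l) = (c * t) • actL r (actR r W) := by
    funext i k j l
    simp only [actL, actR, Pi.smul_apply]
    module
  rw [e2, e3, actL_actR, actL_coeff_sub, actR_coeff_sub, ht]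
  simp only [Pi.smul_apply]
  rw [smul_smul, h2]
  congr 1
  field_simp

theorem conj_op (a : A) (x : Form f) :
    conj f q z w c hs (op a • x) = s a • conj f q z w c hs x := by
  refine h.induction (P := fun a => ∀ x : Form f, conj f q z w c hs (op a • x)
    = s a • conj f q z w c hs x) (fun b x => ?_)
    (fun a b ha hb x => ?_) (fun a b ha hb x => ?_) (fun k l x => ?_) (fun hD x => ?_) a x
  · rw [show op (algebraMap ℂ A b) • x = b • x from algebraMap_smul Aᵐᵒᵖ b x, map_smulₛₗ,
      Algebra.algebraMap_eq_smul_one, hs.map_smul, hs.map_one, smul_assoc, one_smul]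
  · rw [MulOpposite.op_add, add_smul, map_add, ha, hb, hs.map_add, add_smul]
  · rw [MulOpposite.op_mul, mul_smul, hb, ha, hs.map_mul, mul_smul]
  · rw [smul_zeta_expansion h x]
    simp only [Finset.smul_sum, map_sum]
    refine Finset.sum_congr rfl fun m _ => Finset.sum_congr rfl fun n _ => ?_
    rw [show ∀ (b : A) (y : Form f), op (z k l) • b • y = b • op (z k l) • y from
      fun b y => (smul_comm _ _ _).symm, conj_smul, conj_smul, conj_op_zeta hs c h hf hq ht ht0, hs.map_z]
    exact (smul_comm (z k l) _ _).symm
  · calc conj f q z w c hs (op w • x)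
        = s w • s (qdet q z) • conj f q z w c hs (op w • x) := by
          rw [smul_smul, ← hs.map_mul, h.qdet_mul, hs.map_one, one_smul]
      _ = s w • conj f q z w c hs x := by
          rw [← hD, smul_smul, ← MulOpposite.op_mul, h.mul_qdet, MulOpposite.op_one, one_smul]

omit h hf ht ht0 in
theorem conj_trace (ν : Family) : starRingEnd ℂ (ν.trace q) = (ν.trace q)⁻¹ := by
  cases ν <;> simp [trace, hq]

omit h hf ht ht0 in
theorem conj_weight (i : Fin 3) : starRingEnd ℂ (weight q i) = (weight q i)⁻¹ := by
  fin_cases i <;> simp [weight, hq]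

omit ht ht0 in
-- The constant c = −t·trace² is chosen to get exactly −ω here. The sign makes the commutator with ω
-- compatible with the reversal of products.
theorem conj_omega : conj f q z w (-(t * ν.trace q ^ 2)) hs (omega q) = -omega q := by
  have h1 (c : ℂ) (a : A) (x : Form f) : op a • c • x = c • op a • x := smul_comm _ _ _
  have e : conj f q z w (-(t * ν.trace q ^ 2)) hs (omega q)
      = -(ν.trace q • (t * ν.trace q) • ∑ k, ∑ l,
        op (s (antipodeMatrix q z w l k)) • (weight q l)⁻¹ • zeta f z k l) := by
    conv_lhs => rw [omega_eq]
    simp only [← sum_antipode_smul_zeta h, map_sum, map_smulₛₗ, conj_smul, conj_zeta hs _ h,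
      conj_weight hq, h1]
    rw [Finset.sum_comm]
    simp only [Finset.smul_sum, ← Finset.sum_neg_distrib]
    refine Finset.sum_congr rfl fun k _ => Finset.sum_congr rfl fun l _ => ?_
    simp only [smul_smul]
    rw [← neg_smul]
    congr 1
    ring
  rw [e, sum_zeta_smul h hf hs, smul_smul, mul_inv_cancel₀ (trace_ne_zero q ν), one_smul]

theorem conj_diff (a : A) : conj f q z w (-(t * ν.trace q ^ 2)) hs (diff q a) = diff q (s a) := by
  rw [diff_apply, diff_apply, map_sub, conj_op hs _ h hf hq ht ht0, conj_smul,
    conj_omega hs h hf hq]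
  simp only [smul_neg]
  abel

/-- Each ζ is fixed by the square because the constant c has modulus one. The square is left linear
and ζ generates the forms. -/
theorem conj_conj (x : Form f) : conj f q z w (-(t * ν.trace q ^ 2)) hs
    (conj f q z w (-(t * ν.trace q ^ 2)) hs x) = x := by
  have hcc : starRingEnd ℂ (-(t * ν.trace q ^ 2)) * (-(t * ν.trace q ^ 2)) = 1 := by
    have := trace_ne_zero q ν
    rw [map_neg, map_mul, map_pow, conj_trace hq, ht]
    field_simp
  have e (i j : Fin 3) : conj f q z w (-(t * ν.trace q ^ 2)) hs
      (conj f q z w (-(t * ν.trace q ^ 2)) hs (zeta f z i j)) = zeta f z i j := by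
    rw [conj_zeta hs _ h, map_smulₛₗ, conj_zeta hs _ h, smul_smul, hcc, one_smul]
  rw [smul_zeta_expansion h x]
  simp only [map_sum]
  refine Finset.sum_congr rfl fun m _ => Finset.sum_congr rfl fun n _ => ?_
  rw [conj_smul, conj_op hs _ h hf hq ht ht0, e, hs.star_star h]

end Form

open Form

theorem IsAction.isStarCalculus {q : ℂˣ} {A : Type} [Ring A] [Bialgebra ℂ A]
    {z : Fin 3 → Fin 3 → A} {w : A} {f : A →ₐ[ℂ] Matrix (Fin 3 × Fin 3) (Fin 3 × Fin 3) ℂ}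
    {ν : Family} {t : ℂ} (h : IsAction q z w ν t f) (hq : ‖(q : ℂ)‖ = 1) (ht : ‖t‖ = 1) {s : A → A}
    (hs : IsStarMap z s) : h.calculus.IsStarCalculus s := by
  have hq' := (Complex.inv_eq_conj hq).symm
  have ht' := (Complex.inv_eq_conj ht).symm
  have ht0 : t ≠ 0 := by
    rintro rfl
    simp at ht
  exact ⟨conj f q z w _ hs, conj_conj hs h.group h.apply_z hq' ht' ht0, conj_smul hs _,
    conj_op hs _ h.group h.apply_z hq' ht' ht0, conj_diff hs h.group h.apply_z hq' ht' ht0⟩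

end Family

/-- The involution passes to equivalent calculi. -/
theorem Calculus.Equivalent.isStarCalculus {A : Type} [Ring A] [Algebra ℂ A] {C : Calculus.{u} A}
    {C' : Calculus.{v} A} (h : C.Equivalent C') {s : A → A} (hs : C'.IsStarCalculus s) :
    C.IsStarCalculus s := by
  obtain ⟨ζ, h1, h2, h3⟩ := h
  obtain ⟨σ, hσ, hσ1, hσ2, hσ3⟩ := hs
  refine ⟨(ζ.symm.toLinearMap.comp σ).comp ζ.toLinearMap, fun ρ => ?_, fun a ρ => ?_, fun a ρ => ?_,
    fun a => ?_⟩ <;> apply ζ.injective <;>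
    simp [h1, h2, h3, hσ, hσ1, hσ2, hσ3]

/-! ## Existence of the calculi -/

namespace Family

variable {q : ℂˣ} {ν : Family} {t : ℂ}

theorem qdet_action_mul (ht : t ≠ 0) :
    qdet q (ν.action q t) * ((t ^ 3 * ν.base q ^ 2)⁻¹ • 1) = 1
      ∧ ((t ^ 3 * ν.base q ^ 2)⁻¹ • 1) * qdet q (ν.action q t) = 1 := by
  have h0 : t ^ 3 * ν.base q ^ 2 ≠ 0 :=
    mul_ne_zero (pow_ne_zero _ ht) (pow_ne_zero _ (base_ne_zero q ν))
  rw [(isQuantumMatrix_action q ν t).2]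
  constructor <;> rw [smul_mul_smul_comm, mul_one]
  · rw [mul_inv_cancel₀ h0, one_smul]
  · rw [inv_mul_cancel₀ h0, one_smul]

/-- The right action of `Fun_q(GL(3))` on the left-invariant forms. -/
noncomputable def glHom (q : ℂˣ) (ν : Family) (ht : t ≠ 0) :
    GLq q →ₐ[ℂ] Matrix (Fin 3 × Fin 3) (Fin 3 × Fin 3) ℂ :=
  GLq.lift (ν.action q t) ((t ^ 3 * ν.base q ^ 2)⁻¹ • 1) (isQuantumMatrix_action q ν t).1
    (qdet_action_mul ht).1 (qdet_action_mul ht).2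

theorem glHom_z (ht : t ≠ 0) (n l : Fin 3) : glHom q ν ht (GLq.z q n l) = ν.action q t n l :=
  GLq.lift_z _ _

theorem isAction_glHom (hq : (q : ℂ) ^ 2 ≠ 1) (ht : Admissible q ν t) :
    IsAction q (GLq.z q) (GLq.dinv q) ν t (glHom q ν ((admissible_iff q ν t).1 ht).1) :=
  ⟨GLq.isQuantumGroup q, glHom_z _, hq, ht⟩

/-- The right action of `Fun_q(SL(3))` on the left-invariant forms. -/
noncomputable def slHom (q : ℂˣ) (ν : Family) (ht : t ≠ 0) (h : t ^ 3 * ν.base q ^ 2 = 1) :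
    SLq q →ₐ[ℂ] Matrix (Fin 3 × Fin 3) (Fin 3 × Fin 3) ℂ :=
  SLq.lift (glHom q ν ht) (by
    rw [map_qdet]
    simp only [glHom_z]
    exact (isQuantumMatrix_action q ν t).2.trans (by rw [h, one_smul]))

theorem slHom_proj (ht : t ≠ 0) (h : t ^ 3 * ν.base q ^ 2 = 1) (a : GLq q) :
    slHom q ν ht h (SLq.proj q a) = glHom q ν ht a := SLq.lift_proj _ _ _

theorem isAction_slHom (hq : (q : ℂ) ^ 2 ≠ 1) (ht : Admissible q ν t)
    (h : t ^ 3 * ν.base q ^ 2 = 1) :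
    IsAction q (SLq.z q) 1 ν t (slHom q ν ((admissible_iff q ν t).1 ht).1 h) :=
  ⟨SLq.isQuantumGroup q, fun n l => (slHom_proj _ _ _).trans (glHom_z _ n l), hq, ht⟩

namespace Form

/-- The projection of the forms over `GL_q(3)` to those over `SL_q(3)`. -/
noncomputable def proj (f : GLq q →ₐ[ℂ] Matrix (Fin 3 × Fin 3) (Fin 3 × Fin 3) ℂ)
    (g : SLq q →ₐ[ℂ] Matrix (Fin 3 × Fin 3) (Fin 3 × Fin 3) ℂ) : Form f →ₗ[ℂ] Form g where
  toFun x I := SLq.proj q (x I)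
  map_add' x y := funext fun I => map_add (SLq.proj q) (x I) (y I)
  map_smul' c x := funext fun I => map_smul (SLq.proj q) c (x I)

variable {f : GLq q →ₐ[ℂ] Matrix (Fin 3 × Fin 3) (Fin 3 × Fin 3) ℂ}
  {g : SLq q →ₐ[ℂ] Matrix (Fin 3 × Fin 3) (Fin 3 × Fin 3) ℂ}

theorem proj_apply (x : Form f) (I : Fin 3 × Fin 3) : proj f g x I = SLq.proj q (x I) := rfl

theorem proj_smul (a : GLq q) (x : Form f) : proj f g (a • x) = SLq.proj q a • proj f g x :=
  Form.ext fun I => map_mul (SLq.proj q) a (x I)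

theorem proj_omega : proj f g (omega q) = omega q := by
  refine Form.ext fun I => ?_
  rw [proj_apply]
  simp only [omega]
  split_ifs <;> simp

variable (h : ∀ a, g (SLq.proj q a) = f a)
include h

theorem proj_op_smul (a : GLq q) (x : Form f) :
    proj f g (op a • x) = op (SLq.proj q a) • proj f g x := by
  have e : (SLq.proj q).mapMatrix.comp (matrixRight f) = (matrixRight g).comp (SLq.proj q) := by
    refine (GLq.isQuantumGroup q).algHom_ext fun k l => ?_
    refine Matrix.ext fun I J => ?_
    simp only [AlgHom.comp_apply, AlgHom.mapMatrix_apply, Matrix.map_apply,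
      matrixRight_z (GLq.isQuantumGroup q), map_sum, map_smul]
    exact ((matrixRight_z (SLq.isQuantumGroup q) k l I J).trans
      (Finset.sum_congr rfl fun n _ => by rw [SLq.z, h]; rfl)).symm
  refine Form.ext fun J => ?_
  rw [proj_apply, op_smul_apply, op_smul_apply, map_sum]
  refine Finset.sum_congr rfl fun I _ => ?_
  rw [map_mul, proj_apply]
  congr 1
  exact congrFun (congrFun (DFunLike.congr_fun e a) I) J

theorem proj_diff (a : GLq q) : proj f g (diff q a) = diff q (SLq.proj q a) := by
  rw [diff_apply, diff_apply, map_sub, proj_op_smul h, proj_smul, proj_omega]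

end Form

theorem induces (hq : (q : ℂ) ^ 2 ≠ 1) (ht : Admissible q ν t) (h : t ^ 3 * ν.base q ^ 2 = 1) :
    (isAction_glHom hq ht).calculus.Induces (isAction_slHom hq ht h).calculus :=
  ⟨Form.proj _ _, Form.proj_smul, Form.proj_op_smul (slHom_proj _ h), Form.proj_diff (slHom_proj _ h)⟩

theorem isInduced (hq : (q : ℂ) ^ 2 ≠ 1) (ht : Admissible q ν t) (h : t ^ 3 * ν.base q ^ 2 = 1) :
    (isAction_slHom hq ht h).calculus.IsInduced := by
  have h0 : (isAction_slHom hq ht h).calculus.IsBicovariant := IsAction.isBicovariant _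
  exact ⟨h0, IsAction.hasBasis _, _, IsAction.isBicovariant _, IsAction.hasBasis _, induces hq ht h⟩

theorem mem_slParameters : t ∈ slParameters q ν ↔ Admissible q ν t ∧ t ^ 3 * ν.base q ^ 2 = 1 := by
  have hq : (q : ℂ) ≠ 0 := q.ne_zero
  cases ν
  · refine and_congr_right fun _ => ?_
    change t ^ 3 = _ ↔ t ^ 3 * ((q : ℂ)⁻¹) ^ 2 = 1
    rw [inv_pow, mul_inv_eq_one₀ (pow_ne_zero _ hq)]
  · refine and_congr_right fun _ => ?_
    change t ^ 3 = _ ↔ t ^ 3 * (q : ℂ) ^ 2 = 1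
    rw [← div_eq_one_iff_eq (inv_ne_zero (pow_ne_zero _ hq)), div_inv_eq_mul]

end Family

/-! ## Classes of forms at the unit of the group -/

namespace Calculus

open Braid

variable {A : Type} [Ring A] [Bialgebra ℂ A] {q : ℂˣ} {z : Fin 3 → Fin 3 → A} {w : A}

/-- The counits of the coordinates of a form with respect to the differentials of the matrix
entries. -/
noncomputable def HasBasis.cls {C : Calculus.{u} A} (hC : C.HasBasis z) (p : Fin 3 × Fin 3) :
    C.Form →ₗ[ℂ] ℂ :=
  (Bialgebra.counitAlgHom ℂ A).toLinearMap ∘ₗ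
    ((Module.Basis.mk hC.1 hC.2.ge).coord p).restrictScalars ℂ

namespace HasBasis

variable {C : Calculus.{u} A} (hC : C.HasBasis z)

theorem cls_smul (p : Fin 3 × Fin 3) (a : A) (ρ : C.Form) :
    hC.cls p (a • ρ) = Coalgebra.counit (R := ℂ) a * hC.cls p ρ := by
  simp [cls]

theorem cls_d (p : Fin 3 × Fin 3) (i j : Fin 3) :
    hC.cls p (C.d (z i j)) = if (i, j) = p then 1 else 0 := by
  have e : C.d (z i j) = Module.Basis.mk hC.1 hC.2.ge (i, j) :=
    (Module.Basis.mk_apply hC.1 hC.2.ge (i, j)).symm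
  simp only [cls, LinearMap.comp_apply, LinearMap.restrictScalars_apply, e,
    Module.Basis.coord_apply, Module.Basis.repr_self]
  rw [Finsupp.single_apply]
  split_ifs <;> simp

theorem counit_antipode (h : IsQuantumGroup q z w) (i j : Fin 3) :
    Coalgebra.counit (R := ℂ) (antipodeMatrix q z w i j) = if i = j then (1 : ℂ) else 0 := by
  have := congrArg (Coalgebra.counit (R := ℂ)) (h.antipode_mul i j)
  simp only [map_sum, Bialgebra.counit_mul, h.counit_z] at this
  simp only [mul_ite, mul_one, mul_zero, Finset.sum_ite_eq', Finset.mem_univ, if_true] at this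
  rw [this]
  split_ifs <;> simp

theorem cls_trTheta (h : IsQuantumGroup q z w) (a b : Fin 3) :
    hC.cls (a, b) (C.trTheta q z (antipodeMatrix q z w)) = if a = b then weight q a else 0 := by
  simp only [trTheta, theta, map_add, map_smul, map_sum, hC.cls_smul, hC.cls_d, counit_antipode h]
  fin_cases a <;> fin_cases b <;> simp [weight]

end HasBasis

/-- Three classes of (dz 0 0)·z 1 1 at the unit suffice. The class at (2, 2) comes only from τ and
fixes its contribution; the class at (0, 0) then gives t. The class at (1, 1) gives the square of
the entry (0, 1) of R, which is 0 in the first family and (q − q⁻¹)² in the second. -/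
theorem IsBraided.parameters_unique (h : IsQuantumGroup q z w) (hq : (q : ℂ) ^ 2 ≠ 1)
    {C : Calculus.{u} A} (hC : C.HasBasis z) {ν ν' : Family} {t t' : ℂ} (ht : t ≠ 0)
    (hb : C.IsBraided q z (antipodeMatrix q z w) ν t)
    (hb' : C.IsBraided q z (antipodeMatrix q z w) ν' t') : ν = ν' ∧ t = t' := by
  have key (ν : Family) (t : ℂ) (hb : C.IsBraided q z (antipodeMatrix q z w) ν t) :
      ∃ x : ℂ, hC.cls (0, 0) (op (z 1 1) • C.d (z 0 0)) = t - x * (q : ℂ) ^ 4 ∧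
        hC.cls (1, 1) (op (z 1 1) • C.d (z 0 0)) = t * ν.coeff q 0 1 ^ 2 + (t - 1) - x * (q : ℂ) ^ 2 ∧
        hC.cls (2, 2) (op (z 1 1) • C.d (z 0 0)) = -x := by
    rw [hb 0 1 0 1]
    generalize (t - 1) ^ 2 • prod z 0 1 0 1
        + (t * (t - 1) * ν.hecke q) • actL (ν.coeff q) (prod z) 0 1 0 1 = y
    refine ⟨(ν.kappa q t)⁻¹ * Coalgebra.counit (R := ℂ) y, ?_, ?_, ?_⟩ <;>
      simp [hC.cls_smul, hC.cls_d, hC.cls_trTheta h, actL, actR, h.counit_z, weight,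
        IsQuantumMatrix.rOff] <;> ring
  obtain ⟨x, h0, h1, h2⟩ := key ν t hb
  obtain ⟨x', h0', h1', h2'⟩ := key ν' t' hb'
  have hx : x = x' := by linear_combination h2 - h2'
  have htt : t = t' := by
    rw [hx] at h0
    linear_combination h0' - h0
  subst hx htt
  refine ⟨?_, rfl⟩
  have hrr : t * (ν.coeff q 0 1 ^ 2 - ν'.coeff q 0 1 ^ 2) = 0 := by linear_combination h1' - h1
  have hr := (mul_eq_zero.1 hrr).resolve_left ht
  have hne : (q : ℂ) - (q : ℂ)⁻¹ ≠ 0 := Family.hecke_ne_zero hq .second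
  cases ν <;> cases ν' <;> first | rfl | skip
  all_goals
    simp [Family.coeff, IsQuantumMatrix.rDiag] at hr
    exact absurd hr hne

theorem IsBraided.map {A B : Type} [Ring A] [Algebra ℂ A] [Ring B] [Algebra ℂ B]
    {z : Fin 3 → Fin 3 → A} {S : Matrix (Fin 3) (Fin 3) A} {C : Calculus.{u} A}
    {C' : Calculus.{v} B} {ν : Family} {t : ℂ} (hb : C.IsBraided q z S ν t) (p : A →ₐ[ℂ] B)
    (φ : C.Form →ₗ[ℂ] C'.Form) (h1 : ∀ (a : A) (ρ : C.Form), φ (a • ρ) = p a • φ ρ)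
    (h2 : ∀ (a : A) (ρ : C.Form), φ (op a • ρ) = op (p a) • φ ρ)
    (h3 : ∀ a : A, φ (C.d a) = C'.d (p a)) :
    C'.IsBraided q (fun i j => p (z i j)) (S.map p) ν t := by
  intro i k j l
  have e := congrArg φ (hb i k j l)
  have hτ : φ (C.trTheta q z S) = C'.trTheta q (fun i j => p (z i j)) (S.map p) := by
    simp only [trTheta, theta, map_add, map_smul, map_sum, h1, h3, Matrix.map_apply]
  have hY (i k j l : Fin 3) :
      φ (actL (ν.coeff q) (actR (ν.coeff q) fun i k j l => z i j • C.d (z k l)) i k j l)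
      = actL (ν.coeff q) (actR (ν.coeff q) fun i k j l => p (z i j) • C'.d (p (z k l))) i k j l := by
    simp only [actL, actR, map_add, map_smul, h1, h3]
  have hZ (i k j l : Fin 3) : p (prod z i k j l) = prod (fun i j => p (z i j)) i k j l :=
    map_mul p _ _
  rw [h2, h3, map_sub, map_add, map_smul φ t, map_smul φ (t - 1), map_smul φ (ν.kappa q t)⁻¹, hY,
    h1 (z i j), h3, h1, hτ] at e
  simp only [actL, map_add, map_smul, hZ] at e ⊢
  exact e

theorem Equivalent.isBraided {A : Type} [Ring A] [Algebra ℂ A] {z : Fin 3 → Fin 3 → A}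
    {S : Matrix (Fin 3) (Fin 3) A} {C : Calculus.{u} A} {C' : Calculus.{v} A} (h : C.Equivalent C')
    {ν : Family} {t : ℂ} (hb : C.IsBraided q z S ν t) : C'.IsBraided q z S ν t := by
  obtain ⟨ζ, h1, h2, h3⟩ := h
  exact hb.map (AlgHom.id ℂ A) ζ.toLinearMap h1 h2 h3

end Calculus

/-! ## The number of parameters -/

theorem Complex.card_pow_three_eq {a : ℂ} (ha : a ≠ 0) : Nat.card {t : ℂ | t ^ 3 = a} = 3 := by
  have hζ := Complex.isPrimitiveRoot_exp 3 (by norm_num)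
  obtain ⟨b, hb⟩ := IsAlgClosed.exists_pow_nat_eq a (n := 3) (by norm_num)
  have h := hζ.card_nthRoots a
  rw [if_pos ⟨b, hb⟩] at h
  have e : {t : ℂ | t ^ 3 = a} = ↑(Polynomial.nthRoots 3 a).toFinset := by
    ext t
    simp [Polynomial.mem_nthRoots]
  rw [e, Nat.card_coe_set_eq, Set.ncard_coe_finset,
    Multiset.toFinset_card_of_nodup (hζ.nthRoots_nodup ha), h]

/-- If κ vanished, conjugating the equation with t̄ = t⁻¹ and q̄ = q⁻¹ would give a second equation
for t. Eliminating t from the two leaves (q⁴ − 1)²(q⁴ + 1) = 0. -/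
theorem Family.admissible_of_norm_eq_one {q : ℂˣ} {t : ℂ} (hq : ‖(q : ℂ)‖ = 1) (ht : ‖t‖ = 1)
    (h1 : (q : ℂ) ^ 4 ≠ 1) (h2 : (q : ℂ) ^ 4 ≠ -1) (ν : Family) : Admissible q ν t := by
  have hq0 : (q : ℂ) ≠ 0 := q.ne_zero
  have ht0 : t ≠ 0 := by
    rintro rfl
    simp at ht
  have hq' := (Complex.inv_eq_conj hq).symm
  have ht' := (Complex.inv_eq_conj ht).symm
  have key : ((q : ℂ) ^ 4 - 1) ^ 2 * ((q : ℂ) ^ 4 + 1) ≠ 0 :=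
    mul_ne_zero (pow_ne_zero _ (sub_ne_zero.2 h1)) fun h => h2 (eq_neg_of_add_eq_zero_left h)
  cases ν
  · refine ⟨ht0, fun h => key ?_⟩
    have hc := congrArg (starRingEnd ℂ) h
    simp only [map_sub, map_mul, map_add, map_pow, map_one, map_zero, hq', ht'] at hc
    field_simp at hc
    linear_combination ((q : ℂ) ^ 6 + (q : ℂ) ^ 4 + 1) * hc + ((q : ℂ) ^ 4 + (q : ℂ) ^ 2 + 1) * h
  · refine ⟨ht0, fun h => key ?_⟩
    have hc := congrArg (starRingEnd ℂ) h
    simp only [map_sub, map_mul, map_add, map_pow, map_one, map_zero, hq', ht'] at hc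
    field_simp at hc
    linear_combination ((q : ℂ) ^ 6 + (q : ℂ) ^ 2 + 1) * hc
      + (q : ℂ) ^ 2 * ((q : ℂ) ^ 4 + (q : ℂ) ^ 2 + 1) * h

theorem norm_eq_one_of_pow_three {q : ℂˣ} {t : ℂ} (hq : ‖(q : ℂ)‖ = 1) {ν : Family}
    (h : ‖t ^ 3 * ν.base q ^ 2‖ = 1) : ‖t‖ = 1 := by
  have hb : ‖ν.base q‖ = 1 := by cases ν <;> simp [Family.base, hq]
  rw [norm_mul, norm_pow, norm_pow, hb, one_pow, mul_one] at h
  exact (pow_eq_one_iff_of_nonneg (norm_nonneg t) (by norm_num)).1 h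

theorem card_slParameters {q : ℂˣ} (hq : ‖(q : ℂ)‖ = 1) (h1 : (q : ℂ) ^ 4 ≠ 1)
    (h2 : (q : ℂ) ^ 4 ≠ -1) : Nat.card ((ν : Family) × slParameters q ν) = 6 := by
  have e (ν : Family) : slParameters q ν = {t | t ^ 3 = (ν.base q ^ 2)⁻¹} := by
    ext t
    rw [Family.mem_slParameters, Set.mem_ofPred_eq,
      ← div_eq_one_iff_eq (inv_ne_zero (pow_ne_zero _ (Family.base_ne_zero q ν))), div_inv_eq_mul]
    exact ⟨fun h => h.2, fun h =>
      ⟨Family.admissible_of_norm_eq_one hq (norm_eq_one_of_pow_three hq (by rw [h, norm_one])) h1 h2 ν, h⟩⟩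
  have h3 (ν : Family) : Nat.card (slParameters q ν) = 3 := by
    rw [e]
    exact Complex.card_pow_three_eq (inv_ne_zero (pow_ne_zero _ (Family.base_ne_zero q ν)))
  have hf (ν : Family) : Finite (slParameters q ν) := Nat.finite_of_card_ne_zero (by simp [h3])
  let E : ((ν : Family) × slParameters q ν) ≃ slParameters q .first ⊕ slParameters q .second :=
    { toFun := fun p => match p with
        | ⟨.first, t⟩ => .inl t
        | ⟨.second, t⟩ => .inr t
      invFun := Sum.elim (fun t => ⟨.first, t⟩) fun t => ⟨.second, t⟩
      left_inv := by rintro ⟨_ | _, t⟩ <;> rfl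
      right_inv := by rintro (t | t) <;> rfl }
  rw [Nat.card_congr E, Nat.card_sum, h3, h3]

/-! ## Intertwiners of the third tensor power -/

namespace GLq

variable {q : ℂˣ}

/-- A two-dimensional upper triangular representation whose only off-diagonal entry is at
`(a, b)`. -/
def ladder (x y : Fin 3 → ℂ) (a b i j : Fin 3) : Matrix (Fin 2) (Fin 2) ℂ :=
  !![if i = j then x i else 0, if i = a ∧ j = b then 1 else 0; 0, if i = j then y i else 0]

theorem ladder_mul (x y : Fin 3 → ℂ) (a b i j k l : Fin 3) :
    ladder x y a b i j * ladder x y a b k l =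
      !![if i = j ∧ k = l then x i * x k else 0,
        (if i = j ∧ k = a ∧ l = b then x i else 0) + (if i = a ∧ j = b ∧ k = l then y k else 0);
        0, if i = j ∧ k = l then y i * y k else 0] := by
  ext s t
  fin_cases s <;> fin_cases t <;> simp [ladder, Matrix.mul_apply, ite_and] <;>
    split_ifs <;> simp_all

/-- The four off-diagonal entries play the role of the Chevalley generators of the quantized
enveloping algebra, with the two diagonal characters as the group-like elements in their coproducts.
-/
theorem isQuantumMatrix_ladder {a b : Fin 3} {x y : Fin 3 → ℂ}
    (h : (a, b) = (0, 1) ∧ x = ![(q : ℂ), 1, 1] ∧ y = ![1, (q : ℂ), 1] ∨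
      (a, b) = (1, 0) ∧ x = ![(q : ℂ), 1, 1] ∧ y = ![1, (q : ℂ), 1] ∨
      (a, b) = (1, 2) ∧ x = ![1, (q : ℂ), 1] ∧ y = ![1, 1, (q : ℂ)] ∨
      (a, b) = (2, 1) ∧ x = ![1, (q : ℂ), 1] ∧ y = ![1, 1, (q : ℂ)]) :
    IsQuantumMatrix q (ladder x y a b) := by
  obtain ⟨h, rfl, rfl⟩ | ⟨h, rfl, rfl⟩ | ⟨h, rfl, rfl⟩ | ⟨h, rfl, rfl⟩ := h <;>
  obtain ⟨rfl, rfl⟩ := Prod.mk.inj h <;>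
  · refine ⟨fun i j k hjk => ?_, fun i k j hik => ?_, fun i k j l hik hlj => ?_,
      fun i k j l hik hjl => ?_⟩ <;> simp only [ladder_mul] <;> ext s t <;> revert s t
    · revert i j k; simp [Fin.forall_fin_succ]
    · revert i j k; simp [Fin.forall_fin_succ]
    · revert i j k l; simp [Fin.forall_fin_succ]
    · revert i j k l; simp [Fin.forall_fin_succ]

/-- The upper right entry acts as a twisted derivation: it replaces an index in one factor while the
characters x and y act on the factors before and after it. -/
theorem ladder_mul_mul_apply (x y : Fin 3 → ℂ) (a b i r k s n m : Fin 3) :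
    (ladder x y a b i r * ladder x y a b k s * ladder x y a b n m) 0 1 =
      (if i = r then if k = s then if m = b then if n = a then x i * x k else 0 else 0 else 0 else 0)
      + (if i = r then if n = m then if s = b then if k = a then x i * y n else 0 else 0 else 0
        else 0)
      + (if n = m then if k = s then if r = b then if i = a then y k * y n else 0 else 0 else 0
        else 0) := by
  simp only [ladder, Matrix.mul_apply, Fin.sum_univ_two, Matrix.of_apply, Matrix.cons_val_zero,
    Matrix.cons_val_one, mul_ite, ite_mul, mul_one, mul_zero, zero_mul, one_mul]
  split_ifs <;> simp_all <;> ring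

/-- A matrix of numbers that commutes with the third tensor power of the quantum matrix. -/
def IsIntertwiner (q : ℂˣ) (Ω : Fin 3 → Fin 3 → Fin 3 → Fin 3 → Fin 3 → Fin 3 → ℂ) : Prop :=
  ∀ i k n j l p, ∑ r, ∑ s, ∑ f, Ω i k n r s f • (z q r j * z q s l * z q f p)
    = ∑ r, ∑ s, ∑ m, Ω r s m j l p • (z q i r * z q k s * z q n m)

variable {Ω : Fin 3 → Fin 3 → Fin 3 → Fin 3 → Fin 3 → Fin 3 → ℂ}

/-- Evaluating the intertwining relation in the ladder representation kills the side with the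
vanishing row. The other side is a relation between the rows obtained by replacing one index a by b.
-/
theorem IsIntertwiner.ladder_row (hΩ : IsIntertwiner q Ω) {a b : Fin 3} {x y : Fin 3 → ℂ}
    (hx : IsQuantumMatrix q (ladder x y a b)) (hd : qdet q (ladder x y a b) = (q : ℂ) • 1)
    (i k n : Fin 3) (h0 : ∀ j l p, Ω i k n j l p = 0) (j l p : Fin 3) :
    (if n = a then x i * x k * Ω i k b j l p else 0)
      + (if k = a then x i * y n * Ω i b n j l p else 0)
      + (if i = a then y k * y n * Ω b k n j l p else 0) = 0 := by
  have hq : (q : ℂ) ≠ 0 := q.ne_zero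
  let f : GLq q →ₐ[ℂ] Matrix (Fin 2) (Fin 2) ℂ := GLq.lift (ladder x y a b) ((q : ℂ)⁻¹ • 1) hx
    (by rw [hd, smul_mul_smul_comm, mul_inv_cancel₀ hq, one_smul, one_mul])
    (by rw [hd, smul_mul_smul_comm, inv_mul_cancel₀ hq, one_smul, one_mul])
  have hf (i j) : f (z q i j) = ladder x y a b i j := GLq.lift_z i j
  have := congrArg (fun a => f a 0 1) (hΩ i k n j l p)
  simp only [h0, zero_smul, Finset.sum_const_zero, map_zero, map_sum, map_smul, map_mul, hf,
    Matrix.sum_apply, Matrix.smul_apply, ladder_mul_mul_apply, smul_eq_mul, mul_add,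
    Finset.sum_add_distrib, Matrix.zero_apply, mul_ite, mul_zero, Finset.sum_ite_eq,
    Finset.sum_ite_eq', Finset.mem_univ, if_true, Finset.sum_ite_irrel, Finset.sum_const_zero]
    at this
  refine Eq.trans ?_ this.symm
  simp only [mul_comm]

theorem qdet_ladder {a b : Fin 3} {x y : Fin 3 → ℂ}
    (h : (a, b) = (0, 1) ∧ x = ![(q : ℂ), 1, 1] ∧ y = ![1, (q : ℂ), 1] ∨
      (a, b) = (1, 0) ∧ x = ![(q : ℂ), 1, 1] ∧ y = ![1, (q : ℂ), 1] ∨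
      (a, b) = (1, 2) ∧ x = ![1, (q : ℂ), 1] ∧ y = ![1, 1, (q : ℂ)] ∨
      (a, b) = (2, 1) ∧ x = ![1, (q : ℂ), 1] ∧ y = ![1, 1, (q : ℂ)]) :
    qdet q (ladder x y a b) = (q : ℂ) • 1 := by
  obtain ⟨h, rfl, rfl⟩ | ⟨h, rfl, rfl⟩ | ⟨h, rfl, rfl⟩ | ⟨h, rfl, rfl⟩ := h <;>
  obtain ⟨rfl, rfl⟩ := Prod.mk.inj h <;>
  · ext s t
    simp only [qdet, Matrix.sub_apply, Matrix.add_apply, Matrix.smul_apply]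
    fin_cases s <;> fin_cases t <;> simp [ladder]

/-- An intertwiner vanishes if its row at `(0, 1, 2)` does. -/
theorem IsIntertwiner.eq_zero (hΩ : IsIntertwiner q Ω) (h012 : ∀ j l p, Ω 0 1 2 j l p = 0)
    (i k n j l p : Fin 3) : Ω i k n j l p = 0 := by
  have hq : (q : ℂ) ≠ 0 := q.ne_zero
  have c01 := fun i k n h0 => hΩ.ladder_row (isQuantumMatrix_ladder (.inl ⟨rfl, rfl, rfl⟩))
    (qdet_ladder (.inl ⟨rfl, rfl, rfl⟩)) i k n h0
  have c10 := fun i k n h0 => hΩ.ladder_row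
    (isQuantumMatrix_ladder (.inr (.inl ⟨rfl, rfl, rfl⟩)))
    (qdet_ladder (.inr (.inl ⟨rfl, rfl, rfl⟩))) i k n h0
  have c12 := fun i k n h0 => hΩ.ladder_row
    (isQuantumMatrix_ladder (.inr (.inr (.inl ⟨rfl, rfl, rfl⟩))))
    (qdet_ladder (.inr (.inr (.inl ⟨rfl, rfl, rfl⟩)))) i k n h0
  have c21 := fun i k n h0 => hΩ.ladder_row
    (isQuantumMatrix_ladder (.inr (.inr (.inr ⟨rfl, rfl, rfl⟩))))
    (qdet_ladder (.inr (.inr (.inr ⟨rfl, rfl, rfl⟩)))) i k n h0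
  -- The order is chosen so that each application of a Chevalley generator to a known zero row
  -- involves just one row not yet treated. All 27 rows are reached from (0, 1, 2), and the only
  -- division is by powers of q.
  have h112 (j l p) : Ω 1 1 2 j l p = 0 := by
    simpa [hq] using c01 0 1 2 h012 j l p
  have h002 (j l p) : Ω 0 0 2 j l p = 0 := by
    simpa [hq] using c10 0 1 2 h012 j l p
  have h022 (j l p) : Ω 0 2 2 j l p = 0 := by
    simpa [hq] using c12 0 1 2 h012 j l p
  have h011 (j l p) : Ω 0 1 1 j l p = 0 := by
    simpa [hq] using c21 0 1 2 h012 j l p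
  have h102 (j l p) : Ω 1 0 2 j l p = 0 := by
    simpa [hq, h012] using c10 1 1 2 h112 j l p
  have h111 (j l p) : Ω 1 1 1 j l p = 0 := by
    simpa [hq] using c21 1 1 2 h112 j l p
  have h001 (j l p) : Ω 0 0 1 j l p = 0 := by
    simpa [hq] using c21 0 0 2 h002 j l p
  have h122 (j l p) : Ω 1 2 2 j l p = 0 := by
    simpa [hq] using c01 0 2 2 h022 j l p
  have h021 (j l p) : Ω 0 2 1 j l p = 0 := by
    simpa [hq, h012] using c21 0 2 2 h022 j l p
  have h010 (j l p) : Ω 0 1 0 j l p = 0 := by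
    simpa [hq, h001] using c10 0 1 1 h011 j l p
  have h212 (j l p) : Ω 2 1 2 j l p = 0 := by
    simpa [hq, h122] using c12 1 1 2 h112 j l p
  have h202 (j l p) : Ω 2 0 2 j l p = 0 := by
    simpa [hq] using c12 1 0 2 h102 j l p
  have h101 (j l p) : Ω 1 0 1 j l p = 0 := by
    simpa [hq] using c21 1 0 2 h102 j l p
  have h110 (j l p) : Ω 1 1 0 j l p = 0 := by
    simpa [hq, h011, h101] using c10 1 1 1 h111 j l p
  have h000 (j l p) : Ω 0 0 0 j l p = 0 := by
    simpa [hq] using c10 0 0 1 h001 j l p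
  have h222 (j l p) : Ω 2 2 2 j l p = 0 := by
    simpa [hq] using c12 1 2 2 h122 j l p
  have h121 (j l p) : Ω 1 2 1 j l p = 0 := by
    simpa [hq, h112] using c21 1 2 2 h122 j l p
  have h020 (j l p) : Ω 0 2 0 j l p = 0 := by
    simpa [hq] using c10 0 2 1 h021 j l p
  have h211 (j l p) : Ω 2 1 1 j l p = 0 := by
    simpa [hq, h121, h112] using c12 1 1 1 h111 j l p
  have h201 (j l p) : Ω 2 0 1 j l p = 0 := by
    simpa [hq, h102] using c21 2 0 2 h202 j l p
  have h100 (j l p) : Ω 1 0 0 j l p = 0 := by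
    simpa [hq, h001] using c10 1 0 1 h101 j l p
  have h221 (j l p) : Ω 2 2 1 j l p = 0 := by
    simpa [hq, h122, h212] using c21 2 2 2 h222 j l p
  have h120 (j l p) : Ω 1 2 0 j l p = 0 := by
    simpa [hq, h021] using c10 1 2 1 h121 j l p
  have h210 (j l p) : Ω 2 1 0 j l p = 0 := by
    simpa [hq, h120] using c12 1 1 0 h110 j l p
  have h200 (j l p) : Ω 2 0 0 j l p = 0 := by
    simpa [hq] using c10 2 0 1 h201 j l p
  have h220 (j l p) : Ω 2 2 0 j l p = 0 := by
    simpa [hq] using c10 2 2 1 h221 j l p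
  match i, k, n with
  | 0, 0, 0 => exact h000 j l p
  | 0, 0, 1 => exact h001 j l p
  | 0, 0, 2 => exact h002 j l p
  | 0, 1, 0 => exact h010 j l p
  | 0, 1, 1 => exact h011 j l p
  | 0, 1, 2 => exact h012 j l p
  | 0, 2, 0 => exact h020 j l p
  | 0, 2, 1 => exact h021 j l p
  | 0, 2, 2 => exact h022 j l p
  | 1, 0, 0 => exact h100 j l p
  | 1, 0, 1 => exact h101 j l p
  | 1, 0, 2 => exact h102 j l p
  | 1, 1, 0 => exact h110 j l p
  | 1, 1, 1 => exact h111 j l p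
  | 1, 1, 2 => exact h112 j l p
  | 1, 2, 0 => exact h120 j l p
  | 1, 2, 1 => exact h121 j l p
  | 1, 2, 2 => exact h122 j l p
  | 2, 0, 0 => exact h200 j l p
  | 2, 0, 1 => exact h201 j l p
  | 2, 0, 2 => exact h202 j l p
  | 2, 1, 0 => exact h210 j l p
  | 2, 1, 1 => exact h211 j l p
  | 2, 1, 2 => exact h212 j l p
  | 2, 2, 0 => exact h220 j l p
  | 2, 2, 1 => exact h221 j l p
  | 2, 2, 2 => exact h222 j l p

/-- An intertwiner preserves weights. -/
theorem IsIntertwiner.eq_zero_of_weight (hΩ : IsIntertwiner q Ω) {j l p : Fin 3}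
    (h : (![2, 3, 5] : Fin 3 → ℂ) j * (![2, 3, 5] : Fin 3 → ℂ) l * (![2, 3, 5] : Fin 3 → ℂ) p
      ≠ 30) : Ω 0 1 2 j l p = 0 := by
  -- A diagonal character with distinct prime values: a product of three of them is 2·3·5 only for
  -- the permutations of (0, 1, 2).
  set x : Fin 3 → ℂ := ![2, 3, 5]
  have hx : IsQuantumMatrix q (fun i j : Fin 3 => if i = j then x i else 0) := by
    refine ⟨fun i j k hjk => ?_, fun i k j hik => ?_, fun i k j l hik hlj => ?_,
      fun i k j l hik hjl => ?_⟩
    · simp only [mul_ite, ite_mul, zero_mul, mul_zero]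
      split_ifs <;> simp_all
    · simp only [mul_ite, ite_mul, zero_mul, mul_zero]
      split_ifs <;> simp_all
    · exact mul_comm _ _
    · have : (if k = j then x k else 0) * (if i = l then x i else 0) = 0 := by
        split_ifs with h1 h2
        · subst h1 h2
          exact absurd hik (not_lt.2 hjl.le)
        all_goals simp
      rw [this, smul_zero, add_zero, mul_comm]
  have hd : qdet q (fun i j : Fin 3 => if i = j then x i else 0) = 30 := by
    simp [qdet, x]
    norm_num
  let f : GLq q →ₐ[ℂ] ℂ := GLq.lift (fun i j : Fin 3 => if i = j then x i else 0) 30⁻¹ hx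
    (by rw [hd]; norm_num) (by rw [hd]; norm_num)
  have hf (i j) : f (z q i j) = if i = j then x i else 0 := GLq.lift_z i j
  have := congrArg f (hΩ 0 1 2 j l p)
  simp only [map_sum, map_smul, map_mul, hf, smul_eq_mul, mul_ite, ite_mul, mul_zero, zero_mul,
    Finset.sum_ite_eq, Finset.sum_ite_eq', Finset.mem_univ, if_true] at this
  have h30 : x 0 * x 1 * x 2 = 30 := by simp [x]; norm_num
  rw [h30] at this
  exact (mul_eq_zero.1 (show Ω 0 1 2 j l p * (x j * x l * x p - 30) = 0 by
    linear_combination this)).resolve_right (sub_ne_zero.2 h)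

/-- An intertwiner vanishes if its six entries at `(0, 1, 2)` and the permutations do. -/
theorem IsIntertwiner.eq_zero_of_permutations (hΩ : IsIntertwiner q Ω) (h012 : Ω 0 1 2 0 1 2 = 0)
    (h021 : Ω 0 1 2 0 2 1 = 0) (h102 : Ω 0 1 2 1 0 2 = 0) (h120 : Ω 0 1 2 1 2 0 = 0)
    (h201 : Ω 0 1 2 2 0 1 = 0) (h210 : Ω 0 1 2 2 1 0 = 0) (i k n j l p : Fin 3) :
    Ω i k n j l p = 0 := by
  refine hΩ.eq_zero (fun j l p => ?_) i k n j l p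
  by_cases h : (![2, 3, 5] : Fin 3 → ℂ) j * (![2, 3, 5] : Fin 3 → ℂ) l
      * (![2, 3, 5] : Fin 3 → ℂ) p = 30
  · fin_cases j <;> fin_cases l <;> fin_cases p <;> first | assumption | norm_num at h
  · exact hΩ.eq_zero_of_weight h

end GLq

/-! ## Bicovariant tensors of forms -/

namespace Braid

theorem sum_actL_smul {M : Type*} [AddCommGroup M] [Module ℂ M] (r : Fin 3 → Fin 3 → ℂ)
    (F : Fin 3 → Fin 3 → Fin 3 → Fin 3 → ℂ) (G : Fin 3 → Fin 3 → Fin 3 → Fin 3 → M)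
    (i k j l : Fin 3) :
    ∑ a, ∑ b, actL r F a b j l • G i k a b = ∑ a, ∑ b, F a b j l • actR r G i k a b := by
  simp only [actL, actR, add_smul, smul_add, smul_assoc, Finset.sum_add_distrib]
  congr 1
  · simp only [smul_comm (F _ _ _ _)]
  · rw [Finset.sum_comm]
    simp only [IsQuantumMatrix.rOff_comm, smul_comm (F _ _ _ _)]

end Braid

namespace Calculus

open Braid

namespace HasBasis

variable {A : Type} [Ring A] [Bialgebra ℂ A] {q : ℂˣ} {z : Fin 3 → Fin 3 → A} {w : A}
  {C : Calculus.{u} A} (hC : C.HasBasis z)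

/-- The coordinates of a form with respect to the differentials of the matrix entries. -/
noncomputable def coord (p : Fin 3 × Fin 3) : C.Form →ₗ[A] A :=
  (Module.Basis.mk hC.1 hC.2.ge).coord p

theorem coord_d (p : Fin 3 × Fin 3) (i j : Fin 3) :
    hC.coord p (C.d (z i j)) = if (i, j) = p then 1 else 0 := by
  have e : C.d (z i j) = Module.Basis.mk hC.1 hC.2.ge (i, j) :=
    (Module.Basis.mk_apply hC.1 hC.2.ge (i, j)).symm
  simp only [coord, e, Module.Basis.coord_apply, Module.Basis.repr_self]
  exact Finsupp.single_apply

theorem sum_coord_smul (ρ : C.Form) : ∑ p, hC.coord p ρ • C.d (z p.1 p.2) = ρ := by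
  have := (Module.Basis.mk hC.1 hC.2.ge).sum_repr ρ
  simpa [coord] using this

/-- The coordinates of the left coaction of a form. -/
noncomputable def leftCoord (e b : Fin 3) : C.Form →ₗ[A] A :=
  ∑ x, (hC.coord (x, b)).smulRight (z x e)

/-- The coordinates of the right coaction of a form. -/
noncomputable def rightCoord (a e : Fin 3) : C.Form →ₗ[A] A :=
  ∑ y, (hC.coord (a, y)).smulRight (z e y)

theorem leftCoord_apply (e b : Fin 3) (ρ : C.Form) :
    hC.leftCoord e b ρ = ∑ x, hC.coord (x, b) ρ * z x e := by
  simp [leftCoord, LinearMap.sum_apply]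

theorem rightCoord_apply (a e : Fin 3) (ρ : C.Form) :
    hC.rightCoord a e ρ = ∑ y, hC.coord (a, y) ρ * z e y := by
  simp [rightCoord, LinearMap.sum_apply]

theorem leftCoord_d (e b i j : Fin 3) :
    hC.leftCoord e b (C.d (z i j)) = if j = b then z i e else 0 := by
  simp [leftCoord_apply, coord_d, Prod.ext_iff, ite_and]

theorem rightCoord_d (a e i j : Fin 3) :
    hC.rightCoord a e (C.d (z i j)) = if i = a then z e j else 0 := by
  simp [rightCoord_apply, coord_d, Prod.ext_iff, ite_and]

theorem leftCoord_csmul (e b : Fin 3) (c : ℂ) (ρ : C.Form) :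
    hC.leftCoord e b (c • ρ) = c • hC.leftCoord e b ρ :=
  (hC.leftCoord e b).map_smul_of_tower c ρ

theorem rightCoord_csmul (a e : Fin 3) (c : ℂ) (ρ : C.Form) :
    hC.rightCoord a e (c • ρ) = c • hC.rightCoord a e ρ :=
  (hC.rightCoord a e).map_smul_of_tower c ρ

/-- Left coordinates arise by right multiplication with Z, so the antipode inverts them. A form
whose left coordinates vanish is therefore zero. -/
theorem sum_leftCoord_mul_antipode (h : IsQuantumGroup q z w) (a b : Fin 3) (ρ : C.Form) :
    ∑ e, hC.leftCoord e b ρ * antipodeMatrix q z w e a = hC.coord (a, b) ρ := by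
  simp only [leftCoord_apply, Finset.sum_mul, mul_assoc]
  rw [Finset.sum_comm]
  simp only [← Finset.mul_sum, h.mul_antipode]
  simp

/-- The commutation of the quantum matrix with the coordinates of the two coactions. -/
theorem sum_rightCoord_mul (h : IsQuantumMatrix q z) (n p : Fin 3) (ρ : C.Form) :
    ∑ a, (IsQuantumMatrix.rDiag q a n • (hC.rightCoord a a ρ * z n p)
        + IsQuantumMatrix.rOff a n • (hC.rightCoord a n ρ * z a p))
      = ∑ y, (IsQuantumMatrix.rDiag q y p • (hC.leftCoord y y ρ * z n p)
        + IsQuantumMatrix.rOff y p • (hC.leftCoord p y ρ * z n y)) := by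
  -- In terms of the coordinates ρ(x, y) of the form, both sides contract ρ with R Z₁Z₂ = Z₁Z₂ R.
  simp only [leftCoord_apply, rightCoord_apply, Finset.sum_mul, Finset.smul_sum,
    ← Finset.sum_add_distrib, mul_assoc, ← mul_smul_comm, ← mul_add]
  rw [Finset.sum_comm]
  simp only [mul_smul_comm, h.rtt]

/-- The tensors of forms on which the coactions act as on the products of two matrix entries. -/
structure IsCovariant (W : Fin 3 → Fin 3 → Fin 3 → Fin 3 → C.Form) : Prop where
  left : ∀ i k j l e b, hC.leftCoord e b (W i k j l)
    = ∑ r, ∑ s, hC.cls (e, b) (W r s j l) • prod z i k r s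
  right : ∀ i k j l a e, hC.rightCoord a e (W i k j l)
    = ∑ r, ∑ s, hC.cls (a, e) (W i k r s) • prod z r s j l

namespace IsCovariant

variable {hC} {W W' : Fin 3 → Fin 3 → Fin 3 → Fin 3 → C.Form}

theorem add (hW : hC.IsCovariant W) (hW' : hC.IsCovariant W') : hC.IsCovariant (W + W') where
  left i k j l e b := by
    simp only [Pi.add_apply, map_add, hW.left, hW'.left, add_smul, Finset.sum_add_distrib]
  right i k j l e b := by
    simp only [Pi.add_apply, map_add, hW.right, hW'.right, add_smul, Finset.sum_add_distrib]

theorem smul (hW : hC.IsCovariant W) (c : ℂ) : hC.IsCovariant (c • W) where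
  left i k j l e b := by
    simp only [Pi.smul_apply, leftCoord_csmul, map_smul, hW.left, smul_assoc, Finset.smul_sum]
  right i k j l e b := by
    simp only [Pi.smul_apply, rightCoord_csmul, map_smul, hW.right, smul_assoc, Finset.smul_sum]

theorem sub (hW : hC.IsCovariant W) (hW' : hC.IsCovariant W') : hC.IsCovariant (W - W') := by
  have := hW.add (hW'.smul (-1))
  rwa [neg_one_smul, ← sub_eq_add_neg] at this

theorem actL (h : IsQuantumMatrix q z) (hW : hC.IsCovariant W) (ν : Family) :
    hC.IsCovariant (actL (ν.coeff q) W) where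
  left i k j l e b := by
    have e1 : ∀ r s, hC.cls (e, b) (Braid.actL (ν.coeff q) W r s j l)
        = Braid.actL (ν.coeff q) (fun r s j l => hC.cls (e, b) (W r s j l)) r s j l := by
      simp [Braid.actL]
    simp only [e1, sum_actL_smul, ← actL_prod h]
    simp only [Braid.actL, map_add, leftCoord_csmul, hW.left, Finset.smul_sum, smul_add,
      Finset.sum_add_distrib, smul_comm (hC.cls _ _)]
  right i k j l a e := by
    simp only [Braid.actL, map_add, rightCoord_csmul, hW.right, Finset.smul_sum, map_smul,
      add_smul, smul_assoc, Finset.sum_add_distrib]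

theorem actR (h : IsQuantumMatrix q z) (hW : hC.IsCovariant W) (ν : Family) :
    hC.IsCovariant (actR (ν.coeff q) W) where
  left i k j l e b := by
    simp only [Braid.actR, map_add, leftCoord_csmul, hW.left, Finset.smul_sum, map_smul,
      add_smul, smul_assoc, Finset.sum_add_distrib]
  right i k j l a e := by
    have e1 : ∀ r s, hC.cls (a, e) (Braid.actR (ν.coeff q) W i k r s)
        = Braid.actR (ν.coeff q) (fun i k r s => hC.cls (a, e) (W i k r s)) i k r s := by
      simp [Braid.actR]
    simp only [e1, sum_actR_smul, actL_prod h]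
    simp only [Braid.actR, map_add, rightCoord_csmul, hW.right, Finset.smul_sum, smul_add,
      Finset.sum_add_distrib, smul_comm (hC.cls _ _)]

end IsCovariant

/-- The coordinate maps are left linear and their values on dZ are entries of Z, so both coactions
reproduce the product Z₁Z₂. -/
theorem isCovariant_smul_d (h : IsQuantumGroup q z w) :
    hC.IsCovariant fun i k j l => z i j • C.d (z k l) where
  left i k j l e b := by
    simp [leftCoord_d, hC.cls_smul, hC.cls_d, h.counit_z, prod, Prod.ext_iff, ite_and]
  right i k j l a e := by
    simp [rightCoord_d, hC.cls_smul, hC.cls_d, h.counit_z, prod, Prod.ext_iff, ite_and]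

/-- The form τ is invariant on both sides. On the left this is S(Z)·Z = 1, and on the right it is
the adjoint invariance of the weighted trace. -/
theorem isCovariant_prod_smul_trTheta (h : IsQuantumGroup q z w) :
    hC.IsCovariant fun i k j l => prod z i k j l • C.trTheta q z (antipodeMatrix q z w) := by
  have e (a b : Fin 3) : hC.coord (a, b) (C.trTheta q z (antipodeMatrix q z w))
      = weight q b • antipodeMatrix q z w b a := by
    have : C.trTheta q z (antipodeMatrix q z w)
        = ∑ i, ∑ x, (weight q i • antipodeMatrix q z w i x) • C.d (z x i) := by
      simp [trTheta, theta, Fin.sum_univ_three, weight, smul_assoc, smul_add]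
    rw [this]
    simp [coord_d, Prod.ext_iff, ite_and]
  constructor
  · intro i k j l a b
    rw [map_smul, leftCoord_apply]
    simp only [e, smul_mul_assoc, ← Finset.smul_sum, h.antipode_mul, hC.cls_smul,
      hC.cls_trTheta h]
    rcases eq_or_ne b a with rfl | hab
    · simp [h.counit_z, prod]
    · simp [hab, hab.symm]
  · intro i k j l a b
    rw [map_smul, rightCoord_apply]
    simp only [e, smul_mul_assoc, h.sum_weight_antipode_mul, hC.cls_smul, hC.cls_trTheta h]
    rcases eq_or_ne b a with rfl | hab
    · simp [h.counit_z, prod, Algebra.algebraMap_eq_smul_one]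
    · simp [hab.symm]

theorem rid_lTensor_cls (p : Fin 3 × Fin 3) (u : A ⊗[ℂ] A) (x : A) (ρ : C.Form) :
    TensorProduct.rid ℂ A ((hC.cls p).lTensor A
      (TensorProduct.map₂ (LinearMap.mul ℂ A) C.leftAction u (x ⊗ₜ ρ)))
      = hC.cls p ρ • (TensorProduct.rid ℂ A ((Coalgebra.counit (R := ℂ)).lTensor A u) * x) := by
  induction u with
  | zero => simp
  | add u u' hu hu' => simp only [map_add, LinearMap.add_apply, add_mul, smul_add, hu, hu']
  | tmul u u' =>
    have e : C.leftAction u' ρ = u' • ρ := rfl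
    simp only [TensorProduct.map₂_apply_tmul, TensorProduct.map_tmul, LinearMap.lTensor_tmul, TensorProduct.rid_tmul, e,
      hC.cls_smul, LinearMap.mul_apply', smul_mul_assoc, smul_smul, mul_comm]

theorem lid_rTensor_cls (p : Fin 3 × Fin 3) (u : A ⊗[ℂ] A) (x : A) (ρ : C.Form) :
    TensorProduct.lid ℂ A ((hC.cls p).rTensor A
      (TensorProduct.map₂ C.leftAction (LinearMap.mul ℂ A) u (ρ ⊗ₜ x)))
      = hC.cls p ρ • (TensorProduct.lid ℂ A ((Coalgebra.counit (R := ℂ)).rTensor A u) * x) := by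
  induction u with
  | zero => simp
  | add u u' hu hu' => simp only [map_add, LinearMap.add_apply, add_mul, smul_add, hu, hu']
  | tmul u u' =>
    have e : C.leftAction u ρ = u • ρ := rfl
    simp only [TensorProduct.map₂_apply_tmul, TensorProduct.map_tmul, LinearMap.rTensor_tmul, TensorProduct.lid_tmul, e,
      hC.cls_smul, LinearMap.mul_apply', smul_mul_assoc, smul_smul, mul_comm]

/-- The matrix built from the classes of a covariant tensor. -/
noncomputable def intertwiner (q : ℂˣ) (W : Fin 3 → Fin 3 → Fin 3 → Fin 3 → C.Form)
    (i k n j l p : Fin 3) : ℂ :=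
  (if n = p then ∑ a, IsQuantumMatrix.rDiag q a n * hC.cls (a, a) (W i k j l) else 0)
    + IsQuantumMatrix.rOff p n * hC.cls (p, n) (W i k j l)

/-- `sum_rightCoord_mul` relates the two coactions of one form. For a covariant tensor each coaction
is a combination of Z₁Z₂ with classes at the unit as coefficients. Multiplication by the third
factor Z turns this into an identity for the third tensor power. -/
theorem IsCovariant.sum_intertwiner {W : Fin 3 → Fin 3 → Fin 3 → Fin 3 → C.Form}
    (hW : hC.IsCovariant W) (h : IsQuantumMatrix q z) (i k n j l p : Fin 3) :
    ∑ r, ∑ s, ∑ f, hC.intertwiner q W i k n r s f • (z r j * z s l * z f p)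
      = ∑ r, ∑ s, ∑ m, hC.intertwiner q W r s m j l p • (z i r * z k s * z n m) := by
  have e := hC.sum_rightCoord_mul h n p (W i k j l)
  simp only [hW.left, hW.right, prod, Finset.sum_mul, Finset.smul_sum, smul_mul_assoc, smul_smul,
    Finset.sum_add_distrib] at e
  have e1 : ∑ a, ∑ r, ∑ s, (IsQuantumMatrix.rDiag q a n * hC.cls (a, a) (W i k r s)) •
        (z r j * z s l * z n p)
      + ∑ a, ∑ r, ∑ s, (IsQuantumMatrix.rOff a n * hC.cls (a, n) (W i k r s)) •
        (z r j * z s l * z a p)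
      = ∑ r, ∑ s, ∑ f, hC.intertwiner q W i k n r s f • (z r j * z s l * z f p) := by
    simp only [intertwiner, add_smul, Finset.sum_add_distrib, ite_smul, zero_smul,
      Finset.sum_ite_eq, Finset.mem_univ, if_true, Finset.sum_smul]
    congr 1 <;> exact Finset.sum_comm.trans (Finset.sum_congr rfl fun _ _ => Finset.sum_comm)
  have e2 : ∑ y, ∑ r, ∑ s, (IsQuantumMatrix.rDiag q y p * hC.cls (y, y) (W r s j l)) •
        (z i r * z k s * z n p)
      + ∑ y, ∑ r, ∑ s, (IsQuantumMatrix.rOff y p * hC.cls (p, y) (W r s j l)) •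
        (z i r * z k s * z n y)
      = ∑ r, ∑ s, ∑ m, hC.intertwiner q W r s m j l p • (z i r * z k s * z n m) := by
    simp only [intertwiner, add_smul, Finset.sum_add_distrib, ite_smul, zero_smul,
      Finset.sum_ite_eq', Finset.mem_univ, if_true, Finset.sum_smul,
      fun y => IsQuantumMatrix.rOff_comm y p]
    congr 1 <;> exact Finset.sum_comm.trans (Finset.sum_congr rfl fun _ _ => Finset.sum_comm)
  rw [← e1, ← e2, e]

end HasBasis

/-- A covariant tensor vanishes if six of its classes do. -/
theorem HasBasis.IsCovariant.eq_zero {q : ℂˣ} {C : Calculus.{u} (GLq q)}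
    {hC : C.HasBasis (GLq.z q)} {W : Fin 3 → Fin 3 → Fin 3 → Fin 3 → C.Form}
    (hW : hC.IsCovariant W) (h021 : hC.cls (1, 2) (W 0 1 0 2) = 0)
    (h120 : hC.cls (0, 2) (W 0 1 1 2) = 0) (h201 : hC.cls (1, 2) (W 0 1 2 0) = 0)
    (h210 : hC.cls (0, 2) (W 0 1 2 1) = 0)
    (h012 : ((q : ℂ) - (q : ℂ)⁻¹) * (hC.cls (0, 0) (W 0 1 0 1) + hC.cls (1, 1) (W 0 1 0 1))
      + q * hC.cls (2, 2) (W 0 1 0 1) = 0)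
    (h102 : ((q : ℂ) - (q : ℂ)⁻¹) * (hC.cls (0, 0) (W 0 1 1 0) + hC.cls (1, 1) (W 0 1 1 0))
      + q * hC.cls (2, 2) (W 0 1 1 0) = 0) : W = 0 := by
  have hq : (q : ℂ) ≠ 0 := q.ne_zero
  have h := GLq.isQuantumGroup q
  have hΩ : GLq.IsIntertwiner q (hC.intertwiner q W) := hW.sum_intertwiner hC h.isQuantumMatrix
  have h0 := hΩ.eq_zero_of_permutations
    (by simp [intertwiner, IsQuantumMatrix.rDiag, IsQuantumMatrix.rOff, Fin.sum_univ_three]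
        linear_combination h012)
    (by simp [intertwiner, IsQuantumMatrix.rOff, h021])
    (by simp [intertwiner, IsQuantumMatrix.rDiag, IsQuantumMatrix.rOff, Fin.sum_univ_three]
        linear_combination h102)
    (by simp [intertwiner, IsQuantumMatrix.rOff, h120])
    (by simp [intertwiner, IsQuantumMatrix.rOff, h201])
    (by simp [intertwiner, IsQuantumMatrix.rOff, h210])
  -- The intertwiner determines the classes: off-diagonal ones are its entries up to order, while
  -- diagonal ones solve a triangular system with pivot q.
  have hcls (i k j l a b : Fin 3) : hC.cls (a, b) (W i k j l) = 0 := by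
    by_cases hab : a = b
    · have e0 := h0 i k 0 j l 0
      have e1 := h0 i k 1 j l 1
      have e2 := h0 i k 2 j l 2
      simp [intertwiner, IsQuantumMatrix.rDiag, IsQuantumMatrix.rOff, Fin.sum_univ_three]
        at e0 e1 e2
      rw [e0, mul_zero, zero_add] at e1
      have e1' := (mul_eq_zero.1 e1).resolve_left hq
      simp only [e0, e1', mul_zero, zero_add] at e2
      have e2' := (mul_eq_zero.1 e2).resolve_left hq
      subst hab
      match a with
      | 0 => exact e0
      | 1 => exact e1'
      | 2 => exact e2'
    · have e := h0 i k b j l a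
      simpa [intertwiner, IsQuantumMatrix.rOff, hab, Ne.symm hab] using e
  funext i k j l
  rw [Pi.zero_apply, Pi.zero_apply, Pi.zero_apply, Pi.zero_apply, ← hC.sum_coord_smul (W i k j l)]
  refine Finset.sum_eq_zero fun p _ => ?_
  rw [← hC.sum_leftCoord_mul_antipode h p.1 p.2]
  simp [hW.left, hcls]

/-- The products of matrix entries with differentials on the left are covariant. -/
theorem IsBicovariant.isCovariant_op_smul_d {A : Type} [Ring A] [Bialgebra ℂ A] {q : ℂˣ}
    {z : Fin 3 → Fin 3 → A} {w : A} (h : IsQuantumGroup q z w) {C : Calculus.{u} A}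
    (hb : C.IsBicovariant) (hC : C.HasBasis z) :
    hC.IsCovariant fun i k j l => op (z k l) • C.d (z i j) := by
  -- By the Leibniz rule this tensor is d(Z₁Z₂) − Z₁dZ₂. For the first term, bicovariance of d gives
  -- the claim directly.
  have hX (i k j l : Fin 3) : op (z k l) • C.d (z i j)
      = C.d (z i j * z k l) - z i j • C.d (z k l) := by
    rw [C.leibniz, add_sub_cancel_right]
  have hd : hC.IsCovariant fun i k j l => C.d (z i j * z k l) := by
    obtain ⟨⟨ΔL, hL⟩, ⟨ΔR, hR⟩⟩ := hb
    have hc (i k j l : Fin 3) : Coalgebra.comul (R := ℂ) (z i j * z k l)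
        = ∑ r, ∑ s, (z i r * z k s) ⊗ₜ[ℂ] (z r j * z s l) := by
      rw [Bialgebra.comul_mul, h.comul_z, h.comul_z, Finset.sum_mul_sum]
      simp only [Algebra.TensorProduct.tmul_mul_tmul]
    have hL' (e b : Fin 3) (ρ : C.Form) : hC.leftCoord e b ρ
        = TensorProduct.rid ℂ A ((hC.cls (e, b)).lTensor A (ΔL ρ)) := by
      conv_rhs => rw [← hC.sum_coord_smul ρ]
      simp only [map_sum, hL, h.comul_z, TensorProduct.map_tmul, hC.rid_lTensor_cls,
        hC.cls_d, HasBasis.leftCoord_apply, Coalgebra.lTensor_counit_comul, TensorProduct.rid_tmul, one_smul,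
        LinearMap.id_apply, Prod.ext_iff, ite_and, ite_smul, zero_smul, Fintype.sum_prod_type,
        Finset.sum_ite_eq', Finset.mem_univ, if_true]
    have hR' (a e : Fin 3) (ρ : C.Form) : hC.rightCoord a e ρ
        = TensorProduct.lid ℂ A ((hC.cls (a, e)).rTensor A (ΔR ρ)) := by
      conv_rhs => rw [← hC.sum_coord_smul ρ]
      simp only [map_sum, hR, h.comul_z, TensorProduct.map_tmul, hC.lid_rTensor_cls,
        hC.cls_d, HasBasis.rightCoord_apply, Coalgebra.rTensor_counit_comul, TensorProduct.lid_tmul, one_smul,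
        LinearMap.id_apply, Prod.ext_iff, ite_and, ite_smul, zero_smul, Fintype.sum_prod_type,
        Finset.sum_ite_eq', Finset.mem_univ, if_true, Finset.sum_ite_irrel, Finset.sum_const_zero]
    constructor
    · intro i k j l e b
      have e1 := hL 1 (z i j * z k l)
      rw [one_smul] at e1
      rw [hL', e1, hc]
      simp only [map_sum, TensorProduct.map_tmul, hC.rid_lTensor_cls, LinearMap.id_apply,
        Coalgebra.lTensor_counit_comul, TensorProduct.rid_tmul, one_smul, one_mul, prod]
    · intro i k j l a e
      have e1 := hR 1 (z i j * z k l)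
      rw [one_smul] at e1
      rw [hR', e1, hc]
      simp only [map_sum, TensorProduct.map_tmul, hC.lid_rTensor_cls, LinearMap.id_apply,
        Coalgebra.rTensor_counit_comul, TensorProduct.lid_tmul, one_smul, one_mul, prod]
  simpa only [hX, Pi.sub_def] using hd.sub (hC.isCovariant_smul_d h)

end Calculus

/-! ## Classification of the bicovariant calculi -/

namespace Calculus

open Braid
open IsQuantumMatrix (rDiag rOff)

/-- Right multiplication descends to the nine-dimensional fibre at the unit, where every element of
the algebra acts by a matrix of numbers. Relations of the algebra thus become polynomial identities
between structure constants. -/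
theorem HasBasis.cls_op_smul {A : Type} [Ring A] [Bialgebra ℂ A] {z : Fin 3 → Fin 3 → A}
    {C : Calculus.{u} A} (hC : C.HasBasis z) (p : Fin 3 × Fin 3) (a : A) (ρ : C.Form) :
    hC.cls p (op a • ρ) = ∑ r, hC.cls r ρ * hC.cls p (op a • C.d (z r.1 r.2)) := by
  conv_lhs => rw [← hC.sum_coord_smul ρ]
  simp only [Finset.smul_sum, map_sum, fun (c : A) (x : C.Form) =>
    (smul_comm c (op a) x).symm, hC.cls_smul]
  rfl

section

variable {A : Type} [Ring A] [Bialgebra ℂ A] {q : ℂˣ} {z : Fin 3 → Fin 3 → A} {w : A}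
  {C : Calculus.{u} A} (hC : C.HasBasis z) (r : Fin 3 → Fin 3 → ℂ)
include hC

/-- The classes of a combination of the four tensors built from products with differentials. -/
theorem HasBasis.cls_combination (h : IsQuantumGroup q z w) (a00 a10 a01 a11 : ℂ)
    (i k j l a b : Fin 3) :
    hC.cls (a, b) (a00 • z i j • C.d (z k l)
      + a10 • actL r (fun i k j l => z i j • C.d (z k l)) i k j l
      + a01 • actR r (fun i k j l => z i j • C.d (z k l)) i k j l
      + a11 • actL r (actR r fun i k j l => z i j • C.d (z k l)) i k j l)
    = (if i = j then 1 else 0) * (if (k, l) = (a, b) then 1 else 0)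
        * (a00 + a10 * r i k + a01 * r j l + a11 * r i k * r j l)
      + (if k = j then 1 else 0) * (if (i, l) = (a, b) then 1 else 0)
        * (rOff i k * (a10 + a11 * r j l))
      + (if i = l then 1 else 0) * (if (k, j) = (a, b) then 1 else 0)
        * (rOff j l * (a01 + a11 * r i k))
      + (if k = l then 1 else 0) * (if (i, j) = (a, b) then 1 else 0)
        * (rOff i k * rOff j l * a11) := by
  simp only [actL, actR, map_add, map_smul, hC.cls_smul, hC.cls_d, h.counit_z, smul_eq_mul]
  ring

theorem HasBasis.cls_prod_smul_trTheta (h : IsQuantumGroup q z w) (b1 b2 : ℂ)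
    (i k j l a b : Fin 3) :
    hC.cls (a, b) ((b1 • prod z i k j l + b2 • actL r (prod z) i k j l) •
      C.trTheta q z (antipodeMatrix q z w))
    = (if a = b then weight q a else 0)
      * ((if i = j then 1 else 0) * (if k = l then 1 else 0) * (b1 + b2 * r i k)
        + (if k = j then 1 else 0) * (if i = l then 1 else 0) * (b2 * rOff i k)) := by
  simp only [actL, prod, map_add, map_smul, hC.cls_smul, hC.cls_trTheta h, h.counit_z, smul_eq_mul,
    Bialgebra.counit_mul]
  ring

end

variable {q : ℂˣ} {C : Calculus.{u} (GLq q)}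

/-- A covariant tensor is zero once six linear functionals vanish on it. There are six covariant
tensors at hand, and the values of the six functionals on them form an invertible triangular system.
-/
theorem IsBicovariant.exists_expansion (hb : C.IsBicovariant) (hC : C.HasBasis (GLq.z q)) :
    ∃ a00 a10 a01 a11 b1 b2 : ℂ, ∀ i k j l, op (GLq.z q k l) • C.d (GLq.z q i j) =
      (a00 • GLq.z q i j • C.d (GLq.z q k l)
      + a10 • actL (rDiag q) (fun i k j l => GLq.z q i j • C.d (GLq.z q k l)) i k j l
      + a01 • actR (rDiag q) (fun i k j l => GLq.z q i j • C.d (GLq.z q k l)) i k j l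
      + a11 • actL (rDiag q) (actR (rDiag q) fun i k j l => GLq.z q i j • C.d (GLq.z q k l)) i k j l)
      + (b1 • prod (GLq.z q) i k j l + b2 • actL (rDiag q) (prod (GLq.z q)) i k j l) •
        C.trTheta q (GLq.z q) (GLq.antipodeZ q) := by
  have hq : (q : ℂ) ≠ 0 := q.ne_zero
  have h := GLq.isQuantumGroup q
  have hM := h.isQuantumMatrix
  let X : Fin 3 → Fin 3 → Fin 3 → Fin 3 → C.Form :=
    fun i k j l => op (GLq.z q k l) • C.d (GLq.z q i j)
  let Y : Fin 3 → Fin 3 → Fin 3 → Fin 3 → C.Form := fun i k j l => GLq.z q i j • C.d (GLq.z q k l)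
  let T : Fin 3 → Fin 3 → Fin 3 → Fin 3 → C.Form :=
    fun i k j l => prod (GLq.z q) i k j l • C.trTheta q (GLq.z q) (GLq.antipodeZ q)
  have hX : hC.IsCovariant X := hb.isCovariant_op_smul_d h hC
  have hY : hC.IsCovariant Y := hC.isCovariant_smul_d h
  have hT : hC.IsCovariant T := hC.isCovariant_prod_smul_trTheta h
  set lam : ℂ := (q : ℂ) - (q : ℂ)⁻¹ with hlam
  -- At these indices only the tensor with R on both sides contributes. The next three classes bring
  -- in one further unknown each.
  obtain ⟨a11, h11⟩ : ∃ x, x = hC.cls (0, 2) (X 0 1 2 1) := ⟨_, rfl⟩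
  obtain ⟨a01, h01⟩ : ∃ x, x = hC.cls (1, 2) (X 0 1 2 0) - lam * a11 := ⟨_, rfl⟩
  obtain ⟨a10, h10⟩ : ∃ x, x = hC.cls (0, 2) (X 0 1 1 2) - lam * a11 := ⟨_, rfl⟩
  obtain ⟨a00, h00⟩ : ∃ x, x = hC.cls (1, 2) (X 0 1 0 2) - lam * (a10 + a01) - lam ^ 2 * a11 :=
    ⟨_, rfl⟩
  -- The functional occurring in the diagonal entries of the intertwiner. Its value on τ is λ(q⁴ +
  -- q²) + q = q⁵, whence the normalization of b1 and b2.
  let Φ : C.Form → ℂ := fun ρ => lam * (hC.cls (0, 0) ρ + hC.cls (1, 1) ρ) + q * hC.cls (2, 2) ρ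
  let V : Fin 3 → Fin 3 → Fin 3 → Fin 3 → C.Form := a00 • Y + a10 • actL (rDiag q) Y
    + a01 • actR (rDiag q) Y + a11 • actL (rDiag q) (actR (rDiag q) Y)
  obtain ⟨b2, h2⟩ : ∃ x, x = ((q : ℂ) ^ 5)⁻¹ * Φ (X 0 1 1 0 - V 0 1 1 0) := ⟨_, rfl⟩
  obtain ⟨b1, h1⟩ : ∃ x, x = ((q : ℂ) ^ 5)⁻¹ * Φ (X 0 1 0 1 - V 0 1 0 1) - lam * b2 := ⟨_, rfl⟩
  have hV : hC.IsCovariant V := ((hY.smul a00).add ((hY.actL hM .second).smul a10)).add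
    ((hY.actR hM .second).smul a01) |>.add (((hY.actR hM .second).actL hM .second).smul a11)
  have hW := (hX.sub hV).sub ((hT.smul b1).add ((hT.actL hM .second).smul b2))
  have hVc (i k j l a b) : hC.cls (a, b) (V i k j l) = _ :=
    hC.cls_combination (rDiag q) h a00 a10 a01 a11 i k j l a b
  have hTc (i k j l a b) : hC.cls (a, b)
      ((b1 • T + b2 • actL (Family.second.coeff q) T) i k j l) = _ :=
    (congrArg (hC.cls (a, b)) (by
      simp only [T, Pi.add_apply, Pi.smul_apply, actL, add_smul, smul_assoc, smul_add]; rfl)).trans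
    (hC.cls_prod_smul_trTheta (rDiag q) h b1 b2 i k j l a b)
  have hx : ∀ i k j l a b, hC.cls (a, b) ((X - V - (b1 • T + b2 • actL (Family.second.coeff q) T))
      i k j l) = hC.cls (a, b) (X i k j l) - hC.cls (a, b) (V i k j l)
        - hC.cls (a, b) ((b1 • T + b2 • actL (Family.second.coeff q) T) i k j l) := by
    intro i k j l a b
    rw [Pi.sub_apply, Pi.sub_apply, Pi.sub_apply, Pi.sub_apply, map_sub, Pi.sub_apply, Pi.sub_apply,
      Pi.sub_apply, Pi.sub_apply, map_sub]
  have h0 := hW.eq_zero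
    (by rw [hx, hVc, hTc]; simp [rDiag, rOff]; linear_combination -h00)
    (by rw [hx, hVc, hTc]; simp [rDiag, rOff]; linear_combination -h10)
    (by rw [hx, hVc, hTc]; simp [rDiag, rOff]; linear_combination -h01)
    (by rw [hx, hVc, hTc]; simp [rDiag, rOff]; linear_combination -h11)
    (by
      simp only [hx, hTc]
      simp [rDiag, rOff, weight]
      simp only [Φ, map_sub, hlam] at h1
      field_simp at h1 ⊢
      linear_combination -h1)
    (by
      simp only [hx, hTc]
      simp [rDiag, rOff, weight]
      simp only [Φ, map_sub, hlam] at h2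
      field_simp at h2 ⊢
      linear_combination -h2)
  rw [sub_sub, sub_eq_zero] at h0
  refine ⟨a00, a10, a01, a11, b1, b2, fun i k j l => ?_⟩
  refine (congrFun (congrFun (congrFun (congrFun h0 i) k) j) l).trans
    (congrArg (V i k j l + ·) ?_)
  simp only [T, Pi.add_apply, Pi.smul_apply, actL, add_smul, smul_assoc, smul_add]
  rfl

/-- The commutation relations in terms of the braid operator of one of the families. -/
def IsExpanded (q : ℂˣ) (ν : Family) (t b1 b2 : ℂ) (C : Calculus.{u} (GLq q)) : Prop :=
  ∀ i k j l, op (GLq.z q k l) • C.d (GLq.z q i j) =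
    ((t - 1) • GLq.z q i j • C.d (GLq.z q k l)
      + t • actL (ν.coeff q) (actR (ν.coeff q) fun i k j l => GLq.z q i j • C.d (GLq.z q k l)) i k j l)
    + (b1 • prod (GLq.z q) i k j l + b2 • actL (ν.coeff q) (prod (GLq.z q)) i k j l) •
      C.trTheta q (GLq.z q) (GLq.antipodeZ q)

/-- Consistency of d with R Z₁Z₂ = Z₁Z₂ R makes the two one-sided coefficients equal and fixes a00.
One row relation in the fibre then gives a01(a01 + (q − q⁻¹)a11) = 0. With a11 = t, the first root
leaves R on both sides, and the second completes the expression to R − (q − q⁻¹), the inverse of R,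
on both sides. -/
theorem IsBicovariant.exists_isExpanded (hb : C.IsBicovariant) (hC : C.HasBasis (GLq.z q)) :
    ∃ (ν : Family) (t b1 b2 : ℂ), C.IsExpanded q ν t b1 b2 := by
  have hq : (q : ℂ) ≠ 0 := q.ne_zero
  have h := GLq.isQuantumGroup q
  obtain ⟨a00, a10, a01, a11, b1, b2, hX⟩ := hb.exists_expansion hC
  set lam : ℂ := (q : ℂ) - (q : ℂ)⁻¹ with hlam
  have hX' (i k j l a b) : hC.cls (a, b) (op (GLq.z q k l) • C.d (GLq.z q i j)) = _ + _ :=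
    (congrArg (hC.cls (a, b)) (hX i k j l)).trans ((map_add (hC.cls (a, b)) _ _).trans
      (congrArg₂ _ (hC.cls_combination (rDiag q) h a00 a10 a01 a11 i k j l a b)
        (hC.cls_prod_smul_trTheta (rDiag q) h b1 b2 i k j l a b)))
  have hlin (i k j l a b) : hC.cls (a, b)
      (actL (rDiag q) (fun i k j l => C.d (prod (GLq.z q) i k j l)) i k j l)
      = hC.cls (a, b) (actR (rDiag q) (fun i k j l => C.d (prod (GLq.z q) i k j l)) i k j l) := by
    have e := congrArg (fun T => hC.cls (a, b) (C.d (T i k j l)))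
      (actL_prod h.isQuantumMatrix .second)
    simpa only [actL, actR, map_add, map_smul, Family.coeff] using e
  have e1 := hlin 1 0 2 0 1 2
  have e2 := hlin 0 1 2 0 1 2
  simp only [actL, actR, prod, C.leibniz, map_add, map_smul, hX', hC.cls_smul, hC.cls_d,
    h.counit_z] at e1 e2
  simp [rDiag, rOff] at e1 e2
  -- The relation z 0 0 · z 0 1 = q z 0 1 · z 0 0 acts on the class of dz 1 2. At (0, 2) the terms
  -- with τ drop out and only a01 and a11 survive.
  have hrow : hC.cls (0, 2) (op (GLq.z q 0 0 * GLq.z q 0 1) • C.d (GLq.z q 1 2))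
      = q * hC.cls (0, 2) (op (GLq.z q 0 1 * GLq.z q 0 0) • C.d (GLq.z q 1 2)) := by
    rw [h.isQuantumMatrix.row 0 0 1 (by decide), MulOpposite.op_smul, smul_assoc, map_smul,
      smul_eq_mul]
  have hM1 (p) : hC.cls p (op (GLq.z q 0 0) • C.d (GLq.z q 1 2))
      = if (1, 2) = p then a11 else 0 := by
    rw [hX']
    simp [rDiag, rOff]
  have hM2 (p) : hC.cls p (op (GLq.z q 0 1) • C.d (GLq.z q 1 2))
      = if (0, 2) = p then a01 else 0 := by
    rw [hX']
    simp [rDiag, rOff]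
  have hM3 : hC.cls (0, 2) (op (GLq.z q 0 0) • C.d (GLq.z q 0 2)) = a01 + q * a11 := by
    rw [hX']
    simp [rDiag, rOff, mul_comm]
  simp only [MulOpposite.op_mul, mul_smul, hC.cls_op_smul _ (GLq.z q 0 1)
    (op (GLq.z q 0 0) • C.d (GLq.z q 1 2)), hC.cls_op_smul _ (GLq.z q 0 0)
    (op (GLq.z q 0 1) • C.d (GLq.z q 1 2)), hM1, hM2, ite_mul, zero_mul, Fintype.sum_ite_eq, hM3,
    if_true] at hrow
  obtain ⟨act, hact⟩ : ∃ act : GLq q →ₗ[ℂ] C.Form →ₗ[ℂ] C.Form, ∀ a ρ, a • ρ = act a ρ :=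
    ⟨C.leftAction, fun _ _ => rfl⟩
  have hquad : a01 * (a01 + lam * a11) = 0 := by
    rw [hlam]
    field_simp
    linear_combination -hrow
  have ha00 : a00 = a11 - 1 - lam * a01 := by
    rw [← e1] at e2
    linear_combination -e2
  subst e1
  rcases mul_eq_zero.1 hquad with h0 | h0
  · refine ⟨.second, a11, b1, b2, fun i k j l => ?_⟩
    rw [hX, ha00, h0]
    simp only [zero_smul, add_zero, mul_zero, sub_zero]
    rfl
  · have h1 : a01 = -(lam * a11) := eq_neg_of_add_eq_zero_left h0
    refine ⟨.first, a11, b1 + lam * b2, b2, fun i k j l => ?_⟩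
    rw [hX, ha00, h1]
    simp only [actL, actR, Family.coeff, hact, map_add, map_smul, LinearMap.add_apply,
      LinearMap.smul_apply, ← hlam]
    module

/-- The matrices of right multiplication on the fibre must respect the row relations of the quantum
matrix. Two of these identities already determine the coefficients of τ as soon as κ ≠ 0. -/
theorem IsExpanded.trace_coeff {ν : Family} {t b1 b2 : ℂ} (he : C.IsExpanded q ν t b1 b2)
    (hC : C.HasBasis (GLq.z q)) :
    (t - 1) ^ 2 + b1 * ν.kappa q t = 0 ∧ b2 * ν.kappa q t = -(ν.hecke q * t * (t - 1)) := by
  have hq : (q : ℂ) ≠ 0 := q.ne_zero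
  have h := GLq.isQuantumGroup q
  have hX (i k j l a b) : hC.cls (a, b) (op (GLq.z q k l) • C.d (GLq.z q i j)) = _ + _ :=
    (congrArg (hC.cls (a, b)) ((he i k j l).trans (congrArg (· + _) (show _ =
      ((t - 1) • GLq.z q i j • C.d (GLq.z q k l)
        + (0 : ℂ) • actL (ν.coeff q) (fun i k j l => GLq.z q i j • C.d (GLq.z q k l)) i k j l
        + (0 : ℂ) • actR (ν.coeff q) (fun i k j l => GLq.z q i j • C.d (GLq.z q k l)) i k j l
        + t • actL (ν.coeff q) (actR (ν.coeff q) fun i k j l => GLq.z q i j • C.d (GLq.z q k l))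
          i k j l) by
      rw [zero_smul, zero_smul, add_zero, add_zero])))).trans ((map_add (hC.cls (a, b)) _ _).trans
      (congrArg₂ _ (hC.cls_combination (ν.coeff q) h (t - 1) 0 0 t i k j l a b)
        (hC.cls_prod_smul_trTheta (ν.coeff q) h b1 b2 i k j l a b)))
  have hrow (k l m i j a b) (hlm : l < m) :
      ∑ p : Fin 3 × Fin 3, hC.cls p (op (GLq.z q k l) • C.d (GLq.z q i j))
        * hC.cls (a, b) (op (GLq.z q k m) • C.d (GLq.z q p.1 p.2))
      = q * ∑ p : Fin 3 × Fin 3, hC.cls p (op (GLq.z q k m) • C.d (GLq.z q i j))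
        * hC.cls (a, b) (op (GLq.z q k l) • C.d (GLq.z q p.1 p.2)) := by
    rw [← hC.cls_op_smul, ← hC.cls_op_smul, ← mul_smul, ← mul_smul, ← MulOpposite.op_mul,
      ← MulOpposite.op_mul, h.isQuantumMatrix.row k l m hlm, MulOpposite.op_smul, smul_assoc,
      map_smul, smul_eq_mul]
  -- Row relations acting on dz 2 2 and dz 2 1, read off at the classes (0, 1) and (1, 0).
  have e1 := hrow 0 0 1 2 2 0 1 (by decide)
  have e2 := hrow 1 0 2 2 1 1 0 (by decide)
  simp only [Fintype.sum_prod_type, Fin.sum_univ_three, hX] at e1 e2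
  cases ν
  · simp [Family.coeff, rDiag, rOff, weight] at e1 e2
    have h2 : b2 * Family.kappa q .first t = -(Family.hecke q .first * t * (t - 1)) := by
      simp only [Family.kappa, Family.hecke, Family.trace]
      linear_combination (norm := (field_simp; ring)) -(q : ℂ)⁻¹ * e2
    refine ⟨?_, h2⟩
    simp only [Family.kappa, Family.hecke, Family.trace] at h2 ⊢
    linear_combination (norm := (field_simp; ring)) e1 - ((q : ℂ)⁻¹ - q) * h2
  · simp [Family.coeff, rDiag, rOff, weight] at e1 e2
    simp only [Family.kappa, Family.hecke, Family.trace]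
    constructor
    · linear_combination (norm := (field_simp; ring)) e1
    · linear_combination (norm := (field_simp; ring)) e2

/-- For t = 0 right multiplication by every entry would kill the class of dz 0 1, hence so would the
determinant, which is invertible. -/
theorem IsExpanded.parameter_ne_zero {ν : Family} {t b1 b2 : ℂ} (he : C.IsExpanded q ν t b1 b2)
    (hC : C.HasBasis (GLq.z q)) (hκ : ν.kappa q 0 ≠ 0) : t ≠ 0 := by
  have h := GLq.isQuantumGroup q
  rintro rfl
  have h2 : b2 = 0 := by
    have := (he.trace_coeff hC).2
    rw [mul_zero, zero_mul, neg_zero] at this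
    exact (mul_eq_zero.1 this).resolve_right hκ
  subst h2
  have h0 (p k l) : hC.cls p (op (GLq.z q k l) • C.d (GLq.z q 0 1)) = 0 := by
    rw [he]
    simp [hC.cls_smul, h.counit_z, prod]
  have h1 (p a b c k l) : hC.cls p (op (GLq.z q k l * a * b) • C.d (GLq.z q 0 1)) = c * 0 := by
    rw [MulOpposite.op_mul, MulOpposite.op_mul, mul_smul, mul_smul, hC.cls_op_smul]
    simp [hC.cls_op_smul _ _ (op (GLq.z q k l) • C.d (GLq.z q 0 1)), h0]
  have hD (p) : hC.cls p (op (qdet q (GLq.z q)) • C.d (GLq.z q 0 1)) = 0 := by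
    simp [qdet, MulOpposite.op_add, MulOpposite.op_sub, MulOpposite.op_smul, add_smul, sub_smul,
      smul_assoc, -MulOpposite.op_mul, h1 p _ _ 0]
  have h3 : hC.cls (0, 1) (op (qdet q (GLq.z q) * GLq.dinv q) • C.d (GLq.z q 0 1)) = 0 := by
    rw [MulOpposite.op_mul, mul_smul, hC.cls_op_smul]
    simp [hD]
  rw [h.qdet_mul, MulOpposite.op_one, one_smul, hC.cls_d, if_pos rfl] at h3
  exact one_ne_zero h3

/-- The bicovariant calculi with nine independent differentials are those of the two families. -/
theorem IsBicovariant.exists_isBraided (hb : C.IsBicovariant) (hC : C.HasBasis (GLq.z q))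
    (hq : (q : ℂ) ^ 2 ≠ 1) : ∃ (ν : Family) (t : ℂ), Admissible q ν t ∧
      C.IsBraided q (GLq.z q) (GLq.antipodeZ q) ν t := by
  obtain ⟨ν, t, b1, b2, he⟩ := hb.exists_isExpanded hC
  obtain ⟨h1, h2⟩ := he.trace_coeff hC
  -- Admissibility is automatic: κ = 0 would force (t − 1)² = 0, but at t = 1 the value of κ is
  -- μ·trace, which is nonzero since q² ≠ 1.
  have hκ : ν.kappa q t ≠ 0 := by
    intro h0
    rw [h0, mul_zero, add_zero] at h1
    have ht : t = 1 := sub_eq_zero.1 (pow_eq_zero_iff two_ne_zero |>.1 h1)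
    rw [ht, Family.kappa, sub_self, zero_mul, zero_add, one_mul] at h0
    exact mul_ne_zero (Family.hecke_ne_zero hq ν) (Family.trace_ne_zero q ν) h0
  have ht : t ≠ 0 := by
    rintro rfl
    exact he.parameter_ne_zero hC hκ rfl
  refine ⟨ν, t, (Family.admissible_iff q ν t).2 ⟨ht, hκ⟩, fun i k j l => ?_⟩
  have hb1 : b1 = -((ν.kappa q t)⁻¹ * (t - 1) ^ 2) := by
    field_simp
    linear_combination h1
  have hb2 : b2 = -((ν.kappa q t)⁻¹ * (t * (t - 1) * ν.hecke q)) := by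
    field_simp
    linear_combination h2
  rw [he, hb1, hb2]
  refine (congrArg₂ _ (add_comm _ _) ?_).trans (sub_eq_add_neg _ _).symm
  rw [← smul_assoc, ← neg_smul]
  congr 1
  module

end Calculus

/-! ## Calculi over `GL_q(3)` and their quotients -/

theorem antipodeMatrix_map {A B : Type} [Ring A] [Algebra ℂ A] [Ring B] [Algebra ℂ B] (q : ℂˣ)
    (z : Fin 3 → Fin 3 → A) (w : A) (f : A →ₐ[ℂ] B) :
    (antipodeMatrix q z w).map f = antipodeMatrix q (fun i j => f (z i j)) (f w) := by
  refine Matrix.ext fun i j => ?_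
  fin_cases i <;> fin_cases j <;> simp [antipodeMatrix]

namespace Calculus

variable {q : ℂˣ} {ν : Family} {t : ℂ}

theorem IsBraided.equivalent {A : Type} [Ring A] [Bialgebra ℂ A] {z : Fin 3 → Fin 3 → A} {w : A}
    {S : Matrix (Fin 3) (Fin 3) A} {C : Calculus.{u} A} {C' : Calculus.{v} A}
    (h : IsQuantumGroup q z w) (ht : Admissible q ν t) (hC : C.HasBasis z) (hC' : C'.HasBasis z)
    (hb : C.IsBraided q z S ν t) (hb' : C'.IsBraided q z S ν t) : C.Equivalent C' :=
  have hκ := ((Family.admissible_iff q ν t).1 ht).2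
  IsGamma.equivalent h hC hC' (hb.isGamma h.isQuantumMatrix hκ) (hb'.isGamma h.isQuantumMatrix hκ)

/-- The quantum determinant commutes with the forms up to a factor. -/
theorem IsBraided.op_qdet_smul {C : Calculus.{u} (GLq q)} (hq : (q : ℂ) ^ 2 ≠ 1)
    (ht : Admissible q ν t) (hC : C.HasBasis (GLq.z q))
    (hb : C.IsBraided q (GLq.z q) (GLq.antipodeZ q) ν t) (ρ : C.Form) :
    op (qdet q (GLq.z q)) • ρ = (t ^ 3 * ν.base q ^ 2) • qdet q (GLq.z q) • ρ := by
  have hm := Family.isAction_glHom hq ht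
  obtain ⟨ζ, h1, h2, -⟩ := IsBraided.equivalent (GLq.isQuantumGroup q) ht hC hm.hasBasis hb
    hm.isBraided
  refine ζ.injective ?_
  rw [h2, map_smul, h1, hm.op_qdet_smul GLq.comulHom_qdet]

/-- Let ρD = cDρ with c = t³·base². The involution fixes D and reverses the products, so applying it
to this relation and using the relation again gives c̄c = 1. -/
theorem IsStarCalculus.norm_eq_one {C : Calculus.{u} (GLq q)} (hq : ‖(q : ℂ)‖ = 1)
    (hq' : (q : ℂ) ^ 2 ≠ 1) (ht : Admissible q ν t) (hC : C.HasBasis (GLq.z q))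
    (hb : C.IsBraided q (GLq.z q) (GLq.antipodeZ q) ν t) (hs : C.IsStarCalculus (GLq.star hq)) :
    ‖t‖ = 1 := by
  obtain ⟨σ, -, h1, h2, h3⟩ := hs
  have h := GLq.isQuantumGroup q
  set D := qdet q (GLq.z q)
  set c := t ^ 3 * ν.base q ^ 2 with hc
  have hD : GLq.star hq D = D := congrArg ConjOp.get (GLq.starHom_qdet hq)
  have e := congrArg σ (hb.op_qdet_smul hq' ht hC (C.d (GLq.z q 0 0)))
  rw [h2, LinearMap.map_smulₛₗ, h1, h3, GLq.star_z, hD, hb.op_qdet_smul hq' ht hC, smul_smul] at e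
  have e2 := congrArg (hC.cls (0, 0)) (congrArg (GLq.dinv q • ·) e)
  simp only [hC.cls_smul, map_smul, hC.cls_d, smul_eq_mul, if_true, mul_one] at e2
  have hε : Coalgebra.counit (R := ℂ) (GLq.dinv q) * Coalgebra.counit (R := ℂ) D = 1 := by
    rw [← Bialgebra.counit_mul, h.mul_qdet, Bialgebra.counit_one]
  have e3 : starRingEnd ℂ c * c = 1 := by
    linear_combination -e2 + (1 - starRingEnd ℂ c * c) * hε
  refine norm_eq_one_of_pow_three (ν := ν) hq ?_
  rw [← hc]
  have e4 := congrArg norm e3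
  rw [norm_mul, RCLike.norm_conj, norm_one] at e4
  nlinarith [norm_nonneg c]

/-- The calculi over `SL_q(3)` induced from `GL_q(3)` are those of the two families. -/
theorem IsInduced.exists_isBraided {C' : Calculus.{u} (SLq q)} (hi : C'.IsInduced)
    (hq : (q : ℂ) ^ 2 ≠ 1) : ∃ (ν : Family) (t : ℂ), Admissible q ν t ∧
      t ^ 3 * ν.base q ^ 2 = 1 ∧ C'.IsBraided q (SLq.z q) (SLq.antipodeZ q) ν t := by
  obtain ⟨-, hC', C, hb, hC, φ, h1, h2, h3⟩ := hi
  obtain ⟨ν, t, ht, hB⟩ := hb.exists_isBraided hC hq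
  refine ⟨ν, t, ht, ?_, ?_⟩
  -- In the quotient D = 1, so the commutation factor of D must be 1 because the class of dz 0 0 is
  -- nonzero.
  · have e := congrArg φ (hB.op_qdet_smul hq ht hC (C.d (GLq.z q 0 0)))
    rw [h2, map_smul, h1, h3, SLq.proj_qdet, MulOpposite.op_one, one_smul, one_smul] at e
    have e2 := congrArg (hC'.cls (0, 0)) e
    change hC'.cls (0, 0) (C'.d (SLq.z q 0 0)) = hC'.cls (0, 0) (_ • C'.d (SLq.z q 0 0)) at e2
    rw [map_smul, hC'.cls_d, if_pos rfl, smul_eq_mul, mul_one] at e2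
    exact e2.symm
  · have e : (GLq.antipodeZ q).map (SLq.proj q) = SLq.antipodeZ q := by
      refine (antipodeMatrix_map q (GLq.z q) (GLq.dinv q) (SLq.proj q)).trans ?_
      rw [SLq.proj_dinv]
      rfl
    have := hB.map (SLq.proj q) φ h1 h2 h3
    rw [e] at this
    exact this

theorem IsInduced.exists_equivalent {C : Calculus.{u} (SLq q)} (hi : C.IsInduced)
    (hq : (q : ℂ) ^ 2 ≠ 1) : ∃ (ν : Family) (t : ℂ) (ht : Admissible q ν t)
      (h : t ^ 3 * ν.base q ^ 2 = 1), C.Equivalent (Family.isAction_slHom hq ht h).calculus := by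
  obtain ⟨ν, t, ht, h, hB⟩ := hi.exists_isBraided hq
  have hm := Family.isAction_slHom hq ht h
  exact ⟨ν, t, ht, h, IsBraided.equivalent (SLq.isQuantumGroup q) ht hi.2.1 hm.hasBasis hB
    hm.isBraided⟩

end Calculus

/-! ### The classification theorem -/

theorem mainTheorem6 (q : ℂˣ) (hq : ‖(q : ℂ)‖ = 1)
    (hq₁ : (q : ℂ) ∉ ({1, -1, Complex.I, -Complex.I} : Set ℂ)) :
    -- the bicovariant `*`-calculi on `GL_q(3, ℝ)` are the `Γ_ν(t)` with `|t| = 1`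
    (∀ C : Calculus.{u} (GLq q), C.IsBicovariant → C.HasBasis (GLq.z q) →
      (C.IsStarCalculus (GLq.star hq) ↔
        ∃ (ν : Family) (t : ℂ), ‖t‖ = 1 ∧ Admissible q ν t ∧
          C.IsGamma q (GLq.z q) (GLq.antipodeZ q) ν t)) ∧
    -- all these calculi exist and are determined by their commutation relations
    (∀ (ν : Family) (t : ℂ), ‖t‖ = 1 → Admissible q ν t →
      ∃ C : Calculus.{0} (GLq q), C.IsBicovariant ∧ C.HasBasis (GLq.z q) ∧
        C.IsGamma q (GLq.z q) (GLq.antipodeZ q) ν t ∧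
        ∀ C' : Calculus.{u} (GLq q), C'.IsBicovariant → C'.HasBasis (GLq.z q) →
          C'.IsGamma q (GLq.z q) (GLq.antipodeZ q) ν t → C'.Equivalent C) ∧
    -- all induced calculi on `SL_q(3, ℂ)` are `*`-calculi
    (∀ C : Calculus.{u} (SLq q), C.IsInduced → C.IsStarCalculus (SLq.star hq)) ∧
    -- the induced calculi are the `Γ_ν(t)` with `t ^ 3 = q ^ (± 2)`, and there are six of them
    (∃ Γ : (ν : Family) × slParameters q ν → Calculus.{0} (SLq q),
      (∀ p, (Γ p).IsInduced ∧
        (Γ p).IsGamma q (SLq.z q) (SLq.antipodeZ q) p.1 (p.2 : ℂ)) ∧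
      (∀ p p', (Γ p).Equivalent (Γ p') → p = p') ∧
      (∀ C : Calculus.{u} (SLq q), C.IsInduced → ∃ p, C.Equivalent (Γ p))) ∧
    ((q : ℂ) ^ 4 ≠ -1 → Nat.card ((ν : Family) × slParameters q ν) = 6) := by
  have hq2 : (q : ℂ) ^ 2 ≠ 1 := fun h => hq₁ (by
    rcases sq_eq_sq_iff_eq_or_eq_neg.1 (h.trans (one_pow 2).symm) with h | h <;> simp [h])
  have hq4 : (q : ℂ) ^ 4 ≠ 1 := by
    intro h
    have h' : ((q : ℂ) ^ 2 - 1) * (((q : ℂ) - Complex.I) * ((q : ℂ) + Complex.I)) = 0 := by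
      linear_combination h - ((q : ℂ) ^ 2 - 1) * Complex.I_sq
    rcases mul_eq_zero.1 h' with h' | h'
    · exact hq2 (sub_eq_zero.1 h')
    · rcases mul_eq_zero.1 h' with h' | h'
      · exact hq₁ (by simp [sub_eq_zero.1 h'])
      · exact hq₁ (by simp [eq_neg_of_add_eq_zero_left h'])
  refine ⟨fun C hb hC => ⟨fun hs => ?_, ?_⟩, fun ν t ht hadm => ?_, fun C hi => ?_, ?_,
    card_slParameters hq hq4⟩
  · obtain ⟨ν, t, hadm, hB⟩ := hb.exists_isBraided hC hq2
    exact ⟨ν, t, hs.norm_eq_one hq hq2 hadm hC hB, hadm, hB.isGamma (GLq.isQuantumMatrix q)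
      ((Family.admissible_iff q ν t).1 hadm).2⟩
  · rintro ⟨ν, t, ht, hadm, hg⟩
    have hm := Family.isAction_glHom hq2 hadm
    exact (Calculus.IsGamma.equivalent (GLq.isQuantumGroup q) hC hm.hasBasis hg
      hm.isGamma).isStarCalculus (hm.isStarCalculus hq ht (GLq.isStarMap hq))
  · have hm := Family.isAction_glHom hq2 hadm
    exact ⟨hm.calculus, hm.isBicovariant, hm.hasBasis, hm.isGamma, fun C' _ hC' hg' =>
      Calculus.IsGamma.equivalent (GLq.isQuantumGroup q) hC' hm.hasBasis hg' hm.isGamma⟩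
  · obtain ⟨ν, t, hadm, h, he⟩ := hi.exists_equivalent hq2
    exact he.isStarCalculus ((Family.isAction_slHom hq2 hadm h).isStarCalculus hq
      (norm_eq_one_of_pow_three hq (by rw [h, norm_one])) (SLq.isStarMap hq))
  · have hp (p : (ν : Family) × slParameters q ν) := Family.mem_slParameters.1 p.2.2
    refine ⟨fun p => (Family.isAction_slHom hq2 (hp p).1 (hp p).2).calculus, fun p =>
      ⟨Family.isInduced hq2 (hp p).1 (hp p).2, Family.IsAction.isGamma _⟩, fun p p' he => ?_,
      fun C hi => ?_⟩
    · have hm := Family.isAction_slHom hq2 (hp p).1 (hp p).2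
      have hm' := Family.isAction_slHom hq2 (hp p').1 (hp p').2
      obtain ⟨h1, h2⟩ := Calculus.IsBraided.parameters_unique (SLq.isQuantumGroup q) hq2
        hm'.hasBasis ((Family.admissible_iff q _ _).1 (hp p).1).1 (he.isBraided hm.isBraided)
        hm'.isBraided
      obtain ⟨ν, t⟩ := p
      obtain ⟨ν', t'⟩ := p'
      obtain rfl : ν = ν' := h1
      obtain rfl : t = t' := Subtype.ext h2
      rfl
    · obtain ⟨ν, t, hadm, h, he⟩ := hi.exists_equivalent hq2
      exact ⟨⟨ν, t, Family.mem_slParameters.2 ⟨hadm, h⟩⟩, he⟩
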